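/- **Setting.** Let $K$ be a field that contains $\mathbb{Q}_p$ and is complete for a non-archimedean absolute value $|\ |$ extending the $p$-adic one, let $L\subseteq K$ be a finite extension of $\mathbb{Q}_p$, and let $\mathrm{val}_L:K^\times\to\mathbb{R}$ be the additive valuation, a negative multiple of $\log|\ |$, with $\mathrm{val}_L(L^\times)=\mathbb{Z}$. Let $(X,\Phi,\Lambda,\Phi^\vee)$ be a reduced root datum with finite set of roots $\Phi\subseteq X$, where the lattices $X$ and $\Lambda$ are in perfect duality $\langle\ ,\ \rangle$, with Weyl group $W$ and the system of positive roots $\Phi^+$ given by a base (for instance the characters, roots, cocharacters and coroots of a maximal split torus in an $L$-split connected reductive group, with $\Phi^+$ given by a Borel subgroup). Write ${}^w\lambda$ for the action of $W$ on $\Lambda$, and put $\Lambda^{--}=\{\lambda\in\Lambda:\langle\alpha,\lambda\rangle\le 0\text{ for all }\alpha\in\Phi^+\}$. Let $T'$ be the dual torus over $K$, so $T'(K)=\mathrm{Hom}(\Lambda,K^\times)$ and $K[\Lambda]$ is the ring of algebraic functions on $T'$. Regard $T'$ as a rigid analytic space, whose points are the maximal ideals $x$ of $K[\Lambda]$; $|f(x)|$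 is computed in the finite extension $K[\Lambda]/x$ of $K$. Put $V_{\mathbb{R}}=\mathrm{Hom}(\Lambda,\mathbb{R})$, and let $\mathrm{val}:T'\to V_{\mathbb{R}}$ be the map $\mathrm{val}(x)(\lambda)=\mathrm{val}_L(\lambda(x))$, so that $\mathrm{val}(\zeta)=\mathrm{val}_L\circ\zeta$ for $\zeta\in T'(K)$. Let $\gamma:W\times\Lambda\to K^\times$ be a map such that, for all $v,w\in W$ and $\lambda,\mu\in\Lambda$: (a) $\gamma(w,\lambda\mu)=\gamma(w,\lambda)\gamma(w,\mu)$; (b) $\gamma(vw,\lambda)=\gamma(v,{}^w\lambda)\gamma(w,\lambda)$; (c) $|\gamma(w,\lambda)|\le 1$ if $\lambda\in\Lambda^{--}$; (d) $\gamma(w,\lambda)=1$ if ${}^w\lambda=\lambda$. Put $\gamma^{dom}(\lambda)=\gamma(w,\lambda)$ for any $w$ with ${}^w\lambda\in\Lambda^{--}$, and $\|\sum_\lambda c_\lambda\lambda\|_\gamma=\sup_\lambda|\gamma^{dom}(\lambda)c_\lambda|$ on $K[\Lambda]$. Let $K\langle\Lambda;\gamma\rangle$ be the completion of $K[\Lambda]$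 for this norm, and $K\langle\Lambda;\gamma\rangle^{W,\gamma}$ the subalgebra of invariants for the continuous extension of the twisted action $w\cdot\sum c_\lambda\lambda=\sum\gamma(w,\lambda)c_\lambda\,{}^w\lambda$. Put $z_w=-\mathrm{val}(\gamma(w^{-1},\cdot))\in V_{\mathbb{R}}$ and $$T'_\gamma(K)=\{\zeta\in T'(K):|\zeta(\lambda)|\le|\gamma^{dom}(\lambda)|\text{ for all }\lambda\in\Lambda\}.$$ **Proposition 2.4.** There is a subset $T'_\gamma$ of the rigid analytic torus $T'$ with the following properties. (i) $T'_\gamma$ is an open $K$-affinoid subdomain of $T'$. It is the rational subset given by finitely many inequalities $|\gamma^{dom}(\lambda)^{-1}\lambda(x)|\le 1$, $\lambda\in F$, with $F\subset\Lambda$ finite, and its set of $K$-valued points is $T'_\gamma(K)$. (ii) The Banach algebra $K\langle\Lambda;\gamma\rangle$, with the inclusion $K[\Lambda]\to K\langle\Lambda;\gamma\rangle$, is the ring of analytic functions on $T'_\gamma$: it is an affinoid $K$-algebra whose norm defines the canonical topology, the induced morphism $\mathrm{Sp}\,K\langle\Lambda;\gamma\rangle\to T'$ has image in $T'_\gamma$,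 and every morphism from a $K$-affinoid space to $T'$ with image in $T'_\gamma$ factors uniquely through it. (iii) $T'_\gamma$ is the preimage under $\mathrm{val}$ of the convex hull in $V_{\mathbb{R}}$ of the finitely many points $-z_w$, $w\in W$. Moreover: (iv) $K\langle\Lambda;\gamma\rangle^{W,\gamma}$ is an affinoid $K$-algebra (with its norm defining the canonical topology). -/

import Mathlib

noncomputable section

namespace AffinoidTorus

/-! ### Root datum: Weyl group action on the cocharacter lattice, antidominant cocharacters

`X` and `Λ` are the character and cocharacter lattices (`Λ = T/T₀` for a split maximal torus `T`,
where `val_L(α(t)) = ⟨α, λ(t)⟩`), and a base `b` gives the system `Φ⁺` of positive roots. -/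

section RootDatum

variable {ι X Λ : Type*} [AddCommGroup X] [AddCommGroup Λ] (P : RootDatum ι X Λ)

/-- The natural left action `λ ↦ ʷλ` of the Weyl group on the cocharacter lattice `Λ`. It is the
contragredient of the action on the character lattice `X`, see `root_weylAct`. -/
def weylAct (w : P.weylGroup) : Λ →+ Λ :=
  (RootPairing.Equiv.coweightEquiv P P ((w⁻¹ : P.weylGroup) : P.Aut)).toLinearMap.toAddMonoidHom

lemma weylAct_mul (v w : P.weylGroup) (l : Λ) :
    weylAct P (v * w) l = weylAct P v (weylAct P w l) := by
  simp only [weylAct, mul_inv_rev]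
  rfl

lemma weylAct_one (l : Λ) : weylAct P 1 l = l := by
  simp only [weylAct, inv_one]
  rfl

lemma root_weylAct (w : P.weylGroup) (i : ι) (l : Λ) :
    P.toLinearMap (P.root i) (weylAct P w l) =
      P.toLinearMap (P.root (P.weylGroupToPerm w⁻¹ i)) l := by
  have h := RootPairing.Hom.weight_coweight_transpose_apply P P l
    ((w⁻¹ : P.weylGroup) : P.Aut).toHom
  have h2 := DFunLike.congr_fun h (P.root i)
  have h3 := RootPairing.Hom.root_weightMap_apply P P i ((w⁻¹ : P.weylGroup) : P.Aut).toHom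
  simp only [LinearMap.dualMap_apply] at h2
  rw [h3] at h2
  exact h2.symm

variable {P}

/-- The antidominant cocharacters: `⟨α, λ⟩ ≤ 0` for all roots `α` positive with respect to `b`. -/
def Antidominant (b : P.Base) (l : Λ) : Prop :=
  ∀ i, b.IsPos i → P.toLinearMap (P.root i) l ≤ 0

/-- Every Weyl group orbit in `Λ` contains an antidominant cocharacter. -/
lemma exists_antidominant [Finite ι] [P.IsReduced] (b : P.Base) (l : Λ) :
    ∃ w : P.weylGroup, Antidominant b (weylAct P w l) := by
  classical
  have := Fintype.ofFinite ι
  let S : Finset ι := Finset.univ.filter fun i => b.IsPos i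
  let h : Λ → ℤ := fun m => ∑ i ∈ S, P.toLinearMap (P.root i) m
  let B : ℤ := ∑ i : ι, |P.toLinearMap (P.root i) l|
  have hB : ∀ w : P.weylGroup, 0 ≤ h (weylAct P w l) + S.card * B := by
    intro w
    have : ∀ i ∈ S, -B ≤ P.toLinearMap (P.root i) (weylAct P w l) := by
      intro i _
      rw [root_weylAct]
      have h1 : |P.toLinearMap (P.root (P.weylGroupToPerm w⁻¹ i)) l| ≤ B :=
        Finset.single_le_sum (f := fun i => |P.toLinearMap (P.root i) l|)
          (fun _ _ => abs_nonneg _) (Finset.mem_univ _)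
      have := neg_abs_le (P.toLinearMap (P.root (P.weylGroupToPerm w⁻¹ i)) l)
      linarith
    have := Finset.card_nsmul_le_sum S _ _ this
    simp only [nsmul_eq_mul] at this
    simp only [h]
    linarith
  let f : P.weylGroup → ℕ := fun w => (h (weylAct P w l) + S.card * B).toNat
  obtain ⟨w, hw⟩ : ∃ w, ∀ v, f w ≤ f v :=
    ⟨Function.argmin f, fun v => Function.argmin_le f v⟩
  refine ⟨w, ?_⟩
  set m := weylAct P w l with hm
  have key : ∀ i ∈ b.support, P.toLinearMap (P.root i) m ≤ 0 := by
    intro i hi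
    let s := RootPairing.weylGroup.ofIdx P i
    have h1 := hw (s * w)
    have h2 : h m ≤ h (weylAct P s m) := by
      have e1 := hB w
      have e2 := hB (s * w)
      simp only [f] at h1
      rw [weylAct_mul] at h1 e2
      rw [← hm] at h1 e1 e2
      omega
    have hs : ∀ j, P.toLinearMap (P.root j) (weylAct P s m) =
        P.toLinearMap (P.root (P.reflectionPerm i j)) m := by
      intro j
      rw [root_weylAct]
      have : P.weylGroupToPerm s⁻¹ j = P.reflectionPerm i j := by
        have hinv : s⁻¹ = s := Subtype.ext (RootPairing.Equiv.reflection_inv P i)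
        rw [hinv]
        rfl
      rw [this]
    have hiS : i ∈ S := by
      simp only [S, Finset.mem_filter, Finset.mem_univ, true_and]
      exact RootPairing.Base.isPos_of_mem_support hi
    have e1 : h m = P.toLinearMap (P.root i) m + ∑ j ∈ S.erase i, P.toLinearMap (P.root j) m :=
      (Finset.add_sum_erase S _ hiS).symm
    have e2 : h (weylAct P s m) = P.toLinearMap (P.root i) (weylAct P s m) +
        ∑ j ∈ S.erase i, P.toLinearMap (P.root j) (weylAct P s m) :=
      (Finset.add_sum_erase S _ hiS).symm
    have e3 : ∑ j ∈ S.erase i, P.toLinearMap (P.root j) (weylAct P s m) =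
        ∑ j ∈ S.erase i, P.toLinearMap (P.root j) m := by
      have hmem : ∀ j ∈ S.erase i, P.reflectionPerm i j ∈ S.erase i := by
        intro j hj
        simp only [S, Finset.mem_erase, Finset.mem_filter, Finset.mem_univ, true_and] at hj ⊢
        have hp := hj.2.reflectionPerm hi hj.1
        refine ⟨?_, hp⟩
        intro hji
        have hj' : j = P.reflectionPerm i i := by
          have h5 := congrArg (P.reflectionPerm i) hji
          rwa [RootPairing.reflectionPerm_self] at h5
        have := RootPairing.Base.IsPos.neg_iff_not b i
        rw [RootPairing.indexNeg_neg, ← hj'] at this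
        exact this.1 hj.2 (RootPairing.Base.isPos_of_mem_support hi)
      refine Finset.sum_bij' (fun j _ => P.reflectionPerm i j) (fun j _ => P.reflectionPerm i j)
        hmem hmem ?_ ?_ ?_
      · intro j _; simp
      · intro j _; simp
      · intro j _; exact hs j
    have e4 : P.toLinearMap (P.root i) (weylAct P s m) = - P.toLinearMap (P.root i) m := by
      rw [hs]
      simp
    linarith
  intro i hi
  refine hi.induction_on_add (p := fun i => P.toLinearMap (P.root i) m ≤ 0) key ?_
  intro i j k hk h1 h2
  rw [hk, map_add, LinearMap.add_apply]
  have := key j h2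
  linarith

end RootDatum

/-! ### Cocycles on the Weyl group and the completed twisted group ring -/

section Cocycle

variable {ι X Λ : Type*} [AddCommGroup X] [AddCommGroup Λ] {P : RootDatum ι X Λ}

/-- A cocycle `γ : W × Λ → Kˣ` on the Weyl group with values in `T'(K) = Hom(Λ, Kˣ)` which is
positive and partially trivial. The group `Λ` is written additively. -/
structure WeylCocycle (b : P.Base) (K : Type*) [NormedField K] where
  /-- the value `γ(w, λ)` -/
  toFun : P.weylGroup → Λ → Kˣ
  mul : ∀ w l m, toFun w (l + m) = toFun w l * toFun w m
  cocycle : ∀ v w l, toFun (v * w) l = toFun v (weylAct P w l) * toFun w l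
  norm_le_one : ∀ w l, Antidominant b l → ‖(toFun w l : K)‖ ≤ 1
  eq_one : ∀ w l, weylAct P w l = l → toFun w l = 1

variable {b : P.Base} {K : Type*}

instance [NormedField K] : CoeFun (WeylCocycle b K) fun _ => P.weylGroup → Λ → Kˣ :=
  ⟨WeylCocycle.toFun⟩

namespace WeylCocycle

section Basic

set_option linter.unusedSectionVars false

variable [NormedField K] (γ : WeylCocycle b K)

lemma norm_le (v w : P.weylGroup) (l : Λ) (hv : Antidominant b (weylAct P v l)) :
    ‖(γ w l : K)‖ ≤ ‖(γ v l : K)‖ := by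
  have h := γ.cocycle (w * v⁻¹) v l
  rw [inv_mul_cancel_right] at h
  rw [h, Units.val_mul, norm_mul]
  exact mul_le_of_le_one_left (norm_nonneg _) (γ.norm_le_one _ _ hv)

/-- The character `λ ↦ γ(w, λ)`, a `K`-valued point of the dual torus. -/
def char (w : P.weylGroup) : Multiplicative Λ →* Kˣ where
  toFun l := γ w l.toAdd
  map_one' := γ.eq_one _ _ (map_zero _)
  map_mul' _ _ := γ.mul _ _ _

variable [Finite ι] [P.IsReduced]

/-- `γ^dom(λ) = γ(w, λ)` for any `w` such that `ʷλ` is antidominant. -/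
def dom (l : Λ) : Kˣ := γ (exists_antidominant b l).choose l

lemma norm_le_dom (w : P.weylGroup) (l : Λ) : ‖(γ w l : K)‖ ≤ ‖(γ.dom l : K)‖ :=
  γ.norm_le _ _ _ (exists_antidominant b l).choose_spec

/-- The absolute value of `γ^dom(λ)` does not depend on the choice of `w`. -/
lemma norm_dom_eq (w : P.weylGroup) (l : Λ) (hw : Antidominant b (weylAct P w l)) :
    ‖(γ.dom l : K)‖ = ‖(γ w l : K)‖ :=
  le_antisymm (γ.norm_le _ _ _ hw) (γ.norm_le_dom _ _)

lemma norm_dom_pos (l : Λ) : 0 < ‖(γ.dom l : K)‖ := norm_pos_iff.2 (γ.dom l).ne_zero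

lemma norm_dom_add_le (l m : Λ) :
    ‖(γ.dom (l + m) : K)‖ ≤ ‖(γ.dom l : K)‖ * ‖(γ.dom m : K)‖ := by
  have h := γ.mul (exists_antidominant b (l + m)).choose l m
  rw [dom, h, Units.val_mul, norm_mul]
  gcongr <;> exact γ.norm_le_dom _ _

lemma norm_dom_zero : ‖(γ.dom (0 : Λ) : K)‖ = 1 := by
  rw [dom, γ.eq_one _ _ (map_zero _)]
  simp

lemma norm_dom_weylAct (w : P.weylGroup) (l : Λ) :
    ‖(γ.dom (weylAct P w l) : K)‖ * ‖(γ w l : K)‖ ≤ ‖(γ.dom l : K)‖ := by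
  have h := γ.cocycle (exists_antidominant b (weylAct P w l)).choose w l
  rw [dom, ← norm_mul, ← Units.val_mul, ← h]
  exact γ.norm_le_dom _ _

/-- The group ring `K[Λ]`, to be equipped with the norm `‖·‖_γ`. -/
def GroupRing (_γ : WeylCocycle b K) : Type _ := AddMonoidAlgebra K Λ

instance : CommRing γ.GroupRing := inferInstanceAs (CommRing (AddMonoidAlgebra K Λ))

instance : Algebra K γ.GroupRing := inferInstanceAs (Algebra K (AddMonoidAlgebra K Λ))

/-- `K[Λ]` as an algebra, without and with the norm. -/
def toGroupRing : AddMonoidAlgebra K Λ ≃ₐ[K] γ.GroupRing := AlgEquiv.refl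

/-- The coefficients `c_λ` of `∑ c_λ λ`. -/
def coeff (f : γ.GroupRing) : Λ →₀ K := (γ.toGroupRing.symm f).coeff

/-- `‖∑ c_λ λ‖_γ = sup_λ |γ^dom(λ) c_λ|`. -/
def gnorm (f : γ.GroupRing) : ℝ := ⨆ l : Λ, ‖(γ.dom l : K) * γ.coeff f l‖

@[simp] lemma coeff_add (f g : γ.GroupRing) : γ.coeff (f + g) = γ.coeff f + γ.coeff g := rfl

@[simp] lemma coeff_neg (f : γ.GroupRing) : γ.coeff (-f) = -γ.coeff f := rfl

@[simp] lemma coeff_zero : γ.coeff (0 : γ.GroupRing) = 0 := rfl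

@[simp] lemma coeff_smul (r : K) (f : γ.GroupRing) : γ.coeff (r • f) = r • γ.coeff f := rfl

lemma bddAbove_gnorm (f : γ.GroupRing) :
    BddAbove (Set.range fun l : Λ => ‖(γ.dom l : K) * γ.coeff f l‖) := by
  refine ⟨∑ l ∈ (γ.coeff f).support, ‖(γ.dom l : K) * γ.coeff f l‖, ?_⟩
  rintro _ ⟨l, rfl⟩
  by_cases hl : l ∈ (γ.coeff f).support
  · exact Finset.single_le_sum (f := fun l => ‖(γ.dom l : K) * γ.coeff f l‖)
      (fun _ _ => norm_nonneg _) hl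
  · simp only [Finsupp.notMem_support_iff.1 hl, mul_zero, norm_zero]
    exact Finset.sum_nonneg fun _ _ => norm_nonneg _

lemma le_gnorm (f : γ.GroupRing) (l : Λ) :
    ‖(γ.dom l : K)‖ * ‖γ.coeff f l‖ ≤ γ.gnorm f := by
  rw [← norm_mul]
  exact le_ciSup (γ.bddAbove_gnorm f) l

lemma gnorm_le (f : γ.GroupRing) (C : ℝ)
    (h : ∀ l, ‖(γ.dom l : K)‖ * ‖γ.coeff f l‖ ≤ C) : γ.gnorm f ≤ C :=
  ciSup_le fun l => by rw [norm_mul]; exact h l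

lemma gnorm_nonneg (f : γ.GroupRing) : 0 ≤ γ.gnorm f :=
  Real.iSup_nonneg fun _ => norm_nonneg _

lemma gnorm_mul_le [IsUltrametricDist K] (f g : γ.GroupRing) :
    γ.gnorm (f * g) ≤ γ.gnorm f * γ.gnorm g := by
  classical
  have hnn := mul_nonneg (γ.gnorm_nonneg f) (γ.gnorm_nonneg g)
  refine γ.gnorm_le _ _ fun n => ?_
  rw [← norm_mul]
  have hc : γ.coeff (f * g) n = (γ.coeff f).sum fun l r => (γ.coeff g).sum fun m s =>
      if l + m = n then r * s else 0 :=
    AddMonoidAlgebra.coeff_mul (γ.toGroupRing.symm f) (γ.toGroupRing.symm g) n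
  rw [hc, Finsupp.mul_sum, Finsupp.sum]
  refine IsUltrametricDist.norm_sum_le_of_forall_le_of_nonneg hnn fun l _ => ?_
  rw [Finsupp.mul_sum, Finsupp.sum]
  refine IsUltrametricDist.norm_sum_le_of_forall_le_of_nonneg hnn fun m _ => ?_
  split_ifs with h
  · subst h
    rw [norm_mul, norm_mul]
    calc _ ≤ (‖(γ.dom l : K)‖ * ‖(γ.dom m : K)‖) * (‖γ.coeff f l‖ * ‖γ.coeff g m‖) := by
          gcongr
          exact γ.norm_dom_add_le l m
      _ = (‖(γ.dom l : K)‖ * ‖γ.coeff f l‖) * (‖(γ.dom m : K)‖ * ‖γ.coeff g m‖) := by ring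
      _ ≤ _ := mul_le_mul (γ.le_gnorm f l) (γ.le_gnorm g m) (by positivity) (γ.gnorm_nonneg f)
  · simpa using hnn

variable [IsUltrametricDist K]

/-- `‖·‖_γ` is a submultiplicative norm. -/
def ringNorm : RingNorm γ.GroupRing where
  toFun := γ.gnorm
  map_zero' := le_antisymm (γ.gnorm_le _ _ fun l => by simp) (γ.gnorm_nonneg _)
  add_le' f g := γ.gnorm_le _ _ fun l => by
    calc _ ≤ ‖(γ.dom l : K)‖ * (‖γ.coeff f l‖ + ‖γ.coeff g l‖) := by
          gcongr
          exact norm_add_le _ _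
      _ ≤ _ := by
          rw [mul_add]
          exact add_le_add (γ.le_gnorm f l) (γ.le_gnorm g l)
  neg' f := by simp [gnorm]
  mul_le' := γ.gnorm_mul_le
  eq_zero_of_map_eq_zero' f hf := by
    have h : γ.coeff f = 0 := by
      ext l
      have h1 := γ.le_gnorm f l
      have hf' : γ.gnorm f = 0 := hf
      rw [hf'] at h1
      have h2 := γ.norm_dom_pos l
      have h3 : ‖γ.coeff f l‖ ≤ 0 := by
        by_contra! h4
        exact absurd (mul_pos h2 h4) (not_lt.2 h1)
      simpa using h3
    exact γ.toGroupRing.symm.injective (AddMonoidAlgebra.coeff_injective h)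

instance : NormedCommRing γ.GroupRing :=
  { γ.ringNorm.toNormedRing with mul_comm := mul_comm }

lemma norm_def (f : γ.GroupRing) : ‖f‖ = ⨆ l : Λ, ‖(γ.dom l : K) * γ.coeff f l‖ := rfl

instance : NormedAlgebra K γ.GroupRing where
  norm_smul_le r f := γ.gnorm_le _ _ fun l => by
    rw [coeff_smul, Finsupp.smul_apply, norm_smul, mul_left_comm]
    exact mul_le_mul_of_nonneg_left (γ.le_gnorm f l) (norm_nonneg r)

/-- The character `λ ↦ γ(w, λ) ʷλ` of `Λ` with values in the group ring. -/
def twistHom (w : P.weylGroup) : Multiplicative Λ →* γ.GroupRing where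
  toFun l := γ.toGroupRing (AddMonoidAlgebra.single (weylAct P w l.toAdd) (γ w l.toAdd : K))
  map_one' := by
    have h : γ w (0 : Λ) = 1 := (γ.char w).map_one
    simp only [toAdd_one, map_zero, h]
    exact map_one γ.toGroupRing
  map_mul' l m := by
    rw [← map_mul, AddMonoidAlgebra.single_mul_single, ← Units.val_mul, toAdd_mul, γ.mul, map_add]

/-- The twisted action `w · ∑ c_λ λ = ∑ γ(w, λ) c_λ ʷλ` on the group ring. -/
def twist (w : P.weylGroup) : γ.GroupRing →ₐ[K] γ.GroupRing :=
  (AddMonoidAlgebra.lift K γ.GroupRing Λ (γ.twistHom w)).comp γ.toGroupRing.symm.toAlgHom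

lemma twist_single (w : P.weylGroup) (l : Λ) (c : K) :
    γ.twist w (γ.toGroupRing (AddMonoidAlgebra.single l c)) =
      γ.toGroupRing (AddMonoidAlgebra.single (weylAct P w l) (γ w l * c)) := by
  have h := AddMonoidAlgebra.lift_single (γ.twistHom w) l c
  refine h.trans ?_
  simp only [twistHom, MonoidHom.coe_mk, OneHom.coe_mk, toAdd_ofAdd]
  rw [← map_smul, AddMonoidAlgebra.smul_single, smul_eq_mul, mul_comm]

lemma coeff_twist (w : P.weylGroup) (f : γ.GroupRing) (l : Λ) :
    γ.coeff (γ.twist w f) (weylAct P w l) = γ w l * γ.coeff f l := by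
  obtain ⟨f, rfl⟩ := γ.toGroupRing.surjective f
  induction f using AddMonoidAlgebra.induction_linear with
  | zero => simp
  | add x y hx hy => simp [hx, hy, mul_add]
  | single m c =>
    classical
    have hinj : ∀ m, weylAct P w m = weylAct P w l ↔ m = l := by
      refine fun m => ⟨fun h => ?_, fun h => by rw [h]⟩
      have := congrArg (weylAct P w⁻¹) h
      simpa [← weylAct_mul, weylAct_one] using this
    rw [twist_single]
    simp only [coeff, AlgEquiv.symm_apply_apply, AddMonoidAlgebra.coeff_single,
      Finsupp.single_apply, hinj]
    split_ifs with h
    · rw [h]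
    · simp

lemma norm_twist_le (w : P.weylGroup) (f : γ.GroupRing) : ‖γ.twist w f‖ ≤ ‖f‖ := by
  refine γ.gnorm_le _ _ fun n => ?_
  obtain ⟨l, rfl⟩ : ∃ l, weylAct P w l = n :=
    ⟨weylAct P w⁻¹ n, by rw [← weylAct_mul, mul_inv_cancel, weylAct_one]⟩
  rw [coeff_twist, norm_mul, ← mul_assoc]
  exact (mul_le_mul_of_nonneg_right (γ.norm_dom_weylAct w l) (norm_nonneg _)).trans
    (γ.le_gnorm f l)

lemma continuous_twist (w : P.weylGroup) : Continuous (γ.twist w) :=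
  AddMonoidHomClass.continuous_of_bound (γ.twist w) 1 fun f => by
    rw [one_mul]; exact γ.norm_twist_le w f

/-- The Banach algebra `K⟨Λ; γ⟩`, the completion of `K[Λ]` with respect to `‖·‖_γ`. -/
abbrev BanachAlgebra : Type _ := UniformSpace.Completion γ.GroupRing

/-- The inclusion `K[Λ] → K⟨Λ; γ⟩`. -/
def incl : AddMonoidAlgebra K Λ →ₐ[K] γ.BanachAlgebra where
  toRingHom := UniformSpace.Completion.coeRingHom.comp γ.toGroupRing.toRingEquiv.toRingHom
  commutes' r := by
    change ((γ.toGroupRing (algebraMap K _ r) : γ.GroupRing) : γ.BanachAlgebra) = _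
    rw [AlgEquiv.commutes]
    rfl

/-- The twisted action of `W` on `K⟨Λ; γ⟩`, by continuity. -/
def twistCompl (w : P.weylGroup) : γ.BanachAlgebra →+* γ.BanachAlgebra :=
  UniformSpace.Completion.mapRingHom (γ.twist w : γ.GroupRing →+* γ.GroupRing)
    (γ.continuous_twist w)

lemma twistCompl_coe (w : P.weylGroup) (f : γ.GroupRing) :
    γ.twistCompl w (f : γ.BanachAlgebra) = (γ.twist w f : γ.GroupRing) :=
  UniformSpace.Completion.mapRingHom_coe (γ.continuous_twist w) f

/-- The algebra `K⟨Λ; γ⟩^{W, γ}` of invariants for the twisted action, with the norm of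
`K⟨Λ; γ⟩`. -/
def invariants : Subalgebra K γ.BanachAlgebra where
  carrier := {f | ∀ w, γ.twistCompl w f = f}
  mul_mem' ha hb w := by rw [_root_.map_mul, ha w, hb w]
  add_mem' ha hb w := by rw [_root_.map_add, ha w, hb w]
  algebraMap_mem' r w := by
    have h : algebraMap K γ.BanachAlgebra r = ((algebraMap K γ.GroupRing r : γ.GroupRing) :
      γ.BanachAlgebra) := rfl
    rw [h, twistCompl_coe, AlgHom.commutes]

end Basic

end WeylCocycle

end Cocycle

/-! ### Affinoid algebras and affinoid subdomains -/

section Points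

variable {K : Type*} [NormedField K] {A : Type*} [CommRing A] [Algebra K A]

/-- The absolute value `|f(x)|` of the value of `f` at a point `x`, in the residue field `A/x`, a
finite extension of `K` whose absolute value is the unique extension of the one of `K`. -/
def absAt (f : A) (x : MaximalSpectrum A) : ℝ :=
  letI : Field (A ⧸ x.asIdeal) := Ideal.Quotient.field x.asIdeal
  spectralNorm K (A ⧸ x.asIdeal) (Ideal.Quotient.mk x.asIdeal f)

/-- For a `K`-algebra homomorphism `ψ : A → B`, all points `m` of `B` have their image `ψ⁻¹(m)`
in the set `U` of points of `A`. -/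
def MapsInto {B : Type*} [CommRing B] [Algebra K B] (ψ : A →ₐ[K] B)
    (U : Set (MaximalSpectrum A)) : Prop :=
  ∀ m : MaximalSpectrum B, ∃ x ∈ U, x.asIdeal = m.asIdeal.comap ψ

end Points

section Affinoid

universe u

variable (K : Type u) [NormedField K] [IsUltrametricDist K]

/-- The Tate algebra `K⟨T₁, …, Tₙ⟩` of power series whose coefficients tend to `0`. -/
def TateAlgebra (n : ℕ) : Subalgebra K (MvPowerSeries (Fin n) K) where
  __ := MvPowerSeries.IsRestricted.subring (R := K) (fun _ : Fin n => (1 : ℝ))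
  algebraMap_mem' r := MvPowerSeries.isRestricted_C _ r

/-- The Gauss norm `sup |coefficients|` on the Tate algebra. -/
def TateAlgebra.gaussNorm {n : ℕ} (f : TateAlgebra K n) : ℝ :=
  MvPowerSeries.gaussNorm (fun a : K => ‖a‖) (fun _ => 1) (f : MvPowerSeries (Fin n) K)

/-- A normed `K`-algebra `A` is an affinoid `K`-algebra (with its canonical topology) if there is a
surjection `φ` from a Tate algebra onto `A` such that the norm of `A` is equivalent to the residue
norm of `φ`, i.e. `φ` is bounded and elements of `A` have preimages of comparable norm. -/
def IsAffinoid (A : Type*) [NormedCommRing A] [NormedAlgebra K A] : Prop :=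
  ∃ (n : ℕ) (φ : TateAlgebra K n →ₐ[K] A) (C : ℝ),
    (∀ f, ‖φ f‖ ≤ C * TateAlgebra.gaussNorm K f) ∧
    ∀ a, ∃ f, φ f = a ∧ TateAlgebra.gaussNorm K f ≤ C * ‖a‖

variable {K} {A : Type*} [CommRing A] [Algebra K A]

/-- Let `A` be a `K`-algebra of finite type, and `𝔛` the rigid analytic space attached to the
affine variety `Spec A`; its points are the maximal ideals of `A`, and morphisms `Sp C → 𝔛` from
an affinoid space are the same as `K`-algebra homomorphisms `A → C`. The set `U` of points of `𝔛`
is an (open) affinoid subdomain with ring of analytic functions `B`, the restriction of functions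
being `j : A → B`, if `Sp B → 𝔛` has image in `U` and every morphism `Sp C → 𝔛` with image in `U`
from an affinoid space factors uniquely through it. (Homomorphisms of affinoid algebras are
automatically continuous.) -/
structure IsAffinoidSubdomain (U : Set (MaximalSpectrum A)) {B : Type*} [NormedCommRing B]
    [NormedAlgebra K B] (j : A →ₐ[K] B) : Prop where
  isAffinoid : IsAffinoid K B
  mapsInto : MapsInto j U
  existsUnique : ∀ (C : Type u) [NormedCommRing C] [NormedAlgebra K C], IsAffinoid K C →
    ∀ ψ : A →ₐ[K] C, MapsInto ψ U → ∃! β : B →A[K] C, (β : B →ₐ[K] C).comp j = ψ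

end Affinoid

/-! ### The normalized valuation of `L` -/

section Valuation

variable {p : ℕ} [Fact p.Prime] {K : Type*} [NormedField K] [NormedAlgebra ℚ_[p] K]

/-- The absolute value of a uniformizer of `L`. -/
def absUniformizer (L : IntermediateField ℚ_[p] K) : ℝ :=
  sSup {r : ℝ | ∃ y ∈ L, ‖y‖ = r ∧ r < 1}

/-- `val_L`, as a function of the absolute value `r = |x|` of `x`: it is proportional to `-log |x|`
and takes the value `1` at uniformizers of `L`. -/
def valL (L : IntermediateField ℚ_[p] K) (r : ℝ) : ℝ := Real.log r / Real.log (absUniformizer L)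

end Valuation

/-! ### The dual torus and the valuation map -/

section Torus

variable {Λ K : Type*} [AddCommGroup Λ]

/-- The maximal ideal of `K[Λ]` attached to a `K`-valued point `ζ ∈ T'(K) = Hom(Λ, Kˣ)`. -/
def torusPoint [Field K] (ζ : Multiplicative Λ →* Kˣ) :
    MaximalSpectrum (AddMonoidAlgebra K Λ) where
  asIdeal := RingHom.ker (AddMonoidAlgebra.lift K K Λ ((Units.coeHom K).comp ζ))
  isMaximal := RingHom.ker_isMaximal_of_surjective _ fun r =>
    ⟨algebraMap K _ r, by simp⟩

variable [NontriviallyNormedField K] {p : ℕ} [Fact p.Prime] [NormedAlgebra ℚ_[p] K]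

/-- `val : T'(K) = Hom(Λ, Kˣ) → V_ℝ = Hom(Λ, ℝ)`, `ζ ↦ val_L ∘ ζ`. -/
def valHom (L : IntermediateField ℚ_[p] K) (ζ : Multiplicative Λ →* Kˣ) : Λ →+ ℝ where
  toFun l := valL L ‖(ζ (.ofAdd l) : K)‖
  map_zero' := by simp [valL]
  map_add' l m := by
    have h (l) : ‖(ζ (.ofAdd l) : K)‖ ≠ 0 := norm_ne_zero_iff.2 (Units.ne_zero _)
    rw [ofAdd_add, map_mul, Units.val_mul, norm_mul, valL, Real.log_mul (h l) (h m), add_div]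
    rfl

variable [IsUltrametricDist K] [CompleteSpace K] [Module.Finite ℤ Λ]

lemma absAt_mul (f g : AddMonoidAlgebra K Λ) (x : MaximalSpectrum (AddMonoidAlgebra K Λ)) :
    absAt (K := K) (f * g) x = absAt (K := K) f x * absAt (K := K) g x := by
  let _ : Field (AddMonoidAlgebra K Λ ⧸ x.asIdeal) := Ideal.Quotient.field x.asIdeal
  have : AddMonoid.FG Λ := AddGroup.fg_iff_addMonoid_fg.1 (Module.Finite.iff_addGroup_fg.1 ‹_›)
  have : Algebra.FiniteType K (AddMonoidAlgebra K Λ ⧸ x.asIdeal) := inferInstance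
  have : Module.Finite K (AddMonoidAlgebra K Λ ⧸ x.asIdeal) :=
    finite_of_finite_type_of_isJacobsonRing _ _
  exact spectralAlgNorm_mul (K := K) (Ideal.Quotient.mk x.asIdeal f) (Ideal.Quotient.mk x.asIdeal g)

lemma absAt_one (x : MaximalSpectrum (AddMonoidAlgebra K Λ)) :
    absAt (K := K) (1 : AddMonoidAlgebra K Λ) x = 1 := by
  let _ : Field (AddMonoidAlgebra K Λ ⧸ x.asIdeal) := Ideal.Quotient.field x.asIdeal
  exact spectralNorm_one

/-- The map `val` on all points of the rigid analytic torus `T'` over `K`: `val(x)` sends `λ` to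
`val_L(λ(x))`. -/
def valPoint (L : IntermediateField ℚ_[p] K) (x : MaximalSpectrum (AddMonoidAlgebra K Λ)) :
    Λ →+ ℝ where
  toFun l := valL L (absAt (K := K) (AddMonoidAlgebra.single l (1 : K)) x)
  map_zero' := by
    rw [← AddMonoidAlgebra.one_def, absAt_one]
    simp [valL]
  map_add' l m := by
    have h (l : Λ) : absAt (K := K) (AddMonoidAlgebra.single l (1 : K)) x ≠ 0 := by
      intro h0
      have h1 := absAt_mul (AddMonoidAlgebra.single l (1 : K)) (AddMonoidAlgebra.single (-l) 1) x
      rw [h0, zero_mul, AddMonoidAlgebra.single_mul_single, add_neg_cancel, mul_one,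
        ← AddMonoidAlgebra.one_def, absAt_one] at h1
      exact one_ne_zero h1
    rw [show AddMonoidAlgebra.single (l + m) (1 : K) =
      AddMonoidAlgebra.single l 1 * AddMonoidAlgebra.single m 1 by
        rw [AddMonoidAlgebra.single_mul_single, mul_one], absAt_mul, valL,
      Real.log_mul (h l) (h m), add_div]
    rfl

end Torus

namespace WeylCocycle

variable {ι X Λ : Type*} [AddCommGroup X] [AddCommGroup Λ] {P : RootDatum ι X Λ} {b : P.Base}
  {K : Type*} [NontriviallyNormedField K] (γ : WeylCocycle b K)

/-- `T'_γ(K) = {ζ ∈ T'(K) : |ζ(λ)| ≤ |γ^dom(λ)| for all λ ∈ Λ}`. -/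
def domainPoints [Finite ι] [P.IsReduced] : Set (Multiplicative Λ →* Kˣ) :=
  {ζ | ∀ l : Λ, ‖(ζ (.ofAdd l) : K)‖ ≤ ‖(γ.dom l : K)‖}

/-- The points `z_w = - val(γ(w⁻¹, ·))` of `V_ℝ`. -/
def zPoint {p : ℕ} [Fact p.Prime] [NormedAlgebra ℚ_[p] K] (L : IntermediateField ℚ_[p] K)
    (w : P.weylGroup) : Λ →+ ℝ :=
  -valHom L (γ.char w⁻¹)

end WeylCocycle

end AffinoidTorus

/-! The absolute value of `γ.dom` at `λ` is the maximum of the `|γ(w, λ)|`, and on each cone of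
elements made antidominant by a fixed `w` it agrees with the character `γ(w, ·)`. So it is
multiplicative on each of finitely many cones covering `Λ`. By Gordan's lemma each cone is finitely
generated, hence all normalized elements `γ^dom(λ)⁻¹ λ` lie in the algebra over the unit ball of `K`
generated by finitely many of them (`exists_finset_gen_mem_adjoin`). This finite set cuts out `T'_γ`
by finitely many inequalities and provides topological generators, so that a Tate algebra surjects
onto the completion with control of norms.

For the universal property, let `K[Λ] → C` send the points of an affinoid space into `T'_γ`. The
generators then have absolute value at most 1 at all points of `C`, so their images are
power-bounded by the maximum modulus principle. Hence the map is bounded for `‖·‖_γ` and extends to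
the completion. The rigid geometry behind this is proved from Weierstrass division by monic
polynomials over the unit ball: preparation, integral closedness of Tate algebras, the
Nullstellensatz, and the integrality over the unit ball of every element with integral values
(`isIntegralElem_of_forall`).

The description by `val` holds because the maximum of the `|γ(w, λ)|` is, up to sign and logarithm,
the support function of the convex hull of the `-z_w`. Integral `λ` suffice to test membership,
since finitely many strict inequalities with a real solution have an integral one.

For the invariants, Noether's finiteness argument over the unit ball of `K` shows that the traces of
the normalized elements lie in a finitely generated algebra. Characteristic 0 makes `|W|`
invertible, so the trace is onto and dividing by `|W|` costs only a constant. -/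

namespace AffinoidTorus

open Filter Topology

/-! ### The Tate algebra as an ultrametric Banach algebra -/

namespace TateAlgebra

section Norm

variable {K : Type*} [NormedField K] [IsUltrametricDist K] {n : ℕ}

/-- The coefficient of a restricted power series at a multi-index. -/
def coeff (t : Fin n →₀ ℕ) : TateAlgebra K n →ₗ[K] K :=
  (MvPowerSeries.coeff t).comp (TateAlgebra K n).val.toLinearMap

lemma coeff_ext {f g : TateAlgebra K n} (h : ∀ t, coeff t f = coeff t g) : f = g :=
  Subtype.ext (MvPowerSeries.ext h)

lemma tendsto_coeff (f : TateAlgebra K n) :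
    Tendsto (fun t => ‖coeff t f‖) cofinite (𝓝 0) := by
  have h : MvPowerSeries.IsRestricted (fun _ : Fin n => (1 : ℝ)) (f : MvPowerSeries (Fin n) K) :=
    f.2
  simpa [MvPowerSeries.IsRestricted, Finsupp.prod] using! h

/-- Build an element of the Tate algebra from a family of coefficients tending to `0`. -/
def ofCoeff (c : (Fin n →₀ ℕ) → K) (hc : Tendsto (fun t => ‖c t‖) cofinite (𝓝 0)) :
    TateAlgebra K n :=
  ⟨c, by
    change MvPowerSeries.IsRestricted (fun _ : Fin n => (1 : ℝ)) (c : MvPowerSeries (Fin n) K)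
    simpa [MvPowerSeries.IsRestricted, Finsupp.prod] using! hc⟩

@[simp] lemma coeff_ofCoeff (c : (Fin n →₀ ℕ) → K)
    (hc : Tendsto (fun t => ‖c t‖) cofinite (𝓝 0)) (t) : coeff t (ofCoeff c hc) = c t := rfl

lemma gaussNorm_eq (f : TateAlgebra K n) : gaussNorm K f = ⨆ t, ‖coeff t f‖ := by
  simp [gaussNorm, MvPowerSeries.gaussNorm, Finsupp.prod, coeff]

lemma bddAbove_coeff (f : TateAlgebra K n) : BddAbove (Set.range fun t => ‖coeff t f‖) :=
  (tendsto_coeff f).bddAbove_range_of_cofinite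

lemma hasGaussNorm (f : TateAlgebra K n) : MvPowerSeries.HasGaussNorm (fun a : K => ‖a‖)
    (fun _ => 1) (f : MvPowerSeries (Fin n) K) := by
  simpa [MvPowerSeries.HasGaussNorm, Finsupp.prod] using! bddAbove_coeff f

/-- The Gauss norm as a ring norm. -/
def ringNorm : RingNorm (TateAlgebra K n) where
  toFun f := gaussNorm K f
  map_zero' := MvPowerSeries.gaussNorm_zero _ _ norm_zero
  add_le' f g := by
    refine (MvPowerSeries.gaussNorm_add_le_max _ _ _ _ (fun _ => zero_le_one)
      (fun a => norm_nonneg a) IsUltrametricDist.isNonarchimedean_norm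
      (hasGaussNorm f) (hasGaussNorm g)).trans ?_
    exact max_le_add_of_nonneg (MvPowerSeries.gaussNorm_nonneg _ _ _ fun a => norm_nonneg a)
      (MvPowerSeries.gaussNorm_nonneg _ _ _ fun a => norm_nonneg a)
  neg' f := MvPowerSeries.gaussNorm_neg _ _ norm_neg _
  mul_le' f g := MvPowerSeries.gaussNorm_mul_le _ _ _ _ (fun _ => zero_le_one)
    (fun a => norm_nonneg a) norm_mul_le IsUltrametricDist.isNonarchimedean_norm norm_zero
    (hasGaussNorm f) (hasGaussNorm g)
  eq_zero_of_map_eq_zero' f hf := by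
    have := (MvPowerSeries.gaussNorm_eq_zero_iff _ _ _ norm_zero (fun a => norm_nonneg a)
      (fun a : K => norm_eq_zero.1) (fun _ => zero_lt_one) (hasGaussNorm f)).1 hf
    exact Subtype.ext this

instance : NormedCommRing (TateAlgebra K n) :=
  { (ringNorm (K := K) (n := n)).toNormedRing with mul_comm := mul_comm }

lemma norm_eq_gaussNorm (f : TateAlgebra K n) : ‖f‖ = gaussNorm K f := rfl

lemma norm_coeff_le (f : TateAlgebra K n) (t) : ‖coeff t f‖ ≤ ‖f‖ := by
  rw [norm_eq_gaussNorm, gaussNorm_eq]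
  exact le_ciSup (bddAbove_coeff f) t

lemma norm_le {f : TateAlgebra K n} {C : ℝ} (h : ∀ t, ‖coeff t f‖ ≤ C) : ‖f‖ ≤ C := by
  rw [norm_eq_gaussNorm, gaussNorm_eq]
  exact ciSup_le h

/-- The coefficients tend to 0, so only finitely many reach half the norm and the supremum is a
maximum. -/
lemma exists_norm_coeff_eq (f : TateAlgebra K n) : ∃ t, ‖coeff t f‖ = ‖f‖ := by
  by_cases hf : f = 0
  · exact ⟨0, by simp [hf]⟩
  have hpos : 0 < ‖f‖ := norm_pos_iff.2 hf
  have hfin : {t | ‖f‖ / 2 ≤ ‖coeff t f‖}.Finite := by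
    have := (tendsto_coeff f).eventually (gt_mem_nhds (half_pos hpos))
    simpa [Filter.eventually_cofinite] using this
  obtain ⟨t₀, ht₀⟩ : ∃ t, ‖f‖ / 2 < ‖coeff t f‖ := by
    have : ‖f‖ / 2 < ⨆ t, ‖coeff t f‖ := by
      rw [← gaussNorm_eq, ← norm_eq_gaussNorm]; linarith
    exact exists_lt_of_lt_ciSup this
  obtain ⟨t, ht, hmax⟩ := Set.exists_max_image _ (fun t => ‖coeff t f‖) hfin ⟨t₀, ht₀.le⟩
  refine ⟨t, le_antisymm (norm_coeff_le f t) (norm_le fun s => ?_)⟩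
  by_cases hs : ‖f‖ / 2 ≤ ‖coeff s f‖
  · exact hmax s hs
  · exact (not_le.1 hs).le.trans ht

instance : IsUltrametricDist (TateAlgebra K n) :=
  IsUltrametricDist.isUltrametricDist_of_forall_norm_add_le_max_norm fun f g =>
    MvPowerSeries.gaussNorm_add_le_max _ _ _ _ (fun _ => zero_le_one)
      (fun a => norm_nonneg a) IsUltrametricDist.isNonarchimedean_norm
      (hasGaussNorm f) (hasGaussNorm g)

instance : NormedAlgebra K (TateAlgebra K n) where
  norm_smul_le r f := norm_le fun t => by
    rw [map_smul, norm_smul]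
    gcongr
    exact norm_coeff_le f t

/-- The monomial `X ^ t`. -/
def monomial (t : Fin n →₀ ℕ) : TateAlgebra K n :=
  ⟨MvPowerSeries.monomial t 1, MvPowerSeries.isRestricted_monomial _ t 1⟩

lemma coeff_monomial [DecidableEq (Fin n →₀ ℕ)] (s t : Fin n →₀ ℕ) :
    coeff s (monomial t : TateAlgebra K n) = if s = t then 1 else 0 := by
  change MvPowerSeries.coeff s (MvPowerSeries.monomial t (1 : K)) = _
  rw [MvPowerSeries.coeff_monomial]
  congr

lemma monomial_zero : (monomial 0 : TateAlgebra K n) = 1 := rfl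

lemma monomial_add (s t : Fin n →₀ ℕ) :
    (monomial (s + t) : TateAlgebra K n) = monomial s * monomial t :=
  Subtype.ext (by simp [monomial, MvPowerSeries.monomial_mul_monomial])

lemma norm_monomial (t : Fin n →₀ ℕ) : ‖(monomial t : TateAlgebra K n)‖ = 1 := by
  classical
  refine le_antisymm (norm_le fun s => ?_) ?_
  · rw [coeff_monomial]
    split_ifs <;> simp
  · simpa [coeff_monomial] using norm_coeff_le (monomial t : TateAlgebra K n) t

instance : NormOneClass (TateAlgebra K n) := ⟨by rw [← monomial_zero, norm_monomial]⟩

/-- The variable `X i`. -/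
def X (i : Fin n) : TateAlgebra K n := monomial (Finsupp.single i 1)

lemma norm_X (i : Fin n) : ‖(X i : TateAlgebra K n)‖ = 1 := norm_monomial _

lemma monomial_eq (t : Fin n →₀ ℕ) :
    (monomial t : TateAlgebra K n) = t.prod fun i k => X i ^ k := by
  induction t using Finsupp.induction_linear with
  | zero => simp [monomial_zero]
  | add f g hf hg =>
    rw [monomial_add, hf, hg, Finsupp.prod_add_index'] <;> simp [pow_add]
  | single i k =>
    rw [Finsupp.prod_single_index (by simp)]
    induction k with
    | zero => simp [monomial_zero]
    | succ k ih => rw [Finsupp.single_add, monomial_add, ih, pow_succ, X]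

instance : IsDomain (TateAlgebra K n) := by
  have : NoZeroDivisors (TateAlgebra K n) :=
    Function.Injective.noZeroDivisors (Subtype.val : TateAlgebra K n → MvPowerSeries (Fin n) K)
      Subtype.val_injective rfl fun _ _ => rfl
  exact NoZeroDivisors.to_isDomain _

instance [CompleteSpace K] : CompleteSpace (TateAlgebra K n) := by
  refine Metric.complete_of_cauchySeq_tendsto fun u hu => ?_
  have hc : ∀ t, CauchySeq fun k => coeff t (u k) := fun t => by
    rw [Metric.cauchySeq_iff] at hu ⊢
    intro ε hε
    obtain ⟨N, hN⟩ := hu ε hε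
    refine ⟨N, fun a ha b hb => lt_of_le_of_lt ?_ (hN a ha b hb)⟩
    rw [dist_eq_norm, dist_eq_norm, ← map_sub]
    exact norm_coeff_le _ _
  choose c hcl using fun t => cauchySeq_tendsto_of_complete (hc t)
  have hunif : ∀ ε > 0, ∃ N, ∀ k ≥ N, ∀ t, ‖coeff t (u k) - c t‖ ≤ ε := by
    intro ε hε
    obtain ⟨N, hN⟩ := Metric.cauchySeq_iff.1 hu ε hε
    refine ⟨N, fun k hk t => ?_⟩
    have h1 : Tendsto (fun j => ‖coeff t (u k) - coeff t (u j)‖) atTop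
        (𝓝 ‖coeff t (u k) - c t‖) := (tendsto_const_nhds.sub (hcl t)).norm
    refine le_of_tendsto h1 (eventually_atTop.2 ⟨N, fun j hj => ?_⟩)
    have := hN k hk j hj
    rw [dist_eq_norm] at this
    rw [← map_sub]
    exact (norm_coeff_le _ _).trans this.le
  have hres : Tendsto (fun t => ‖c t‖) cofinite (𝓝 0) := by
    rw [Metric.tendsto_nhds]
    intro ε hε
    obtain ⟨N, hN⟩ := hunif (ε / 2) (half_pos hε)
    filter_upwards [(tendsto_coeff (u N)).eventually (gt_mem_nhds (half_pos hε))] with t ht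
    rw [dist_zero_right, norm_norm]
    have := hN N le_rfl t
    calc ‖c t‖ = ‖coeff t (u N) - (coeff t (u N) - c t)‖ := by congr 1; ring
      _ ≤ _ := norm_sub_le _ _
      _ < ε := by linarith
  refine ⟨ofCoeff c hres, Metric.tendsto_atTop.2 fun ε hε => ?_⟩
  obtain ⟨N, hN⟩ := hunif (ε / 2) (half_pos hε)
  refine ⟨N, fun k hk => ?_⟩
  rw [dist_eq_norm]
  refine lt_of_le_of_lt (norm_le fun t => ?_) (half_lt_self hε)
  rw [map_sub]
  exact hN k hk t

end Norm

/-! ### Continuous maps out of Tate algebras, determined on monomials -/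

section Extend

variable {K : Type*} [NontriviallyNormedField K] [IsUltrametricDist K] {n : ℕ}

/-- Monomials span a dense subspace. Through `clm_ext` every identity between continuous linear maps
below is checked on monomials only. -/
lemma hasSum_monomial (f : TateAlgebra K n) :
    HasSum (fun t => coeff t f • (monomial t : TateAlgebra K n)) f := by
  classical
  rw [HasSum, SummationFilter.unconditional_filter, Metric.tendsto_nhds]
  intro ε hε
  have hfin : {t | ε / 2 ≤ ‖coeff t f‖}.Finite := by
    have := (tendsto_coeff f).eventually (gt_mem_nhds (half_pos hε))
    simpa [Filter.eventually_cofinite] using this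
  filter_upwards [eventually_ge_atTop hfin.toFinset] with s hs
  rw [dist_eq_norm]
  refine lt_of_le_of_lt (norm_le fun t => ?_) (half_lt_self hε)
  have h : coeff t (∑ t ∈ s, coeff t f • (monomial t : TateAlgebra K n)) =
      if t ∈ s then coeff t f else 0 := by
    simp [coeff_monomial]
  rw [map_sub, h]
  split_ifs with hts
  · simp [(half_pos hε).le]
  · rw [zero_sub, norm_neg]
    by_contra! hlt
    exact hts (hs (hfin.mem_toFinset.2 hlt.le))

lemma clm_ext {M : Type*} [AddCommMonoid M] [Module K M] [TopologicalSpace M] [T2Space M]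
    {f g : TateAlgebra K n →L[K] M} (h : ∀ t, f (monomial t) = g (monomial t)) : f = g := by
  ext x
  have h1 := (hasSum_monomial x).mapL f
  have h2 := (hasSum_monomial x).mapL g
  simp only [map_smul, h] at h1 h2
  exact h1.unique h2

variable {M : Type*} [NormedAddCommGroup M] [NormedSpace K M] [CompleteSpace M]
  [IsUltrametricDist M]

lemma summable_smul {m : (Fin n →₀ ℕ) → M} {C : ℝ} (hm : ∀ t, ‖m t‖ ≤ C) (f : TateAlgebra K n) :
    Summable fun t => coeff t f • m t := by
  refine NonarchimedeanAddGroup.summable_of_tendsto_cofinite_zero ?_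
  rw [tendsto_zero_iff_norm_tendsto_zero]
  refine squeeze_zero (g := fun t => ‖coeff t f‖ * C) (fun _ => norm_nonneg _) (fun t => ?_) ?_
  · rw [norm_smul]
    exact mul_le_mul_of_nonneg_left (hm t) (norm_nonneg _)
  · simpa using (tendsto_coeff f).mul_const C

/-- The continuous linear map on the Tate algebra with prescribed bounded values on monomials. -/
def extend (m : (Fin n →₀ ℕ) → M) (C : ℝ) (hm : ∀ t, ‖m t‖ ≤ C) : TateAlgebra K n →L[K] M :=
  LinearMap.mkContinuous
    { toFun := fun f => ∑' t, coeff t f • m t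
      map_add' := fun f g => by
        rw [← (summable_smul hm f).tsum_add (summable_smul hm g)]
        simp [add_smul]
      map_smul' := fun r f => by
        rw [RingHom.id_apply, ← (summable_smul hm f).tsum_const_smul]
        simp [mul_smul] } C fun f => by
    have hC : 0 ≤ C := (norm_nonneg _).trans (hm 0)
    refine IsUltrametricDist.norm_tsum_le_of_forall_le_of_nonneg (by positivity) fun t => ?_
    rw [norm_smul, mul_comm]
    exact mul_le_mul (hm t) (norm_coeff_le f t) (norm_nonneg _) hC

@[simp] lemma extend_monomial (m : (Fin n →₀ ℕ) → M) (C : ℝ) (hm : ∀ t, ‖m t‖ ≤ C) (t) :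
    extend (K := K) m C hm (monomial t) = m t := by
  classical
  change ∑' s, coeff s (monomial t : TateAlgebra K n) • m s = m t
  rw [tsum_eq_single t fun s hs => by simp [coeff_monomial, hs]]
  simp [coeff_monomial]

lemma norm_extend_le (m : (Fin n →₀ ℕ) → M) (C : ℝ) (hm : ∀ t, ‖m t‖ ≤ C)
    (f : TateAlgebra K n) : ‖extend (K := K) m C hm f‖ ≤ C * ‖f‖ :=
  ContinuousLinearMap.le_of_opNorm_le _
    (LinearMap.mkContinuous_norm_le _ ((norm_nonneg _).trans (hm 0)) _) f

variable {A : Type*} [NormedCommRing A] [NormedAlgebra K A] [NormOneClass A]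

lemma norm_prod_pow_le {b : Fin n → A} (hb : ∀ i, ‖b i‖ ≤ 1) (t : Fin n →₀ ℕ) :
    ‖t.prod fun i k => b i ^ k‖ ≤ 1 := by
  refine (Finset.norm_prod_le _ _).trans (Finset.prod_le_one (fun _ _ => norm_nonneg _) ?_)
  exact fun i _ => (norm_pow_le _ _).trans (pow_le_one₀ (norm_nonneg _) (hb i))

variable [CompleteSpace A] [IsUltrametricDist A]

/-- Evaluation of restricted power series at elements of the unit ball of a Banach algebra. -/
def evalCLM (b : Fin n → A) (hb : ∀ i, ‖b i‖ ≤ 1) : TateAlgebra K n →L[K] A :=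
  extend (fun t => t.prod fun i k => b i ^ k) 1 (norm_prod_pow_le hb)

lemma evalCLM_monomial (b : Fin n → A) (hb : ∀ i, ‖b i‖ ≤ 1) (t) :
    evalCLM (K := K) b hb (monomial t) = t.prod fun i k => b i ^ k := extend_monomial _ _ _ t

omit [IsUltrametricDist K] in
variable (K) in
/-- Multiplication by an element of a normed algebra, as a continuous linear map. -/
def mulCLM {B : Type*} [NormedCommRing B] [NormedAlgebra K B] (a : B) : B →L[K] B :=
  ContinuousLinearMap.mul K B a

omit [IsUltrametricDist K] in
@[simp] lemma mulCLM_apply {B : Type*} [NormedCommRing B] [NormedAlgebra K B] (a x : B) :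
    mulCLM K a x = a * x := rfl

/-- A continuous linear map is multiplicative if it is so on monomials. -/
lemma map_mul_of_monomial {B : Type*} [NormedCommRing B] [NormedAlgebra K B]
    (φ : TateAlgebra K n →L[K] B)
    (h : ∀ s t, φ (monomial (s + t)) = φ (monomial s) * φ (monomial t)) (f g : TateAlgebra K n) :
    φ (f * g) = φ f * φ g := by
  -- The identity is bilinear, so it is extended by continuity in one factor at a time: first with
  -- the other factor a monomial, then arbitrary.
  have h1 : ∀ s, φ.comp (mulCLM K (monomial s)) = (mulCLM K (φ (monomial s))).comp φ := fun s =>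
    clm_ext fun t => by simp [← monomial_add, h]
  have h2 : φ.comp (mulCLM K g) = (mulCLM K (φ g)).comp φ :=
    clm_ext fun s => by simpa [mul_comm] using DFunLike.congr_fun (h1 s) g
  simpa [mul_comm] using DFunLike.congr_fun h2 f

/-- Evaluation of restricted power series, as an algebra homomorphism. -/
def eval (b : Fin n → A) (hb : ∀ i, ‖b i‖ ≤ 1) : TateAlgebra K n →ₐ[K] A :=
  AlgHom.ofLinearMap (evalCLM b hb).toLinearMap
    (by
      have := evalCLM_monomial (K := K) b hb 0
      rw [monomial_zero] at this
      simpa using this)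
    (map_mul_of_monomial _ fun s t => by
      simp only [evalCLM_monomial]
      rw [Finsupp.prod_add_index'] <;> simp [pow_add])

lemma continuous_eval (b : Fin n → A) (hb : ∀ i, ‖b i‖ ≤ 1) :
    Continuous (eval (K := K) b hb) := (evalCLM b hb).continuous

lemma norm_eval_le (b : Fin n → A) (hb : ∀ i, ‖b i‖ ≤ 1) (f : TateAlgebra K n) :
    ‖eval b hb f‖ ≤ ‖f‖ := by
  rw [← one_mul ‖f‖]
  exact norm_extend_le _ 1 (norm_prod_pow_le hb) f

lemma eval_monomial (b : Fin n → A) (hb : ∀ i, ‖b i‖ ≤ 1) (t) :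
    eval (K := K) b hb (monomial t) = t.prod fun i k => b i ^ k := evalCLM_monomial b hb t

@[simp] lemma eval_X (b : Fin n → A) (hb : ∀ i, ‖b i‖ ≤ 1) (i) :
    eval (K := K) b hb (X i) = b i := by
  rw [X, eval_monomial, Finsupp.prod_single_index (by simp), pow_one]

lemma algHom_ext {B : Type*} [CommRing B] [Algebra K B] [TopologicalSpace B] [T2Space B]
    {φ ψ : TateAlgebra K n →ₐ[K] B} (hφ : Continuous φ) (hψ : Continuous ψ)
    (h : ∀ i, φ (X i) = ψ (X i)) : φ = ψ := by
  have : (⟨φ.toLinearMap, hφ⟩ : TateAlgebra K n →L[K] B) = ⟨ψ.toLinearMap, hψ⟩ :=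
    clm_ext fun t => by
      change φ (monomial t) = ψ (monomial t)
      simp [monomial_eq, Finsupp.prod, h]
  ext x
  exact DFunLike.congr_fun this x

end Extend

end TateAlgebra

end AffinoidTorus

namespace AffinoidTorus

open Filter Topology Polynomial

/-! ### Polynomials over the unit ball and Weierstrass division -/

section UnitBall

variable (R : Type*) [NormedCommRing R] [IsUltrametricDist R] [NormOneClass R]

/-- The closed unit ball of an ultrametric normed ring. -/
def unitBall : Subring R where
  carrier := {x | ‖x‖ ≤ 1}
  one_mem' := norm_one.le
  zero_mem' := by simp
  neg_mem' {x} hx := by simpa using hx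
  add_mem' {x y} hx hy := (IsUltrametricDist.norm_add_le_max x y).trans (max_le hx hy)
  mul_mem' {x y} hx hy := (norm_mul_le x y).trans (mul_le_one₀ hx (norm_nonneg _) hy)

variable {R}

lemma mem_unitBall {x : R} : x ∈ unitBall R ↔ ‖x‖ ≤ 1 := Iff.rfl

/-- A polynomial with coefficients in the unit ball, as a polynomial over the ring. -/
abbrev ofBall (p : (unitBall R)[X]) : R[X] := p.map (unitBall R).subtype

lemma norm_coeff_ofBall_le (p : (unitBall R)[X]) (i : ℕ) : ‖(ofBall p).coeff i‖ ≤ 1 := by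
  rw [coeff_map]
  exact (p.coeff i).2

end UnitBall

namespace TateAlgebra

variable {K : Type*} [NontriviallyNormedField K] [IsUltrametricDist K] [CompleteSpace K] {n : ℕ}

section Inclusion

/-- The inclusion of Tate algebras which omits the first variable. -/
def incl : TateAlgebra K n →ₐ[K] TateAlgebra K (n + 1) :=
  eval (fun i => X i.succ) fun _ => (norm_X _).le

lemma norm_incl_le (f : TateAlgebra K n) : ‖incl f‖ ≤ ‖f‖ := norm_eval_le _ _ f

/-- The inclusion of Tate algebras as a continuous linear map. -/
def inclCLM : TateAlgebra K n →L[K] TateAlgebra K (n + 1) :=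
  evalCLM (fun i => X i.succ) fun _ => (norm_X _).le

lemma inclCLM_apply (f : TateAlgebra K n) : inclCLM f = incl f := rfl

omit [CompleteSpace K] in
lemma monomial_eq_prod (t : Fin n →₀ ℕ) :
    (monomial t : TateAlgebra K n) = ∏ i, X i ^ t i := by
  rw [monomial_eq, Finsupp.prod_fintype _ _ fun i => pow_zero _]

lemma monomial_cons (ν : ℕ) (t : Fin n →₀ ℕ) :
    (monomial (t.cons ν) : TateAlgebra K (n + 1)) = incl (monomial t) * X 0 ^ ν := by
  rw [monomial_eq_prod, Fin.prod_univ_succ, incl, eval_monomial,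
    Finsupp.prod_fintype _ _ fun i => pow_zero _, mul_comm]
  simp

lemma incl_monomial (t : Fin n →₀ ℕ) :
    incl (monomial t : TateAlgebra K n) = monomial (t.cons 0) := by
  simp [monomial_cons]

/-- Polynomials in the first variable. -/
def ofPoly : (TateAlgebra K n)[X] →+* TateAlgebra K (n + 1) :=
  eval₂RingHom (incl (K := K) (n := n)).toRingHom (X 0)

@[simp] lemma ofPoly_C (a : TateAlgebra K n) : ofPoly (C a) = incl a := by
  simp [ofPoly]

@[simp] lemma ofPoly_X : ofPoly (Polynomial.X : (TateAlgebra K n)[X]) = X 0 := by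
  simp [ofPoly]

lemma ofPoly_eq_sum (p : (TateAlgebra K n)[X]) {d : ℕ} (hd : p.degree < d) :
    ofPoly p = ∑ i ∈ Finset.range d, incl (p.coeff i) * X 0 ^ i := by
  have h : p = ∑ i ∈ Finset.range d, C (p.coeff i) * Polynomial.X ^ i := by
    ext1 i
    simp only [finsetSum_coeff, coeff_C_mul_X_pow]
    rw [Finset.sum_ite_eq]
    split_ifs with hi
    · rfl
    · exact coeff_eq_zero_of_degree_lt (hd.trans_le (by simpa using hi))
  conv_lhs => rw [h]
  simp

lemma norm_ofPoly_le (p : (TateAlgebra K n)[X]) {C : ℝ} (hC : ∀ i, ‖p.coeff i‖ ≤ C) :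
    ‖ofPoly p‖ ≤ C := by
  rw [ofPoly_eq_sum p (d := p.natDegree + 1)
    (degree_le_natDegree.trans_lt (by exact_mod_cast Nat.lt_succ_self _))]
  refine IsUltrametricDist.norm_sum_le_of_forall_le_of_nonneg
    ((norm_nonneg _).trans (hC 0)) fun i _ => (norm_mul_le _ _).trans ?_
  calc _ ≤ C * 1 := mul_le_mul ((norm_incl_le _).trans (hC i))
        ((norm_pow_le _ _).trans (pow_le_one₀ (norm_nonneg _) (norm_X _).le)) (norm_nonneg _)
        ((norm_nonneg _).trans (hC 0))
    _ = C := mul_one C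

lemma coeff_incl_mul_pow (a : TateAlgebra K n) (k ν : ℕ) (t : Fin n →₀ ℕ) :
    coeff (t.cons ν) (incl a * X 0 ^ k) = if k = ν then coeff t a else 0 := by
  classical
  have hcont : ∀ (m : ℕ) (s : Fin m →₀ ℕ), Continuous (coeff (K := K) s) := fun m s =>
    AddMonoidHomClass.continuous_of_bound (coeff s) 1 fun f => by
      rw [one_mul]; exact norm_coeff_le f s
  let c (m : ℕ) (s : Fin m →₀ ℕ) : TateAlgebra K m →L[K] K := ⟨coeff s, hcont m s⟩
  have h : ((c _ (t.cons ν)).comp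
      (mulCLM K (X 0 ^ k))).comp inclCLM =
      if k = ν then c _ t else 0 := by
    refine clm_ext fun s => ?_
    change coeff (t.cons ν) (X 0 ^ k * incl (monomial s)) = _
    rw [mul_comm, ← monomial_cons, coeff_monomial]
    split_ifs with h1 h2 h2
    · obtain ⟨-, h4⟩ := Finsupp.cons_injective2 h1
      simp [c, coeff_monomial, h4]
    · exact absurd (Finsupp.cons_injective2 h1).1.symm h2
    · have h3 : t ≠ s := fun h3 => h1 (by rw [h3, h2])
      simp [c, coeff_monomial, h3]
    · rfl
  have := DFunLike.congr_fun h a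
  rw [mul_comm]
  split_ifs at this ⊢ <;> exact this

lemma coeff_ofPoly (p : (TateAlgebra K n)[X]) (ν : ℕ) (t : Fin n →₀ ℕ) :
    coeff (t.cons ν) (ofPoly p) = coeff t (p.coeff ν) := by
  induction p using Polynomial.induction_on' with
  | add p q hp hq => simp [hp, hq]
  | monomial k a =>
    rw [← C_mul_X_pow_eq_monomial, map_mul, map_pow, ofPoly_C, ofPoly_X, coeff_incl_mul_pow]
    simp only [coeff_C_mul_X_pow, eq_comm]
    split_ifs <;> simp

lemma ofPoly_injective : Function.Injective (ofPoly (K := K) (n := n)) := by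
  refine (injective_iff_map_eq_zero _).2 fun p hp => ?_
  ext1 ν
  exact coeff_ext fun t => by rw [← coeff_ofPoly, hp]; simp

end Inclusion

section Division

variable (ω : (unitBall (TateAlgebra K n))[X])

/-- The quotient in Weierstrass division by a monic polynomial over the unit ball. -/
def divW : TateAlgebra K (n + 1) →L[K] TateAlgebra K (n + 1) :=
  -- Only the power of the first variable is divided. Since `ω` is monic, the polynomial quotient
  -- has coefficients in the unit ball, so the values on monomials are bounded by 1 and extend by
  -- continuity.
  extend (fun t => incl (monomial t.tail) * ofPoly (ofBall (Polynomial.X ^ t 0 /ₘ ω))) 1 fun t => by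
    refine (norm_mul_le _ _).trans (mul_le_one₀ ((norm_incl_le _).trans (norm_monomial _).le)
      (norm_nonneg _) (norm_ofPoly_le _ (norm_coeff_ofBall_le _)))

/-- The coefficients of the remainder in Weierstrass division. -/
def remW (i : ℕ) : TateAlgebra K (n + 1) →L[K] TateAlgebra K n :=
  extend (fun t => monomial t.tail * (ofBall (Polynomial.X ^ t 0 %ₘ ω)).coeff i) 1 fun _ =>
    (norm_mul_le _ _).trans (mul_le_one₀ (norm_monomial _).le (norm_nonneg _)
      (norm_coeff_ofBall_le _ i))

lemma norm_divW_le (f : TateAlgebra K (n + 1)) : ‖divW ω f‖ ≤ ‖f‖ := by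
  rw [← one_mul ‖f‖]
  exact norm_extend_le _ _ _ f

lemma norm_remW_le (i : ℕ) (f : TateAlgebra K (n + 1)) : ‖remW ω i f‖ ≤ ‖f‖ := by
  rw [← one_mul ‖f‖]
  exact norm_extend_le _ _ _ f

/-- Division is linear over the Tate algebra in the remaining variables: clear from the definition
on monomials, then extended by density in each factor. -/
lemma divW_incl_mul (a : TateAlgebra K n) (f : TateAlgebra K (n + 1)) :
    divW ω (incl a * f) = incl a * divW ω f := by
  have h1 : ∀ s, (divW ω).comp (mulCLM K (incl (monomial s))) =
      (mulCLM K (incl (monomial s))).comp (divW ω) := fun s =>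
    clm_ext fun t => by
      have ht : ((s.cons 0 + t).tail) = s + t.tail := by
        ext i
        simp [Finsupp.tail_apply]
      change divW ω (incl (monomial s) * monomial t) = incl (monomial s) * divW ω (monomial t)
      rw [incl_monomial, ← monomial_add, divW, extend_monomial, extend_monomial, ht, monomial_add,
        map_mul, incl_monomial, mul_assoc]
      simp
  have h2 : ((divW ω).comp (mulCLM K f)).comp inclCLM =
      (mulCLM K (divW ω f)).comp inclCLM :=
    clm_ext fun s => by
      change divW ω (f * incl (monomial s)) = divW ω f * incl (monomial s)
      rw [mul_comm, mul_comm (divW ω f)]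
      exact DFunLike.congr_fun (h1 s) f
  rw [mul_comm, mul_comm _ (divW ω f)]
  exact DFunLike.congr_fun h2 a

variable {ω} (hω : ω.Monic)
include hω

/-- By additivity and `divW_incl_mul` it is enough to treat powers of the variable; Euclidean
division by a monic polynomial is unique, hence compatible with sums and scalars. -/
lemma divW_ofPoly (p : (TateAlgebra K n)[X]) : divW ω (ofPoly p) = ofPoly (p /ₘ ofBall ω) := by
  have hm : (ofBall ω).Monic := hω.map _
  induction p using Polynomial.induction_on' with
  | add p q hp hq =>
    have : (p + q) /ₘ ofBall ω = p /ₘ ofBall ω + q /ₘ ofBall ω := by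
      refine (div_modByMonic_unique _ (p %ₘ ofBall ω + q %ₘ ofBall ω) hm ⟨?_, ?_⟩).1
      · conv_rhs => rw [← modByMonic_add_div p (ofBall ω), ← modByMonic_add_div q (ofBall ω)]
        ring
      · exact (degree_add_le _ _).trans_lt (max_lt (degree_modByMonic_lt _ hm)
          (degree_modByMonic_lt _ hm))
    rw [map_add, map_add, hp, hq, this, map_add]
  | monomial k a =>
    have h1 : (C a * Polynomial.X ^ k) /ₘ ofBall ω =
        C a * (Polynomial.X ^ k /ₘ ofBall ω) := by
      refine (div_modByMonic_unique _ (C a * (Polynomial.X ^ k %ₘ ofBall ω)) hm ⟨?_, ?_⟩).1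
      · conv_rhs => rw [← modByMonic_add_div (Polynomial.X ^ k) (ofBall ω)]
        ring
      · rw [C_mul']
        exact (degree_smul_le _ _).trans_lt (degree_modByMonic_lt _ hm)
    have h2 : divW ω (X 0 ^ k) = ofPoly (Polynomial.X ^ k /ₘ ofBall ω) := by
      have h3 : (X 0 ^ k : TateAlgebra K (n + 1)) = monomial (Finsupp.cons k 0) := by
        rw [monomial_cons, monomial_zero, map_one, one_mul]
      rw [h3, divW, extend_monomial, Finsupp.tail_cons, Finsupp.cons_zero, monomial_zero, map_one,
        one_mul, ofBall, map_divByMonic _ hω]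
      simp
    rw [← C_mul_X_pow_eq_monomial, h1, map_mul ofPoly, map_mul ofPoly, map_pow, ofPoly_C,
      ofPoly_X, divW_incl_mul, h2]

lemma divW_ofPoly_of_degree_lt {p : (TateAlgebra K n)[X]} (hp : p.degree < ω.degree) :
    divW ω (ofPoly p) = 0 := by
  have hm : (ofBall ω).Monic := hω.map _
  rw [divW_ofPoly hω, (divByMonic_eq_zero_iff hm).2, map_zero]
  rwa [ofBall, hω.degree_map]

/-- The uniqueness half of Weierstrass division. On monomials it is exact division of polynomials.
-/
lemma divW_mul (f : TateAlgebra K (n + 1)) : divW ω (f * ofPoly (ofBall ω)) = f := by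
  have h : (divW ω).comp (mulCLM K (ofPoly (ofBall ω))) =
      ContinuousLinearMap.id K (TateAlgebra K (n + 1)) := clm_ext fun t => by
    have ht : (monomial t : TateAlgebra K (n + 1)) =
        ofPoly (C (monomial t.tail) * Polynomial.X ^ t 0) := by
      rw [map_mul, map_pow, ofPoly_C, ofPoly_X, ← monomial_cons, Finsupp.cons_tail]
    change divW ω (ofPoly (ofBall ω) * monomial t) = monomial t
    rw [ht, ← map_mul, divW_ofPoly hω, mul_divByMonic_cancel_left _ (hω.map _)]
  rw [mul_comm]
  exact DFunLike.congr_fun h f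

/-- The existence half of Weierstrass division: Euclidean division of a power of the variable,
extended by continuity. -/
lemma div_add_rem (f : TateAlgebra K (n + 1)) : divW ω f * ofPoly (ofBall ω) +
    ∑ i ∈ Finset.range ω.natDegree, incl (remW ω i f) * X 0 ^ i = f := by
  have h : (mulCLM K (ofPoly (ofBall ω))).comp (divW ω) +
      ∑ i ∈ Finset.range ω.natDegree, (mulCLM K (X 0 ^ i)).comp
        (inclCLM.comp (remW ω i)) = ContinuousLinearMap.id K (TateAlgebra K (n + 1)) :=
    clm_ext fun t => by
    have hd : (ofBall (Polynomial.X ^ t 0 %ₘ ω)).degree < ω.natDegree := by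
      refine (degree_map_le).trans_lt ?_
      rw [← degree_eq_natDegree hω.ne_zero]
      exact degree_modByMonic_lt _ hω
    simp only [add_apply, sum_apply, ContinuousLinearMap.comp_apply, mulCLM_apply,
      ContinuousLinearMap.id_apply, inclCLM_apply, mul_comm (ofPoly _), mul_comm (X 0 ^ _)]
    simp only [divW, remW, extend_monomial, map_mul, mul_assoc, ← Finset.mul_sum]
    rw [← mul_add, ← map_mul]
    have h1 : ∑ i ∈ Finset.range ω.natDegree, incl
        ((ofBall (Polynomial.X ^ t 0 %ₘ ω)).coeff i) * X 0 ^ i =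
        ofPoly (ofBall (Polynomial.X ^ t 0 %ₘ ω)) :=
      (ofPoly_eq_sum _ hd).symm
    have h2 := modByMonic_add_div (Polynomial.X ^ t 0) ω
    rw [add_comm, mul_comm] at h2
    rw [h1, ← map_add, ofBall, ← Polynomial.map_mul, ← Polynomial.map_add, h2,
      Polynomial.map_pow, Polynomial.map_X, map_pow, ofPoly_X, ← monomial_cons, Finsupp.cons_tail]
  have := DFunLike.congr_fun h f
  simp only [add_apply, sum_apply, ContinuousLinearMap.comp_apply, mulCLM_apply,
    ContinuousLinearMap.id_apply, inclCLM_apply, mul_comm (ofPoly _), mul_comm (X 0 ^ _)] at this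
  exact this

lemma exists_div_add_poly (f : TateAlgebra K (n + 1)) : ∃ p : (TateAlgebra K n)[X],
    p.degree < ω.degree ∧ (∀ i, ‖p.coeff i‖ ≤ ‖f‖) ∧
    f = divW ω f * ofPoly (ofBall ω) + ofPoly p := by
  refine ⟨∑ i ∈ Finset.range ω.natDegree, C (remW ω i f) * Polynomial.X ^ i, ?_, fun i => ?_, ?_⟩
  · refine (degree_sum_le _ _).trans_lt ?_
    rw [Finset.sup_lt_iff (by rw [bot_lt_iff_ne_bot]; simpa using hω.ne_zero)]
    intro i hi
    rw [degree_eq_natDegree hω.ne_zero]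
    exact (degree_C_mul_X_pow_le _ _).trans_lt (by exact_mod_cast Finset.mem_range.1 hi)
  · simp only [finsetSum_coeff, coeff_C_mul_X_pow]
    rw [Finset.sum_ite_eq]
    split_ifs
    · exact norm_remW_le ω i f
    · simp
  · conv_lhs => rw [← div_add_rem hω f]
    simp

/-- If a monic polynomial divides a polynomial in the Tate algebra, it does so as polynomials. -/
lemma dvd_of_ofPoly_dvd {p : (TateAlgebra K n)[X]} (h : ofPoly (ofBall ω) ∣ ofPoly p) :
    ofBall ω ∣ p := by
  have hm : (ofBall ω).Monic := hω.map _
  obtain ⟨z, hz⟩ := h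
  have h1 := divW_mul hω z
  rw [mul_comm, ← hz, divW_ofPoly hω] at h1
  refine ⟨p /ₘ ofBall ω, ofPoly_injective ?_⟩
  rw [hz, map_mul, h1]

end Division

end TateAlgebra

end AffinoidTorus

namespace AffinoidTorus

open Filter Topology Polynomial

/-- Uniqueness of digits in base `B`. It will separate the degrees of the dominant monomials after a
shift of variables. -/
lemma sum_mul_pow_injective {B : ℕ} : ∀ {n : ℕ} {t u : Fin n → ℕ}, (∀ i, t i < B) →
    (∀ i, u i < B) → ∑ i, t i * B ^ (i : ℕ) = ∑ i, u i * B ^ (i : ℕ) → t = u := by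
  intro n
  induction n with
  | zero => intro t u _ _ _; exact Subsingleton.elim _ _
  | succ n ih =>
    intro t u ht hu h
    have hB : 0 < B := (Nat.zero_le _).trans_lt (ht 0)
    have key : ∀ v : Fin (n + 1) → ℕ, ∑ i, v i * B ^ (i : ℕ) =
        v 0 + B * ∑ i : Fin n, v i.succ * B ^ (i : ℕ) := fun v => by
      rw [Fin.sum_univ_succ, Finset.mul_sum]
      congr 1
      · simp
      · exact Finset.sum_congr rfl fun i _ => by rw [Fin.val_succ, pow_succ]; ring
    rw [key, key] at h
    have h0 : t 0 = u 0 := by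
      have := congrArg (· % B) h
      simpa [Nat.add_mul_mod_self_left, Nat.mod_eq_of_lt (ht 0), Nat.mod_eq_of_lt (hu 0)] using this
    rw [h0, Nat.add_left_cancel_iff] at h
    have h1 := ih (fun i => ht i.succ) (fun i => hu i.succ) (Nat.eq_of_mul_eq_mul_left hB h)
    funext i
    refine Fin.cases h0 (fun j => congrFun h1 j) i

namespace TateAlgebra

variable {K : Type*} [NontriviallyNormedField K] [IsUltrametricDist K] [CompleteSpace K] {n : ℕ}

/-! ### Shifts of variables and Weierstrass preparation -/

section Shift

/-- The images of the variables under a shift `X_{i+1} ↦ X_{i+1} + e X_0^{c_i}`. -/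
def shiftVar (c : Fin n → ℕ) (e : unitBall K) : Fin (n + 1) → TateAlgebra K (n + 1) :=
  Fin.cons (X 0) fun i => X i.succ + (e : K) • X 0 ^ c i

omit [CompleteSpace K] in
lemma norm_shiftVar_le (c : Fin n → ℕ) (e : unitBall K) (i) : ‖shiftVar c e i‖ ≤ 1 := by
  refine Fin.cases (norm_X _).le (fun i => ?_) i
  refine (IsUltrametricDist.norm_add_le_max _ _).trans (max_le (norm_X _).le ?_)
  rw [norm_smul]
  exact mul_le_one₀ e.2 (norm_nonneg _)
    ((norm_pow_le _ _).trans (pow_le_one₀ (norm_nonneg _) (norm_X _).le))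

/-- The substitution `X_{i+1} ↦ X_{i+1} + e X_0^{c_i}`. -/
def shift (c : Fin n → ℕ) (e : unitBall K) : TateAlgebra K (n + 1) →ₐ[K] TateAlgebra K (n + 1) :=
  eval (shiftVar c e) (norm_shiftVar_le c e)

lemma norm_shift_le (c : Fin n → ℕ) (e : unitBall K) (f) : ‖shift c e f‖ ≤ ‖f‖ :=
  norm_eval_le _ _ f

lemma shift_comp (c : Fin n → ℕ) (e : unitBall K) :
    (shift c e).comp (shift c (-e)) = AlgHom.id K (TateAlgebra K (n + 1)) := by
  refine algHom_ext ((continuous_eval _ (norm_shiftVar_le c e)).comp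
    (continuous_eval _ (norm_shiftVar_le c (-e)))) continuous_id fun i => ?_
  have h0 : ∀ e : unitBall K, shift c e (X 0) = X 0 := fun e => by
    simp [shift, shiftVar]
  have h1 : ∀ (e : unitBall K) (i : Fin n), shift c e (X i.succ) =
      X i.succ + (e : K) • X 0 ^ c i := fun e i => by
    simp [shift, shiftVar]
  refine Fin.cases ?_ (fun i => ?_) i
  · simp [h0]
  · simp [h0, h1]

/-- The shift as an automorphism. -/
def shiftEquiv (c : Fin n → ℕ) (e : unitBall K) :
    TateAlgebra K (n + 1) ≃ₐ[K] TateAlgebra K (n + 1) :=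
  AlgEquiv.ofAlgHom (shift c e) (shift c (-e)) (shift_comp c e) (by
    have := shift_comp c (-e)
    rwa [neg_neg] at this)

lemma norm_shiftEquiv (c : Fin n → ℕ) (e : unitBall K) (f) : ‖shiftEquiv c e f‖ = ‖f‖ := by
  refine le_antisymm (norm_shift_le c e f) ?_
  conv_lhs => rw [← (shiftEquiv c e).symm_apply_apply f]
  exact norm_shift_le c (-e) _

/-- The image of a monomial under a shift, as a polynomial in the first variable. -/
def shiftPoly (c : Fin n → ℕ) (t : Fin (n + 1) →₀ ℕ) : (unitBall (TateAlgebra K n))[X] :=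
  Polynomial.X ^ t 0 *
    ∏ i, (Polynomial.X ^ c i + C ⟨X i, (norm_X i).le⟩) ^ t i.succ

lemma shift_monomial (c : Fin n → ℕ) (t : Fin (n + 1) →₀ ℕ) :
    shiftEquiv c (1 : unitBall K) (monomial t) = ofPoly (ofBall (shiftPoly c t)) := by
  change shift c 1 (monomial t) = _
  rw [shift, eval_monomial, Finsupp.prod_fintype _ _ fun i => pow_zero _, Fin.prod_univ_succ]
  simp only [shiftPoly, ofBall, Polynomial.map_mul, Polynomial.map_pow, Polynomial.map_prod,
    Polynomial.map_add, Polynomial.map_X, Polynomial.map_C, map_mul, map_pow, map_prod, map_add,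
    ofPoly_X, ofPoly_C, shiftVar, Fin.cons_zero, Fin.cons_succ]
  congr 1
  refine Finset.prod_congr rfl fun i _ => ?_
  congr 1
  refine (add_comm _ _).trans (congrArg₂ _ (one_smul K _) ?_)
  exact (eval_X (K := K) (fun i : Fin n => (X i.succ : TateAlgebra K (n + 1)))
    (fun _ => (norm_X _).le) i).symm

-- The condition `c i ≠ 0` makes every factor monic of degree `c i`, so the monomial acquires a
-- weighted degree in the first variable.
omit [CompleteSpace K] in
lemma monic_shiftPoly {c : Fin n → ℕ} (hc : ∀ i, c i ≠ 0) (t : Fin (n + 1) →₀ ℕ) :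
    (shiftPoly (K := K) c t).Monic ∧
      (shiftPoly (K := K) c t).natDegree = t 0 + ∑ i, t i.succ * c i := by
  have hm : ∀ i, (Polynomial.X ^ c i +
      C (⟨X i, (norm_X i).le⟩ : unitBall (TateAlgebra K n))).Monic := fun i =>
    monic_X_pow_add_C _ (hc i)
  have hp : ∀ i, ((Polynomial.X ^ c i +
      C (⟨X i, (norm_X i).le⟩ : unitBall (TateAlgebra K n))) ^ t i.succ).Monic := fun i =>
    (hm i).pow _
  refine ⟨(monic_X_pow _).mul (monic_prod_of_monic _ _ fun i _ => hp i), ?_⟩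
  rw [shiftPoly, (monic_X_pow _).natDegree_mul (monic_prod_of_monic _ _ fun i _ => hp i),
    natDegree_X_pow, natDegree_prod_of_monic _ _ fun i _ => hp i]
  congr 1
  refine Finset.sum_congr rfl fun i _ => ?_
  rw [(hm i).natDegree_pow, natDegree_X_pow_add_C]

/-- After a shift, a nonzero element is close to a scalar multiple of a monic polynomial. -/
lemma exists_shift_eq {f : TateAlgebra K (n + 1)} (hf : f ≠ 0) :
    ∃ (c : Fin n → ℕ) (a : K) (ω : (unitBall (TateAlgebra K n))[X]) (e : TateAlgebra K (n + 1)),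
      a ≠ 0 ∧ ω.Monic ∧ ‖e‖ < 1 ∧
      shiftEquiv c (1 : unitBall K) f = a • (ofPoly (ofBall ω) + e) ∧
      ((∃ t ≠ 0, ‖coeff t f‖ = ‖f‖) → ω.natDegree ≠ 0) := by
  classical
  have hpos : 0 < ‖f‖ := norm_pos_iff.2 hf
  have hfin : {t | ‖coeff t f‖ = ‖f‖}.Finite := by
    have := (tendsto_coeff f).eventually (gt_mem_nhds hpos)
    refine Set.Finite.subset (Filter.eventually_cofinite.1 this) fun t ht => ?_
    have ht' : ‖coeff t f‖ = ‖f‖ := ht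
    simp [ht']
  set S := hfin.toFinset with hS
  have hmem : ∀ t, t ∈ S ↔ ‖coeff t f‖ = ‖f‖ := fun t => by simp [hS]
  -- `B` exceeds all exponents of the finitely many monomials with coefficient of maximal absolute
  -- value. With `c i` a power of `B`, their weights are numbers written in base `B`, hence
  -- distinct.
  let B := S.sup (fun t => Finset.univ.sup t) + 2
  have hB : ∀ t ∈ S, ∀ i, t i < B := fun t ht i => by
    have h1 : t i ≤ Finset.univ.sup t := Finset.le_sup (Finset.mem_univ i)
    have h2 := Finset.le_sup (f := fun t : Fin (n + 1) →₀ ℕ => Finset.univ.sup t) ht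
    have h3 : Finset.univ.sup t ≤ S.sup fun t => Finset.univ.sup t := h2
    omega
  let c : Fin n → ℕ := fun i => B ^ ((i : ℕ) + 1)
  have hc : ∀ i, c i ≠ 0 := fun i => pow_ne_zero _ (by omega)
  let w : (Fin (n + 1) →₀ ℕ) → ℕ := fun t => t 0 + ∑ i, t i.succ * c i
  have hw : ∀ t, w t = ∑ i, t i * B ^ (i : ℕ) := fun t => by
    rw [Fin.sum_univ_succ]
    simp [w, c]
  have hinj : ∀ t ∈ S, ∀ u ∈ S, w t = w u → t = u := fun t ht u hu h => by
    rw [hw, hw] at h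
    exact DFunLike.coe_injective (sum_mul_pow_injective (hB t ht) (hB u hu) h)
  have hSne : S.Nonempty := by
    obtain ⟨t, ht⟩ := exists_norm_coeff_eq f
    exact ⟨t, (hmem t).2 ht⟩
  obtain ⟨m, hm, hmax⟩ := S.exists_max_image w hSne
  have hmn := (hmem m).1 hm
  have ha : coeff m f ≠ 0 := by rw [← norm_pos_iff, hmn]; exact hpos
  set a := coeff m f with ha_def
  have hb : ∀ t, ‖a⁻¹ * coeff t f‖ ≤ 1 := fun t => by
    rw [norm_mul, norm_inv, hmn, inv_mul_le_iff₀ hpos, mul_one]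
    exact norm_coeff_le f t
  let b : (Fin (n + 1) →₀ ℕ) → unitBall (TateAlgebra K n) := fun t =>
    ⟨algebraMap K _ (a⁻¹ * coeff t f), by
      rw [mem_unitBall, norm_algebraMap', ]; exact hb t⟩
  -- The dominant monomials other than `m` contribute polynomials of strictly smaller degree, so `ω`
  -- is monic of degree `w m`.
  let r : (unitBall (TateAlgebra K n))[X] := ∑ t ∈ S.erase m, C (b t) * shiftPoly c t
  let ω := shiftPoly c m + r
  have hmon := monic_shiftPoly (K := K) hc
  have hr : r.degree < (shiftPoly (K := K) c m).degree := by
    refine (degree_sum_le _ _).trans_lt ?_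
    rw [Finset.sup_lt_iff (by rw [bot_lt_iff_ne_bot]; simpa using (hmon m).1.ne_zero)]
    intro t ht
    rw [C_mul']
    refine (degree_smul_le _ _).trans_lt ?_
    rw [degree_eq_natDegree (hmon t).1.ne_zero, degree_eq_natDegree (hmon m).1.ne_zero,
      (hmon t).2, (hmon m).2]
    have h1 := hmax t (Finset.mem_of_mem_erase ht)
    have h2 : w t ≠ w m := fun h =>
      Finset.ne_of_mem_erase ht (hinj t (Finset.mem_of_mem_erase ht) m hm h)
    exact_mod_cast lt_of_le_of_ne h1 h2
  let f₀ : TateAlgebra K (n + 1) := ∑ t ∈ S, (a⁻¹ * coeff t f) • monomial t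
  let e₀ := a⁻¹ • f - f₀
  have he₀ : ‖e₀‖ < 1 := by
    obtain ⟨t, ht⟩ := exists_norm_coeff_eq e₀
    rw [← ht]
    have h1 : coeff t e₀ = if t ∈ S then 0 else a⁻¹ * coeff t f := by
      simp only [e₀, f₀, map_sub, map_sum, map_smul, coeff_monomial, smul_eq_mul, mul_ite, mul_one,
        mul_zero, Finset.sum_ite_eq]
      split_ifs <;> simp
    rw [h1]
    split_ifs with hts
    · simp
    · rw [norm_mul, norm_inv, hmn, inv_mul_lt_iff₀ hpos, mul_one]
      exact lt_of_le_of_ne (norm_coeff_le f t) fun h => hts ((hmem t).2 h)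
  refine ⟨c, a, ω, shiftEquiv c 1 e₀, ha, (hmon m).1.add_of_left hr, ?_, ?_, ?_⟩
  · rwa [norm_shiftEquiv]
  · have h1 : ofPoly (ofBall ω) = shiftEquiv c (1 : unitBall K) f₀ := by
      have hbm : b m = 1 := Subtype.ext (by
        change algebraMap K _ (a⁻¹ * a) = 1
        rw [inv_mul_cancel₀ ha, map_one])
      have h2 : ω = ∑ t ∈ S, C (b t) * shiftPoly c t := by
        rw [← Finset.add_sum_erase S _ hm, hbm, C_1, one_mul]
      rw [h2, ofBall, Polynomial.map_sum, map_sum, map_sum]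
      refine Finset.sum_congr rfl fun t _ => ?_
      rw [Polynomial.map_mul, Polynomial.map_C, map_mul, ofPoly_C, map_smul, shift_monomial]
      change incl (algebraMap K _ _) * _ = _
      rw [AlgHom.commutes, Algebra.smul_def]
    rw [h1, ← map_add, ← map_smul]
    congr 1
    simp [e₀, smul_smul, mul_inv_cancel₀ ha]
  -- If `ω` had degree 0, the maximal weight would be 0 and the zero index would be the only
  -- dominant one.
  · rintro ⟨t, ht0, ht⟩ h0
    have h1 : w m = 0 := by
      have h2 : ω.natDegree = w m := (natDegree_add_eq_left_of_degree_lt hr).trans (hmon m).2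
      rw [← h2, h0]
    have h2 : w t = 0 := Nat.le_zero.1 (h1 ▸ hmax t ((hmem t).2 ht))
    rw [hw, Finset.sum_eq_zero_iff] at h2
    refine ht0 (Finsupp.ext fun i => ?_)
    have h3 := h2 i (Finset.mem_univ i)
    exact (Nat.mul_eq_zero.1 h3).resolve_right (pow_ne_zero _ (by omega))

end Shift

section Preparation

variable {ω : (unitBall (TateAlgebra K n))[X]} (hω : ω.Monic) {e : TateAlgebra K (n + 1)}
  (he : ‖e‖ < 1)
include hω he

/-- An element close to a monic polynomial divides a monic polynomial of the same degree. -/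
lemma exists_mul_eq_monic : ∃ (q : TateAlgebra K (n + 1)) (ω' : (unitBall (TateAlgebra K n))[X]),
    ω'.Monic ∧ ω'.natDegree = ω.natDegree ∧ q ≠ 0 ∧
      (ofPoly (ofBall ω) + e) * q = ofPoly (ofBall ω') := by
  -- The factor `q` is chosen so that `(ω + e) q` has quotient 1 by `ω`, that is, `q + divW ω (e q)
  -- = 1`. As `‖e‖ < 1`, this equation is solved by inverting `1 - V` with a Neumann series.
  let V : TateAlgebra K (n + 1) →L[K] TateAlgebra K (n + 1) := -((divW ω).comp (mulCLM K e))
  have hV : ‖V‖ < 1 := by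
    refine lt_of_le_of_lt (ContinuousLinearMap.opNorm_le_bound _ (norm_nonneg e) fun x => ?_) he
    change ‖-(divW ω (e * x))‖ ≤ _
    rw [norm_neg]
    exact (norm_divW_le _ _).trans (norm_mul_le _ _)
  let q : TateAlgebra K (n + 1) := ((Units.oneSub V hV)⁻¹ : _ˣ).val 1
  have hq : q + divW ω (e * q) = 1 := by
    have h1 : (1 - V) * ((Units.oneSub V hV)⁻¹ : _ˣ).val = 1 := (Units.oneSub V hV).mul_inv
    have h2 := DFunLike.congr_fun h1 (1 : TateAlgebra K (n + 1))
    have h3 : q - -(divW ω (e * q)) = 1 := h2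
    rwa [sub_neg_eq_add] at h3
  have hqn : ‖q‖ ≤ 1 := by
    by_contra! h
    have h1 : ‖q‖ ≤ max 1 (‖e‖ * ‖q‖) := by
      have h2 : q = 1 - divW ω (e * q) := by rw [← hq]; ring
      conv_lhs => rw [h2]
      rw [sub_eq_add_neg]
      refine (IsUltrametricDist.norm_add_le_max _ _).trans (max_le_max norm_one.le ?_)
      rw [norm_neg]
      exact (norm_divW_le _ _).trans (norm_mul_le _ _)
    rcases le_max_iff.1 h1 with h2 | h2
    · linarith
    · nlinarith
  have hq0 : q ≠ 0 := by
    rintro h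
    rw [h] at hq
    simp at hq
  set g := (ofPoly (ofBall ω) + e) * q with hg
  have hdg : divW ω g = 1 := by
    rw [hg, add_mul, map_add, mul_comm (ofPoly _), divW_mul hω, hq]
  have hgn : ‖g‖ ≤ 1 := by
    refine (norm_mul_le _ _).trans (mul_le_one₀ ?_ (norm_nonneg _) hqn)
    exact (IsUltrametricDist.norm_add_le_max _ _).trans
      (max_le (norm_ofPoly_le _ (norm_coeff_ofBall_le _)) he.le)
  -- With quotient 1, `g` is `ω` plus a remainder of smaller degree. Since `‖g‖ ≤ 1`, the remainder
  -- also has coefficients in the unit ball, and the sum is again monic over it.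
  obtain ⟨p, hp, hpn, hpe⟩ := exists_div_add_poly hω g
  rw [hdg, one_mul] at hpe
  have hpl : p ∈ lifts (unitBall (TateAlgebra K n)).subtype := by
    rw [lifts_iff_coeff_lifts]
    exact fun i => ⟨⟨p.coeff i, (hpn i).trans hgn⟩, rfl⟩
  obtain ⟨p', hp'⟩ := (mem_lifts p).1 hpl
  have hdeg : p'.degree < ω.degree := by
    rw [← hp', degree_map_eq_of_injective Subtype.val_injective] at hp
    exact hp
  refine ⟨q, ω + p', hω.add_of_left hdeg, natDegree_add_eq_left_of_degree_lt hdeg, hq0, ?_⟩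
  rw [← hg, hpe, ofBall, ofBall, Polynomial.map_add, map_add, hp']

/-- If `g` were an inverse, dividing `(ω + e) g = 1` by `ω` would give quotient 0 on the right,
hence `g = -divW ω (e g)` and `‖g‖ ≤ ‖e‖ ‖g‖`, which forces `g = 0`. -/
lemma not_isUnit_add (hdeg : ω.natDegree ≠ 0) : ¬ IsUnit (ofPoly (ofBall ω) + e) := by
  rintro hu
  obtain ⟨g, hg⟩ := hu.exists_right_inv
  have h1 : divW ω 1 = 0 := by
    rw [← map_one ofPoly]
    refine divW_ofPoly_of_degree_lt hω ?_
    rw [degree_one, degree_eq_natDegree hω.ne_zero]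
    exact_mod_cast Nat.pos_of_ne_zero hdeg
  rw [← hg, add_mul, map_add, mul_comm (ofPoly _), divW_mul hω] at h1
  have h2 : ‖g‖ ≤ ‖e‖ * ‖g‖ := by
    conv_lhs => rw [eq_neg_of_add_eq_zero_left h1, norm_neg]
    exact (norm_divW_le _ _).trans (norm_mul_le _ _)
  have h3 : g ≠ 0 := by rintro rfl; simp at hg
  have := norm_pos_iff.2 h3
  nlinarith

end Preparation

/-- Weierstrass preparation: after a shift, every nonzero element divides a monic polynomial. -/
lemma exists_shift_mul_eq_monic {f : TateAlgebra K (n + 1)} (hf : f ≠ 0) :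
    ∃ (c : Fin n → ℕ) (q : TateAlgebra K (n + 1)) (ω : (unitBall (TateAlgebra K n))[X]),
      ω.Monic ∧ q ≠ 0 ∧ shiftEquiv c (1 : unitBall K) f * q = ofPoly (ofBall ω) := by
  obtain ⟨c, a, ω, e, ha, hω, he, h, -⟩ := exists_shift_eq hf
  obtain ⟨q, ω', hω', -, hq, hq'⟩ := exists_mul_eq_monic hω he
  refine ⟨c, a⁻¹ • q, ω', hω', smul_ne_zero (inv_ne_zero ha) hq, ?_⟩
  rw [h, smul_mul_smul_comm, mul_inv_cancel₀ ha, one_smul, hq']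

end TateAlgebra

end AffinoidTorus

namespace AffinoidTorus

open Filter Topology Polynomial

/-! ### Absolute values at points as integrality over the unit ball -/

section Integral

variable {K : Type*} [NontriviallyNormedField K] [IsUltrametricDist K] [CompleteSpace K]

-- The spectral norm is at most 1 exactly when the minimal polynomial has coefficients in the unit
-- ball, and it is bounded by the spectral value of any monic polynomial with that root. Conditions
-- `|f(x)| ≤ 1` thus become integrality conditions accessible to commutative algebra.
omit [CompleteSpace K] in
lemma isIntegral_unitBall_iff {F : Type*} [Field F] [Algebra K F] [Algebra.IsAlgebraic K F]
    (x : F) : IsIntegral (unitBall K) x ↔ spectralNorm K F x ≤ 1 := by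
  constructor
  · rintro ⟨p, hp, hpx⟩
    have hm : (ofBall p).Monic := hp.map _
    have h := norm_root_le_spectralValue (f := spectralAlgNorm K F) spectralAlgNorm_isPowMul
      isNonarchimedean_spectralNorm hm (x := x) (by
        rw [aeval_def, ofBall, eval₂_map]
        exact hpx)
    exact h.trans ((spectralValue_le_one_iff hm).2 (norm_coeff_ofBall_le p))
  · intro h
    have hm := minpoly.monic (Algebra.IsAlgebraic.isAlgebraic (R := K) x).isIntegral
    have h1 := (spectralValue_le_one_iff hm).1 h
    have h2 : minpoly K x ∈ lifts (unitBall K).subtype := by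
      rw [lifts_iff_coeff_lifts]
      exact fun i => ⟨⟨_, h1 i⟩, rfl⟩
    obtain ⟨q, hq, -, hqm⟩ := lifts_and_degree_eq_and_monic h2 hm
    refine ⟨q, hqm, ?_⟩
    have h3 := minpoly.aeval K x
    rw [← hq, aeval_def, eval₂_map] at h3
    exact h3

omit [CompleteSpace K] in
lemma isIntegral_unitBall_algebraMap_iff {F : Type*} [Field F] [Algebra K F]
    [Algebra.IsAlgebraic K F] (c : K) :
    IsIntegral (unitBall K) (algebraMap K F c) ↔ ‖c‖ ≤ 1 := by
  rw [isIntegral_unitBall_iff, spectralNorm_extends]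

/-- Elements of the unit ball of a Banach algebra have integral values. -/
lemma isIntegral_map_of_norm_le_one {A : Type*} [NormedCommRing A] [NormedAlgebra K A]
    [CompleteSpace A] [IsUltrametricDist A] [NormOneClass A] {F : Type*} [Field F] [Algebra K F]
    [Algebra.IsAlgebraic K F] (f : A →ₐ[K] F) {a : A} (ha : ‖a‖ ≤ 1) :
    IsIntegral (unitBall K) (f a) := by
  rw [isIntegral_unitBall_iff]
  by_contra! hσ
  set σ := spectralNorm K F (f a) with hσ_def
  set p := minpoly K (f a) with hp
  have hint := (Algebra.IsAlgebraic.isAlgebraic (R := K) (f a)).isIntegral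
  have hm : p.Monic := minpoly.monic hint
  have hn : 0 < p.natDegree := minpoly.natDegree_pos hint
  have hc0 : ‖p.coeff 0‖ = σ ^ p.natDegree := by
    rw [hσ_def, spectralNorm.spectralNorm_eq_norm_coeff_zero_rpow, ← Real.rpow_natCast,
      ← Real.rpow_mul (norm_nonneg _), one_div, inv_mul_cancel₀ (by exact_mod_cast hn.ne'),
      Real.rpow_one]
  have hci : ∀ i, ‖p.coeff i‖ ≤ σ ^ (p.natDegree - i) := fun i => by
    rcases lt_trichotomy i p.natDegree with hi | hi | hi
    · have h1 : ‖p.coeff i‖ ^ (1 / (p.natDegree - i : ℝ)) ≤ σ := by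
        rw [← spectralValueTerms_of_lt_natDegree p hi]
        exact le_ciSup (spectralValueTerms_bddAbove p) i
      have hpos : 0 < (p.natDegree - i : ℕ) := by omega
      have h2 : ((p.natDegree - i : ℕ) : ℝ) = p.natDegree - i := by
        rw [Nat.cast_sub hi.le]
      rw [← h2] at h1
      calc ‖p.coeff i‖ = (‖p.coeff i‖ ^ (1 / ((p.natDegree - i : ℕ) : ℝ))) ^ (p.natDegree - i) := by
            rw [← Real.rpow_natCast, ← Real.rpow_mul (norm_nonneg _), one_div,
              inv_mul_cancel₀ (by exact_mod_cast hpos.ne'), Real.rpow_one]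
        _ ≤ _ := pow_le_pow_left₀ (Real.rpow_nonneg (norm_nonneg _) _) h1 _
    · rw [hi, hm.coeff_natDegree]; simp
    · rw [coeff_eq_zero_of_natDegree_lt hi]; simp; positivity
  have hcpos : 0 < ‖p.coeff 0‖ := by rw [hc0]; positivity
  have hc : p.coeff 0 ≠ 0 := norm_pos_iff.1 hcpos
  -- If `σ > 1`, the constant term of `p` dominates: `p(a) = p(0) (1 + x)` with `‖x‖ ≤ σ⁻¹ < 1`. So
  -- `p(a)` is a unit of `A`, although `f` sends it to 0.
  let x : A := ∑ i ∈ Finset.range p.natDegree, ((p.coeff 0)⁻¹ * p.coeff (i + 1)) • a ^ (i + 1)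
  have hx : ‖x‖ ≤ σ⁻¹ := by
    refine IsUltrametricDist.norm_sum_le_of_forall_le_of_nonneg (by positivity) fun i hi => ?_
    have hi' := Finset.mem_range.1 hi
    rw [norm_smul, norm_mul, norm_inv, hc0]
    have h1 : ‖a ^ (i + 1)‖ ≤ 1 := (norm_pow_le _ _).trans (pow_le_one₀ (norm_nonneg _) ha)
    have h2 : ‖p.coeff (i + 1)‖ ≤ σ ^ (p.natDegree - 1) :=
      (hci _).trans (pow_le_pow_right₀ hσ.le (by omega))
    calc _ ≤ ((σ ^ p.natDegree)⁻¹ * σ ^ (p.natDegree - 1)) * 1 := by gcongr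
      _ = σ⁻¹ := by
        have h3 : σ ^ p.natDegree = σ ^ (p.natDegree - 1) * σ := by
          rw [← pow_succ]; congr 1; omega
        rw [h3]
        field_simp
  have hx1 : ‖-x‖ < 1 := by
    rw [norm_neg]
    exact hx.trans_lt (inv_lt_one_of_one_lt₀ hσ)
  have hu : IsUnit (1 + x) := by
    have := (Units.oneSub (-x) hx1).isUnit
    rwa [Units.val_oneSub, sub_neg_eq_add] at this
  have hpa : aeval a p = algebraMap K A (p.coeff 0) * (1 + x) := by
    rw [aeval_eq_sum_range, Finset.sum_range_succ', pow_zero, mul_add, mul_one,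
      ← Algebra.smul_def, Finset.smul_sum, Algebra.algebraMap_eq_smul_one, add_comm]
    congr 1
    refine Finset.sum_congr rfl fun i _ => ?_
    rw [smul_smul, mul_inv_cancel_left₀ hc]
  have h0 : f (aeval a p) = 0 := by rw [← aeval_algHom_apply]; exact minpoly.aeval K (f a)
  rw [hpa, map_mul, AlgHom.commutes] at h0
  rcases mul_eq_zero.1 h0 with h | h
  · exact hc ((map_eq_zero _).1 h)
  · exact (hu.map f).ne_zero h

/-- Integrality can be checked modulo all prime ideals. -/
lemma isIntegralElem_of_forall_prime {R A : Type*} [CommRing R] [CommRing A] (χ : R →+* A) (u : A)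
    (h : ∀ p : Ideal A, p.IsPrime →
      ((Ideal.Quotient.mk p).comp χ).IsIntegralElem (Ideal.Quotient.mk p u)) :
    χ.IsIntegralElem u := by
  -- The values at `u` of monic polynomials form a multiplicative set. If `u` is not integral it
  -- omits 0, and some prime ideal avoids it; integrality modulo that prime is then contradicted.
  let S : Submonoid A :=
    { carrier := {a | ∃ P : R[X], P.Monic ∧ eval₂ χ u P = a}
      one_mem' := ⟨1, monic_one, by simp⟩
      mul_mem' := by
        rintro _ _ ⟨P, hP, rfl⟩ ⟨Q, hQ, rfl⟩
        exact ⟨P * Q, hP.mul hQ, by rw [eval₂_mul]⟩ }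
  by_contra hu
  have h0 : (0 : A) ∉ S := hu
  obtain ⟨p, hp, -, hd⟩ := Ideal.exists_le_prime_disjoint (⊥ : Ideal A) S (by
    rw [Set.disjoint_left]
    rintro x hx hxS
    have hx0 : x = 0 := hx
    exact h0 (hx0 ▸ hxS))
  obtain ⟨P, hP, hP0⟩ := h p hp
  rw [← hom_eval₂, Ideal.Quotient.eq_zero_iff_mem] at hP0
  exact Set.disjoint_left.1 hd hP0 ⟨P, hP, rfl⟩

lemma homogenize_div {F : Type*} [Field F] (a : F) {b : F} (hb : b ≠ 0) (N : ℕ) (t : ℕ → F) :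
    a ^ N + ∑ i ∈ Finset.range N, t i * a ^ i * b ^ (N - i) =
      ((a / b) ^ N + ∑ i ∈ Finset.range N, t i * (a / b) ^ i) * b ^ N := by
  rw [add_mul, Finset.sum_mul, div_pow, div_mul_cancel₀ _ (pow_ne_zero _ hb)]
  congr 1
  refine Finset.sum_congr rfl fun i hi => ?_
  have h1 : b ^ N = b ^ i * b ^ (N - i) := by
    rw [← pow_add, Nat.add_sub_cancel' (Finset.mem_range.1 hi).le]
  rw [h1, mul_assoc, mul_assoc, ← mul_assoc ((a / b) ^ i), ← mul_pow, div_mul_cancel₀ _ hb]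

/-- Divisibility in an integrally closed domain from a homogenized integral equation. -/
lemma dvd_of_homogenized {R : Type*} [CommRing R] [IsDomain R] [IsIntegrallyClosed R] {r W s : R}
    (hW : W ≠ 0) {N : ℕ} (hN : N ≠ 0) (t : ℕ → R)
    (h : r ^ N + ∑ i ∈ Finset.range N, t i * r ^ i * W ^ (N - i) = W ^ N * s) : W ∣ r := by
  let L := FractionRing R
  let j := algebraMap R L
  have hj : Function.Injective j := IsFractionRing.injective _ _
  have hW0 : j W ≠ 0 := by rwa [Ne, map_eq_zero_iff j hj]
  -- Dividing the relation by `W ^ N` gives a monic equation for `r / W`, with constant term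
  -- corrected by `s`.
  have hz : IsIntegral R (j r / j W) := by
    have hlt : (∑ i ∈ Finset.range N, C (t i) * Polynomial.X ^ i - C s).degree < N := by
      refine (degree_sub_le _ _).trans_lt (max_lt ?_ ?_)
      · refine (degree_sum_le _ _).trans_lt ?_
        rw [Finset.sup_lt_iff (WithBot.bot_lt_coe _)]
        exact fun i hi => (degree_C_mul_X_pow_le _ _).trans_lt
          (by exact_mod_cast Finset.mem_range.1 hi)
      · exact degree_C_le.trans_lt (by exact_mod_cast Nat.pos_of_ne_zero hN)
    refine ⟨Polynomial.X ^ N + (∑ i ∈ Finset.range N, C (t i) * Polynomial.X ^ i - C s),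
      monic_X_pow_add hlt, ?_⟩
    have hs := congrArg j h
    simp only [map_add, map_mul, map_pow, map_sum] at hs
    rw [homogenize_div _ hW0 N fun i => j (t i), mul_comm] at hs
    have hs' := mul_left_cancel₀ (pow_ne_zero N hW0) hs
    simp only [eval₂_add, eval₂_sub, eval₂_finsetSum, eval₂_mul, eval₂_pow, eval₂_X, eval₂_C]
    rw [← add_sub_assoc, sub_eq_zero]
    exact hs'
  obtain ⟨z, hz'⟩ := IsIntegrallyClosed.isIntegral_iff.1 hz
  refine ⟨z, hj ?_⟩
  rw [map_mul]
  change _ = _ * algebraMap _ L z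
  rw [hz', mul_div_cancel₀ _ hW0]

lemma isIntegrallyClosed_of_forall_dvd {S : Type*} [CommRing S] [IsDomain S]
    (H : ∀ j : S →+* FractionRing S, Function.Injective j → ∀ h f, f ≠ 0 →
      j.IsIntegralElem (j h / j f) → f ∣ h) : IsIntegrallyClosed S := by
  refine (isIntegrallyClosed_iff (FractionRing S)).2 fun {x} hx => ?_
  obtain ⟨h, f, hf, rfl⟩ := IsFractionRing.div_surjective (A := S) x
  have hf0 : f ≠ 0 := nonZeroDivisors.ne_zero hf
  have hj : Function.Injective (algebraMap S (FractionRing S)) := IsFractionRing.injective _ _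
  obtain ⟨z, hz⟩ := H (algebraMap S (FractionRing S)) hj h f hf0 hx
  refine ⟨z, ?_⟩
  rw [hz, map_mul, mul_div_cancel_left₀]
  rwa [Ne, map_eq_zero_iff _ hj]

end Integral

namespace TateAlgebra

variable {K : Type*} [NontriviallyNormedField K] [IsUltrametricDist K] [CompleteSpace K] {n : ℕ}

/-! ### Tate algebras are integrally closed -/

section IntegrallyClosed

omit [CompleteSpace K] in
lemma algebraMap_zero_bijective : Function.Bijective (algebraMap K (TateAlgebra K 0)) := by
  refine ⟨(algebraMap K (TateAlgebra K 0)).injective, fun f => ⟨coeff 0 f, coeff_ext fun t => ?_⟩⟩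
  classical
  rw [Subsingleton.elim t 0, Algebra.algebraMap_eq_smul_one, map_smul, ← monomial_zero,
    coeff_monomial]
  simp

/-- Weierstrass division replaces `h` by its remainder `r`, a polynomial of degree less than that of
`ω`. Reducing the coefficients of the homogenized integral equation modulo `ω ^ N` turns it into a
relation between polynomials over the smaller Tate algebra. That polynomial ring is integrally
closed, so `ω` divides `r`, and `r = 0` by degrees. -/
lemma dvd_of_isIntegralElem_div [IsIntegrallyClosed (TateAlgebra K n)]
    {ω : (unitBall (TateAlgebra K n))[X]} (hω : ω.Monic) {F : Type*} [Field F]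
    (φ : TateAlgebra K (n + 1) →+* F) (hφ : Function.Injective φ) (h : TateAlgebra K (n + 1))
    (hint : φ.IsIntegralElem (φ h / φ (ofPoly (ofBall ω)))) : ofPoly (ofBall ω) ∣ h := by
  have hm : (ofBall ω).Monic := hω.map _
  set w := ofPoly (ofBall ω) with hw
  have hw0 : φ w ≠ 0 := by
    rw [Ne, map_eq_zero_iff φ hφ, hw, map_eq_zero_iff _ ofPoly_injective]
    exact hm.ne_zero
  obtain ⟨r, hr, -, hhr⟩ := exists_div_add_poly hω h
  rw [← hw] at hhr
  suffices hr0 : r = 0 by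
    rw [hr0, map_zero, add_zero] at hhr
    exact ⟨divW ω h, by rw [mul_comm]; exact hhr⟩
  have hy : φ.IsIntegralElem (φ (ofPoly r) / φ w) := by
    have : φ (ofPoly r) / φ w = φ h / φ w - φ (divW ω h) := by
      rw [eq_sub_iff_add_eq, div_add' _ _ _ hw0, ← map_mul, ← map_add, add_comm (ofPoly r),
        ← hhr]
    rw [this]
    exact hint.sub φ (RingHom.isIntegralElem_map φ)
  obtain ⟨p, hp, hp0⟩ := hy
  set N := p.natDegree with hN
  have hN0 : N ≠ 0 := by
    intro h0
    rw [hp.natDegree_eq_zero.1 h0] at hp0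
    simp at hp0
  have hrel : ofPoly r ^ N + ∑ i ∈ Finset.range N, p.coeff i * ofPoly r ^ i * w ^ (N - i) = 0 := by
    apply hφ
    rw [eval₂_eq_sum_range, ← hN, Finset.sum_range_succ, hN, hp.coeff_natDegree, ← hN, map_one,
      one_mul, add_comm] at hp0
    simp only [map_zero, map_add, map_pow, map_sum, map_mul]
    rw [homogenize_div _ hw0 N fun i => φ (p.coeff i), hp0, zero_mul]
  have hωN : (ω ^ N).Monic := hω.pow N
  have hwN : ofPoly (ofBall (ω ^ N)) = w ^ N := by simp [hw, ofBall]
  choose t _ _ ht using fun i => exists_div_add_poly hωN (p.coeff i)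
  simp only [hwN] at ht
  let G : (TateAlgebra K n)[X] :=
    r ^ N + ∑ i ∈ Finset.range N, t i * r ^ i * ofBall ω ^ (N - i)
  have hG : ofBall (ω ^ N) ∣ G := by
    refine dvd_of_ofPoly_dvd hωN ⟨-∑ i ∈ Finset.range N,
      divW (ω ^ N) (p.coeff i) * ofPoly r ^ i * w ^ (N - i), ?_⟩
    have h1 : ofPoly G = ofPoly r ^ N +
        ∑ i ∈ Finset.range N, ofPoly (t i) * ofPoly r ^ i * w ^ (N - i) := by
      simp [G, hw]
    have h2 : ∑ i ∈ Finset.range N, p.coeff i * ofPoly r ^ i * w ^ (N - i) =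
        w ^ N * ∑ i ∈ Finset.range N, divW (ω ^ N) (p.coeff i) * ofPoly r ^ i * w ^ (N - i) +
        ∑ i ∈ Finset.range N, ofPoly (t i) * ofPoly r ^ i * w ^ (N - i) := by
      rw [Finset.mul_sum, ← Finset.sum_add_distrib]
      refine Finset.sum_congr rfl fun i _ => ?_
      conv_lhs => rw [ht i]
      ring
    rw [h2] at hrel
    rw [h1, hwN]
    linear_combination hrel
  obtain ⟨s, hs⟩ := hG
  have hdvd : ofBall ω ∣ r := dvd_of_homogenized hm.ne_zero hN0 t (s := s) (by
    rw [← Polynomial.map_pow]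
    exact hs)
  by_contra hr0
  refine hm.not_dvd_of_degree_lt hr0 ?_ hdvd
  rwa [ofBall, hω.degree_map]

-- Induction on the number of variables. Preparation makes any denominator, after a shift and
-- multiplication by some `q`, a monic polynomial, for which `dvd_of_isIntegralElem_div` applies;
-- `q` is then cancelled.
variable (K) in
theorem isIntegrallyClosed (n : ℕ) : IsIntegrallyClosed (TateAlgebra K n) := by
  induction n with
  | zero => 
    exact IsIntegrallyClosed.of_equiv (R := K)
      (RingEquiv.ofBijective (algebraMap K (TateAlgebra K 0)) algebraMap_zero_bijective)
  | succ n ih =>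
    refine isIntegrallyClosed_of_forall_dvd fun j hj h f hf0 hx => ?_
    obtain ⟨c, q, ω, hω, hq, hfq⟩ := exists_shift_mul_eq_monic hf0
    let σ := shiftEquiv c (1 : unitBall K)
    let φ := j.comp (σ.symm : TateAlgebra K (n + 1) →+* TateAlgebra K (n + 1))
    have hφ : Function.Injective φ := hj.comp σ.symm.injective
    have hφσ : ∀ x, φ (σ x) = j x := fun x => congrArg j (σ.symm_apply_apply x)
    have hq0 : φ q ≠ 0 := by rwa [Ne, map_eq_zero_iff φ hφ]
    have hint : φ.IsIntegralElem (φ (σ h * q) / φ (ofPoly (ofBall ω))) := by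
      rw [← hfq, map_mul, map_mul, hφσ]
      change φ.IsIntegralElem (_ / (φ (σ f) * _))
      rw [hφσ, mul_div_mul_right _ _ hq0]
      obtain ⟨p, hp, hp0⟩ := hx
      refine ⟨p.map (σ : TateAlgebra K (n + 1) →+* TateAlgebra K (n + 1)), hp.map _, ?_⟩
      have hcomp : φ.comp (σ : TateAlgebra K (n + 1) →+* TateAlgebra K (n + 1)) = j :=
        RingHom.ext hφσ
      rwa [eval₂_map, hcomp]
    have hd := dvd_of_isIntegralElem_div hω φ hφ _ hint
    rw [← hfq] at hd
    have hd2 : σ f ∣ σ h := (mul_dvd_mul_iff_right hq).1 hd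
    exact (map_dvd_iff σ).1 hd2

end IntegrallyClosed

end TateAlgebra

end AffinoidTorus

namespace AffinoidTorus

open Filter Topology Polynomial

namespace TateAlgebra

universe v

variable {K : Type*} [NontriviallyNormedField K] [IsUltrametricDist K] [CompleteSpace K] {n : ℕ}

/-! ### Noether normalization, the Nullstellensatz and the maximum modulus for Tate algebras -/

section Descent

/-- Once `ω` is killed, every series equals its remainder, a polynomial in the first variable, and
that variable is itself a root of `ω`. -/
lemma isIntegralElem_of_eq_zero {ω : (unitBall (TateAlgebra K n))[X]} (hω : ω.Monic) {A : Type*}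
    [CommRing A] (φ : TateAlgebra K (n + 1) →+* A) (h0 : φ (ofPoly (ofBall ω)) = 0)
    (f : TateAlgebra K (n + 1)) :
    (φ.comp (incl : TateAlgebra K n →ₐ[K] TateAlgebra K (n + 1)).toRingHom).IsIntegralElem
      (φ f) := by
  set ψ := φ.comp (incl : TateAlgebra K n →ₐ[K] TateAlgebra K (n + 1)).toRingHom with hψ
  have hev : ∀ p, φ (ofPoly p) = eval₂ ψ (φ (X 0)) p := fun p => by
    rw [ofPoly, coe_eval₂RingHom, hom_eval₂]
  have hX : ψ.IsIntegralElem (φ (X 0)) := ⟨ofBall ω, hω.map _, by rw [← hev, h0]⟩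
  obtain ⟨p, -, -, hp⟩ := exists_div_add_poly hω f
  rw [hp, map_add, map_mul, h0, mul_zero, zero_add, hev]
  clear hp
  induction p using Polynomial.induction_on' with
  | add p q hp hq => rw [eval₂_add]; exact hp.add ψ hq
  | monomial k a =>
    rw [eval₂_monomial]
    refine (ψ.isIntegralElem_map).mul ψ ?_
    induction k with
    | zero => rw [pow_zero]; exact ψ.isIntegralElem_one
    | succ k ih => rw [pow_succ]; exact ih.mul ψ hX

/-- An integral homomorphism which is not injective comes from a smaller Tate algebra. -/
lemma exists_isIntegral_comp {A : Type*} [CommRing A] [Algebra K A]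
    (φ : TateAlgebra K (n + 1) →ₐ[K] A) (hφ : φ.toRingHom.IsIntegral)
    {f : TateAlgebra K (n + 1)} (hf : f ≠ 0) (hφf : φ f = 0) :
    ∃ τ : TateAlgebra K n →ₐ[K] TateAlgebra K (n + 1), (∀ g, ‖τ g‖ ≤ ‖g‖) ∧
      (φ.comp τ).toRingHom.IsIntegral := by
  obtain ⟨c, q, ω, hω, hq, hfq⟩ := exists_shift_mul_eq_monic hf
  let σ := shiftEquiv c (1 : unitBall K)
  let τ : TateAlgebra K n →ₐ[K] TateAlgebra K (n + 1) :=
    (σ.symm : TateAlgebra K (n + 1) →ₐ[K] TateAlgebra K (n + 1)).comp incl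
  refine ⟨τ, fun g => ?_, ?_⟩
  · refine le_trans (le_of_eq ?_) (norm_incl_le g)
    rw [← norm_shiftEquiv c 1]
    exact congrArg norm (σ.apply_symm_apply (incl g))
  let φ' : TateAlgebra K (n + 1) →+* A :=
    φ.toRingHom.comp (σ.symm : TateAlgebra K (n + 1) →+* TateAlgebra K (n + 1))
  have hφ' : ∀ x, φ' (σ x) = φ x := fun x => congrArg φ (σ.symm_apply_apply x)
  have hint : φ'.IsIntegral := fun a => by
    obtain ⟨p, hp, hp0⟩ := hφ a
    refine ⟨p.map (σ : TateAlgebra K (n + 1) →+* TateAlgebra K (n + 1)), hp.map _, ?_⟩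
    have hcomp : φ'.comp (σ : TateAlgebra K (n + 1) →+* TateAlgebra K (n + 1)) = φ.toRingHom :=
      RingHom.ext hφ'
    rwa [eval₂_map, hcomp]
  have h0 : φ' (ofPoly (ofBall ω)) = 0 := by
    rw [← hfq, map_mul]
    change φ' (σ f) * _ = 0
    rw [hφ', hφf, zero_mul]
  -- The composite factors through the range of `φ'`: the first map is integral because `ω` vanishes
  -- there, the second because `φ'` is integral.
  have h1 : (φ'.rangeRestrict.comp
      (incl : TateAlgebra K n →ₐ[K] TateAlgebra K (n + 1)).toRingHom).IsIntegral := fun y => by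
    obtain ⟨x, rfl⟩ := φ'.rangeRestrict_surjective y
    exact isIntegralElem_of_eq_zero hω φ'.rangeRestrict (Subtype.ext h0) x
  have h2 : φ'.range.subtype.IsIntegral :=
    RingHom.IsIntegral.tower_top φ'.rangeRestrict _ hint
  have h3 := RingHom.IsIntegral.trans (φ'.rangeRestrict.comp
    (incl : TateAlgebra K n →ₐ[K] TateAlgebra K (n + 1)).toRingHom) φ'.range.subtype h1 h2
  exact h3

end Descent

section Nullstellensatz

lemma not_isUnit_X_zero : ¬ IsUnit (X 0 : TateAlgebra K (n + 1)) := by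
  have hm : (Polynomial.X : (unitBall (TateAlgebra K n))[X]).Monic := monic_X
  have hd : (Polynomial.X : (unitBall (TateAlgebra K n))[X]).natDegree ≠ 0 := by
    rw [natDegree_X]; exact one_ne_zero
  have h0 : ‖(0 : TateAlgebra K (n + 1))‖ < 1 := by rw [norm_zero]; exact one_pos
  have h := not_isUnit_add hm h0 hd
  rwa [add_zero, ofBall, Polynomial.map_X, ofPoly_X] at h

/-- The Nullstellensatz for Tate algebras. -/
theorem isAlgebraic_of_isIntegral : ∀ {n : ℕ} {A : Type v} [Field A] [Algebra K A]
    (φ : TateAlgebra K n →ₐ[K] A), φ.toRingHom.IsIntegral → Algebra.IsAlgebraic K A := by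
  intro n
  induction n with
  | zero =>
    intro A _ _ φ hφ
    have h1 : (algebraMap K (TateAlgebra K 0)).IsIntegral :=
      RingHom.isIntegral_of_surjective _ algebraMap_zero_bijective.2
    have h2 : (φ.toRingHom.comp (algebraMap K (TateAlgebra K 0))).IsIntegral :=
      RingHom.IsIntegral.trans _ _ h1 hφ
    have h3 : φ.toRingHom.comp (algebraMap K (TateAlgebra K 0)) = algebraMap K A :=
      RingHom.ext φ.commutes
    rw [h3] at h2
    have : Algebra.IsIntegral K A := ⟨h2⟩
    infer_instance
  | succ n ih =>
    intro A _ _ φ hφ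
    by_cases hinj : Function.Injective φ
    -- An injective integral map to a field would make the Tate algebra a field, but its first
    -- variable is neither zero nor a unit. Otherwise a kernel element lowers the number of
    -- variables.
    · exfalso
      let _ : Algebra (TateAlgebra K (n + 1)) A := φ.toRingHom.toAlgebra
      have : Algebra.IsIntegral (TateAlgebra K (n + 1)) A := ⟨hφ⟩
      have hfield : IsField (TateAlgebra K (n + 1)) :=
        isField_of_isIntegral_of_isField (S := A) hinj (Field.toIsField A)
      obtain ⟨y, hy⟩ := hfield.mul_inv_cancel
        (a := (X 0 : TateAlgebra K (n + 1))) (by rw [← norm_ne_zero_iff, norm_X]; exact one_ne_zero)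
      exact not_isUnit_X_zero (IsUnit.of_mul_eq_one y hy)
    · rw [injective_iff_map_eq_zero] at hinj
      push Not at hinj
      obtain ⟨f, hf, hf0⟩ := hinj
      obtain ⟨τ, -, hτ⟩ := exists_isIntegral_comp φ hφ hf0 hf
      exact ih (φ.comp τ) hτ

lemma isAlgebraic_quotient (y : Ideal (TateAlgebra K n)) [y.IsMaximal] :
    Algebra.IsAlgebraic K (TateAlgebra K n ⧸ y) := by
  let _ := Ideal.Quotient.field y
  exact isAlgebraic_of_isIntegral (Ideal.Quotient.mkₐ K y)
    (RingHom.isIntegral_of_surjective _ (Ideal.Quotient.mkₐ_surjective K y))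

/-- The maximum modulus principle for Tate algebras: an element with integral values at all
points lies in the unit ball. -/
theorem norm_le_one_of_isIntegral {a : TateAlgebra K n}
    (h : ∀ y : Ideal (TateAlgebra K n), y.IsMaximal →
      IsIntegral (unitBall K) (Ideal.Quotient.mk y a)) : ‖a‖ ≤ 1 := by
  cases n with
  | zero =>
    obtain ⟨c, rfl⟩ := algebraMap_zero_bijective.2 a
    obtain ⟨y, hy⟩ := Ideal.exists_maximal (TateAlgebra K 0)
    let _ := Ideal.Quotient.field y
    have := isAlgebraic_quotient y
    rw [norm_algebraMap', ← isIntegral_unitBall_algebraMap_iff (F := TateAlgebra K 0 ⧸ y)]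
    exact h y hy
  | succ n =>
    classical
    by_contra! ha
    obtain ⟨t, ht⟩ := exists_norm_coeff_eq a
    set c := coeff t a with hc
    have hc0 : c ≠ 0 := by rw [← norm_pos_iff, ht]; linarith
    have hX : (X 0 : TateAlgebra K (n + 1)) = monomial (Finsupp.single 0 1) := rfl
    have hcoeff : coeff (t + Finsupp.single 0 1) (a * X 0) = c := by
      have h1 := MvPowerSeries.coeff_add_mul_monomial t (Finsupp.single 0 1)
        (a : MvPowerSeries (Fin (n + 1)) K) 1
      rw [mul_one] at h1
      exact h1
    -- If `‖a‖ = |c| > 1`, this `g` has norm 1, attained at a nonzero index thanks to the factor `X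
    -- 0`; hence it is not a unit. At a maximal ideal containing `g` the product `a X 0` takes the
    -- value `-c`, which is not integral.
    set g : TateAlgebra K (n + 1) := 1 + c⁻¹ • (a * X 0) with hg
    have hne : t + Finsupp.single 0 1 ≠ 0 := fun h0 => by
      have := DFunLike.congr_fun h0 0
      simp at this
    have hg1 : coeff (t + Finsupp.single 0 1) g = 1 := by
      rw [hg, map_add, map_smul, hcoeff, ← monomial_zero, coeff_monomial, if_neg hne, smul_eq_mul,
        inv_mul_cancel₀ hc0, zero_add]
    have hgn : ‖g‖ = 1 := by
      refine le_antisymm ((IsUltrametricDist.norm_add_le_max _ _).trans (max_le norm_one.le ?_)) ?_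
      · rw [norm_smul, norm_inv, ht]
        have h1 : ‖a * X 0‖ ≤ ‖a‖ := (norm_mul_le _ _).trans (by rw [norm_X, mul_one])
        rw [inv_mul_le_iff₀ (by linarith), mul_one]
        exact h1
      · have := norm_coeff_le g (t + Finsupp.single 0 1)
        rwa [hg1, norm_one] at this
    have hg0 : g ≠ 0 := by rw [← norm_pos_iff, hgn]; exact one_pos
    have hgu : ¬ IsUnit g := by
      obtain ⟨d, k, ω, e, hk, hω, he, hge, hdeg⟩ := exists_shift_eq hg0
      intro hu
      refine not_isUnit_add hω he (hdeg ⟨_, hne, by rw [hg1, hgn, norm_one]⟩) ?_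
      have h1 : IsUnit (shiftEquiv d (1 : unitBall K) g) := hu.map _
      rw [hge, Algebra.smul_def] at h1
      exact isUnit_of_mul_isUnit_right h1
    obtain ⟨y, hy, hgy⟩ := exists_max_ideal_of_mem_nonunits hgu
    let _ := Ideal.Quotient.field y
    have := isAlgebraic_quotient y
    have hX1 : IsIntegral (unitBall K) (Ideal.Quotient.mk y (X 0)) :=
      isIntegral_map_of_norm_le_one (Ideal.Quotient.mkₐ K y) (norm_X 0).le
    have hprod := (h y hy).mul hX1
    have h2 : Ideal.Quotient.mk y a * Ideal.Quotient.mk y (X 0) =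
        algebraMap K (TateAlgebra K (n + 1) ⧸ y) (-c) := by
      have h3 : a * X 0 = c • g + algebraMap K (TateAlgebra K (n + 1)) (-c) := by
        rw [hg, smul_add, smul_smul, mul_inv_cancel₀ hc0, one_smul, map_neg,
          Algebra.algebraMap_eq_smul_one]
        ring
      rw [← map_mul, h3, map_add, Algebra.smul_def, map_mul, Ideal.Quotient.eq_zero_iff_mem.2 hgy,
        mul_zero, zero_add]
      rfl
    rw [h2, isIntegral_unitBall_algebraMap_iff, norm_neg, ht] at hprod
    linarith

end Nullstellensatz

end TateAlgebra

end AffinoidTorus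

namespace AffinoidTorus

open Filter Topology Polynomial

universe v

/-! ### From values at points to integrality over the unit ball -/

section MaximalLift

/-- A root of a specialization of the minimal polynomial of `u` is the value of `u` at some
maximal ideal. -/
lemma exists_isMaximal_of_eval₂_minpoly {R A Ω : Type*} [CommRing R] [IsDomain R]
    [IsIntegrallyClosed R] [CommRing A] [IsDomain A] [Algebra R A]
    [Algebra.IsIntegral R A] (hRA : Function.Injective (algebraMap R A)) [Field Ω] (θ : R →+* Ω) (hθ : (RingHom.ker θ).IsMaximal) (u : A)
    (α : Ω) (hα : eval₂ θ α (minpoly R u) = 0) :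
    ∃ M : Ideal A, M.IsMaximal ∧ ∀ q : R[X], aeval u q ∈ M → eval₂ θ α q = 0 := by
  have : FaithfulSMul R A := (faithfulSMul_iff_algebraMap_injective R A).2 hRA
  have hu : IsIntegral R u := Algebra.IsIntegral.isIntegral u
  let P := minpoly R u
  -- As `R` is integrally closed, `κ` identifies `AdjoinRoot P` with the subring generated by `u`.
  -- The root `α` defines a maximal ideal of it, the kernel of `g`, and lying over for the integral
  -- extension `A` gives `M`.
  let κ : AdjoinRoot P →+* A := AdjoinRoot.lift (algebraMap R A) u (minpoly.aeval R u)
  let g : AdjoinRoot P →+* Ω := AdjoinRoot.lift θ α hα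
  have hκmk : ∀ q : R[X], κ (AdjoinRoot.mk P q) = aeval u q := fun q => AdjoinRoot.lift_mk _ _
  have hgmk : ∀ q : R[X], g (AdjoinRoot.mk P q) = eval₂ θ α q := fun q => AdjoinRoot.lift_mk _ _
  have hκ : Function.Injective κ := by
    refine (injective_iff_map_eq_zero κ).2 fun x hx => ?_
    obtain ⟨q, rfl⟩ := AdjoinRoot.mk_surjective x
    rw [hκmk, minpoly.isIntegrallyClosed_dvd_iff hu] at hx
    exact AdjoinRoot.mk_eq_zero.2 hx
  have hof : (AdjoinRoot.of P).IsIntegral := by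
    have : Module.Finite R (AdjoinRoot P) := (minpoly.monic hu).finite_adjoinRoot
    exact fun x => Algebra.IsIntegral.isIntegral (R := R) x
  have hκof : κ.comp (AdjoinRoot.of P) = algebraMap R A :=
    RingHom.ext fun r => (hκmk (C r)).trans (aeval_C _ _)
  have hgof : g.comp (AdjoinRoot.of P) = θ := RingHom.ext fun r => (hgmk (C r)).trans (eval₂_C _ _)
  have hκi : κ.IsIntegral := RingHom.IsIntegral.tower_top (AdjoinRoot.of P) κ (by
    rw [hκof]
    exact Algebra.IsIntegral.isIntegral)
  have := RingHom.ker_isPrime g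
  have hgm : (RingHom.ker g).IsMaximal :=
    Ideal.isMaximal_of_isIntegral_of_isMaximal_comap' (AdjoinRoot.of P) hof _ (by
      rwa [RingHom.comap_ker, hgof])
  let _ : Algebra (AdjoinRoot P) A := κ.toAlgebra
  have : Algebra.IsIntegral (AdjoinRoot P) A := ⟨hκi⟩
  obtain ⟨M, hM, hMg⟩ := Ideal.exists_ideal_over_maximal_of_isIntegral (S := A) (RingHom.ker g) (by
    have h0 : RingHom.ker (algebraMap (AdjoinRoot P) A) = ⊥ :=
      (RingHom.injective_iff_ker_eq_bot κ).1 hκ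
    rw [h0]
    exact bot_le)
  refine ⟨M, hM, fun q hq => ?_⟩
  have h1 : AdjoinRoot.mk P q ∈ M.comap κ := by
    rw [Ideal.mem_comap, hκmk]
    exact hq
  have h2 : M.comap κ = RingHom.ker g := hMg
  rw [h2, RingHom.mem_ker, hgmk] at h1
  exact h1

lemma isIntegralElem_of_comp_unitBall {R S A : Type*} [NormedCommRing R] [NormOneClass R]
    [IsUltrametricDist R] [NormedCommRing S] [NormOneClass S] [IsUltrametricDist S] [CommRing A]
    (f : R →+* S) (hf : ∀ x, ‖f x‖ ≤ ‖x‖) (ψ : S →+* A) {u : A}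
    (h : ((ψ.comp f).comp (unitBall R).subtype).IsIntegralElem u) :
    (ψ.comp (unitBall S).subtype).IsIntegralElem u := by
  obtain ⟨q, hq, hq0⟩ := h
  let f' : unitBall R →+* unitBall S :=
    (f.comp (unitBall R).subtype).codRestrict _ fun x => (hf x).trans x.2
  refine ⟨q.map f', hq.map _, ?_⟩
  rw [eval₂_map]
  exact hq0

end MaximalLift

namespace TateAlgebra

variable {K : Type*} [NontriviallyNormedField K] [IsUltrametricDist K] [CompleteSpace K] {n : ℕ}

section MaximumModulus

/-- The minimal polynomial of `u` over the integrally closed Tate algebra has coefficients in the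
unit ball. By the maximum modulus principle this is tested at maximal ideals, where the roots of the
specialized polynomial are values of `u` and the coefficients are polynomials in these roots. -/
lemma isIntegralElem_of_injective {A : Type v} [CommRing A] [IsDomain A] [Algebra K A]
    (φ : TateAlgebra K n →ₐ[K] A) (hφ : φ.toRingHom.IsIntegral) (hinj : Function.Injective φ)
    (u : A) (h : ∀ (F : Type v) [Field F] [Algebra K F] (f : A →ₐ[K] F), Function.Surjective f →
      IsIntegral (unitBall K) (f u)) :
    (φ.toRingHom.comp (unitBall (TateAlgebra K n)).subtype).IsIntegralElem u := by
  let _ : Algebra (TateAlgebra K n) A := φ.toRingHom.toAlgebra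
  have : Algebra.IsIntegral (TateAlgebra K n) A := ⟨hφ⟩
  have := isIntegrallyClosed K n
  have hu : IsIntegral (TateAlgebra K n) u := hφ u
  set P := minpoly (TateAlgebra K n) u with hP
  have hPm : P.Monic := minpoly.monic hu
  have hc : ∀ i, ‖P.coeff i‖ ≤ 1 := fun i => by
    refine norm_le_one_of_isIntegral fun y hy => ?_
    let _ := Ideal.Quotient.field y
    let Ω := AlgebraicClosure (TateAlgebra K n ⧸ y)
    let j : (TateAlgebra K n ⧸ y) →+* Ω := algebraMap _ _
    let θ : TateAlgebra K n →+* Ω := j.comp (Ideal.Quotient.mk y)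
    let χ : unitBall K →+* TateAlgebra K n :=
      (algebraMap K (TateAlgebra K n)).comp (unitBall K).subtype
    let _ : Algebra (unitBall K) Ω := (θ.comp χ).toAlgebra
    have hθ : (RingHom.ker θ).IsMaximal := by
      rwa [RingHom.ker_comp_of_injective _ j.injective, Ideal.mk_ker]
    have hroots : ∀ x, (P.map θ).IsRoot x → IsIntegral (unitBall K) x := fun x hx => by
      rw [IsRoot, eval_map] at hx
      obtain ⟨M, hM, hMq⟩ := exists_isMaximal_of_eval₂_minpoly hinj θ hθ u x hx
      let _ := Ideal.Quotient.field M
      obtain ⟨q, hq, hq0⟩ := h (A ⧸ M) (Ideal.Quotient.mkₐ K M) (Ideal.Quotient.mkₐ_surjective K M)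
      refine ⟨q, hq, ?_⟩
      have h1 := hMq (q.map χ) (by
        rw [← Ideal.Quotient.eq_zero_iff_mem, aeval_def, hom_eval₂, eval₂_map, ← hq0]
        congr 1
        exact RingHom.ext fun r => congrArg (Ideal.Quotient.mk M) (φ.commutes r))
      rwa [eval₂_map] at h1
    have h2 := isIntegral_coeff_of_factors (R := unitBall K) (P.map θ)
      (by rw [(hPm.map θ).leadingCoeff]; exact isIntegral_one)
      (IsAlgClosed.splits _) hroots i
    obtain ⟨q, hq, hq0⟩ := h2
    refine ⟨q, hq, j.injective ?_⟩
    rw [coeff_map] at hq0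
    rw [map_zero, hom_eval₂]
    exact hq0
  have h2 : P ∈ lifts (unitBall (TateAlgebra K n)).subtype := by
    rw [lifts_iff_coeff_lifts]
    exact fun i => ⟨⟨_, hc i⟩, rfl⟩
  obtain ⟨q, hq, -, hqm⟩ := lifts_and_degree_eq_and_monic h2 hPm
  refine ⟨q, hqm, ?_⟩
  have h3 := minpoly.aeval (TateAlgebra K n) u
  rw [← hP, ← hq, aeval_def, eval₂_map] at h3
  exact h3

/-- An element with integral values at all points is integral over the unit ball. -/
theorem isIntegralElem_of_forall : ∀ {n : ℕ} {A : Type v} [CommRing A] [Algebra K A]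
    (φ : TateAlgebra K n →ₐ[K] A), φ.toRingHom.IsIntegral → ∀ u : A,
    (∀ (F : Type v) [Field F] [Algebra K F] (f : A →ₐ[K] F), Function.Surjective f →
      IsIntegral (unitBall K) (f u)) →
    (φ.toRingHom.comp (unitBall (TateAlgebra K n)).subtype).IsIntegralElem u := by
  intro n
  induction n with
  | zero =>
    intro A _ _ φ hφ u h
    refine isIntegralElem_of_forall_prime _ _ fun p hp => ?_
    refine isIntegralElem_of_injective ((Ideal.Quotient.mkₐ K p).comp φ) ?_ ?_ _ fun F _ _ f hf =>
      h F (f.comp (Ideal.Quotient.mkₐ K p)) (hf.comp (Ideal.Quotient.mkₐ_surjective K p))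
    · exact RingHom.IsIntegral.trans φ.toRingHom (Ideal.Quotient.mk p) hφ
        (RingHom.isIntegral_of_surjective _ Ideal.Quotient.mk_surjective)
    · refine (injective_iff_map_eq_zero _).2 fun x hx => ?_
      obtain ⟨c, rfl⟩ := algebraMap_zero_bijective.2 x
      rw [AlgHom.commutes] at hx
      rw [(map_eq_zero_iff _ (algebraMap K (A ⧸ p)).injective).1 hx, map_zero]
  | succ n ih =>
    intro A _ _ φ hφ u h
    refine isIntegralElem_of_forall_prime _ _ fun p hp => ?_
    let φ' := (Ideal.Quotient.mkₐ K p).comp φ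
    have hφ' : φ'.toRingHom.IsIntegral :=
      RingHom.IsIntegral.trans φ.toRingHom (Ideal.Quotient.mk p) hφ
        (RingHom.isIntegral_of_surjective _ Ideal.Quotient.mk_surjective)
    have h' : ∀ (F : Type v) [Field F] [Algebra K F] (f : A ⧸ p →ₐ[K] F), Function.Surjective f →
        IsIntegral (unitBall K) (f (Ideal.Quotient.mk p u)) := fun F _ _ f hf =>
      h F (f.comp (Ideal.Quotient.mkₐ K p)) (hf.comp (Ideal.Quotient.mkₐ_surjective K p))
    -- If not injective, `φ'` is replaced by an integral map from fewer variables; `τ` preserves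
    -- unit balls, so integrality over the smaller one suffices.
    by_cases hinj : Function.Injective φ'
    · exact isIntegralElem_of_injective φ' hφ' hinj _ h'
    · rw [injective_iff_map_eq_zero] at hinj
      push Not at hinj
      obtain ⟨f, hf, hf0⟩ := hinj
      obtain ⟨τ, hτ, hτi⟩ := exists_isIntegral_comp φ' hφ' hf0 hf
      exact isIntegralElem_of_comp_unitBall τ.toRingHom hτ φ'.toRingHom (ih (φ'.comp τ) hτi _ h')

end MaximumModulus

end TateAlgebra

end AffinoidTorus

namespace AffinoidTorus

open Filter Topology Polynomial

universe u v

/-! ### Affinoid algebras: boundedness, and a density criterion -/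

section PowerBounded

/-- Powers of an element which is integral over the image of the unit ball are bounded. -/
lemma exists_norm_pow_le_of_isIntegralElem {R A : Type*} [NormedCommRing R] [NormOneClass R]
    [IsUltrametricDist R] [NormedCommRing A] (ψ : R →+* A) {C : ℝ} (hψ : ∀ x, ‖ψ x‖ ≤ C * ‖x‖)
    {a : A} (h : (ψ.comp (unitBall R).subtype).IsIntegralElem a) : ∃ M, ∀ k : ℕ, ‖a ^ k‖ ≤ M := by
  obtain ⟨q, hq, hq0⟩ := h
  set χ := ψ.comp (unitBall R).subtype with hχ
  have hb : ∀ r, ‖χ r‖ ≤ |C| := fun r => by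
    refine (hψ _).trans ((mul_le_mul_of_nonneg_right (le_abs_self C) (norm_nonneg _)).trans ?_)
    exact mul_le_of_le_one_right (abs_nonneg C) r.2
  -- All powers of `a` are values of remainders modulo `q`, hence combinations, with coefficients
  -- bounded by `|C|`, of finitely many powers of `a`.
  refine ⟨∑ i ∈ Finset.range (q.natDegree + 1), |C| * ‖a ^ i‖, fun k => ?_⟩
  have h1 : a ^ k = eval₂ χ a (Polynomial.X ^ k %ₘ q) := by
    have h2 := congrArg (eval₂ χ a) (modByMonic_add_div (Polynomial.X ^ k) q)
    rw [eval₂_add, eval₂_mul, hq0, zero_mul, add_zero, eval₂_X_pow] at h2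
    exact h2.symm
  have h3 : (Polynomial.X ^ k %ₘ q).natDegree < q.natDegree + 1 :=
    Nat.lt_succ_of_le (natDegree_modByMonic_le _ hq)
  rw [h1, eval₂_eq_sum_range' _ h3]
  refine norm_sum_le_of_le _ fun i _ => (norm_mul_le _ _).trans ?_
  exact mul_le_mul_of_nonneg_right (hb _) (norm_nonneg _)

end PowerBounded

section Affinoid

variable {K : Type u} [NontriviallyNormedField K] [IsUltrametricDist K] [CompleteSpace K]
  {A : Type v} [NormedCommRing A] [NormedAlgebra K A]

namespace IsAffinoid

-- The norm of `A` need not be ultrametric, but it is equivalent to a residue norm; lifting the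
-- summands to the Tate algebra gives the ultrametric bound up to a constant.
omit [CompleteSpace K] in
lemma exists_norm_sum_le (hA : IsAffinoid K A) : ∃ C, 0 ≤ C ∧ ∀ {ι : Type*} (s : Finset ι)
    (a : ι → A) (M : ℝ), 0 ≤ M → (∀ i ∈ s, ‖a i‖ ≤ M) → ‖∑ i ∈ s, a i‖ ≤ C * M := by
  obtain ⟨n, φ, C, hC, hφ⟩ := hA
  refine ⟨|C| * |C|, by positivity, fun s a M hM h => ?_⟩
  choose f hf hfC using hφ
  have h1 : ∑ i ∈ s, a i = φ (∑ i ∈ s, f (a i)) := by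
    rw [map_sum]
    exact Finset.sum_congr rfl fun i _ => (hf _).symm
  have h2 : ‖∑ i ∈ s, f (a i)‖ ≤ |C| * M :=
    IsUltrametricDist.norm_sum_le_of_forall_le_of_nonneg (by positivity) fun i hi =>
      (hfC _).trans (mul_le_mul (le_abs_self C) (h i hi) (norm_nonneg _) (abs_nonneg C))
  rw [h1, mul_assoc]
  refine (hC _).trans ?_
  exact mul_le_mul (le_abs_self C) h2 (norm_nonneg (∑ i ∈ s, f (a i))) (abs_nonneg C)

/-- An absolutely convergent series lifts, with control of norms, to the complete Tate algebra. -/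
lemma completeSpace (hA : IsAffinoid K A) : CompleteSpace A := by
  obtain ⟨n, φ, C, hC, hφ⟩ := hA
  refine NormedAddCommGroup.completeSpace_of_summable_imp_tendsto fun a ha => ?_
  choose f hf hfC using hφ
  have hs : Summable fun i => f (a i) :=
    Summable.of_norm_bounded (ha.mul_left |C|) fun i =>
      (hfC _).trans (mul_le_mul_of_nonneg_right (le_abs_self C) (norm_nonneg _))
  have hφc : Continuous φ := AddMonoidHomClass.continuous_of_bound φ C hC
  refine ⟨φ (∑' i, f (a i)), ?_⟩
  have h1 := (hφc.tendsto _).comp hs.hasSum.tendsto_sum_nat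
  refine h1.congr fun k => ?_
  simp only [Function.comp_apply, map_sum, hf]

lemma exists_norm_pow_le (hA : IsAffinoid K A) {a : A}
    (h : ∀ (F : Type v) [Field F] [Algebra K F] (f : A →ₐ[K] F), Function.Surjective f →
      IsIntegral (unitBall K) (f a)) : ∃ M, ∀ k : ℕ, ‖a ^ k‖ ≤ M := by
  obtain ⟨n, φ, C, hC, hφ⟩ := hA
  have hsurj : Function.Surjective φ := fun a => (hφ a).imp fun f hf => hf.1
  exact exists_norm_pow_le_of_isIntegralElem φ.toRingHom hC
    (TateAlgebra.isIntegralElem_of_forall φ (RingHom.isIntegral_of_surjective _ hsurj) a h)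

/-- The Nullstellensatz for affinoid algebras. -/
lemma isAlgebraic (hA : IsAffinoid K A) {F : Type*} [Field F] [Algebra K F] (f : A →ₐ[K] F)
    (hf : Function.Surjective f) : Algebra.IsAlgebraic K F := by
  obtain ⟨n, φ, C, hC, hφ⟩ := hA
  have hsurj : Function.Surjective φ := fun a => (hφ a).imp fun f hf => hf.1
  exact TateAlgebra.isAlgebraic_of_isIntegral (f.comp φ)
    (RingHom.isIntegral_of_surjective _ (hf.comp hsurj))

end IsAffinoid

variable [CompleteSpace A] [IsUltrametricDist A] [NormOneClass A]

omit [CompleteSpace K] in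
lemma exists_eval_eq_of_mem_adjoin {n : ℕ} (b : Fin n → A) (hb : ∀ i, ‖b i‖ ≤ 1) {x : A}
    (hx : x ∈ Algebra.adjoin (unitBall K) (Set.range b)) :
    ∃ f : TateAlgebra K n, TateAlgebra.eval b hb f = x ∧ ‖f‖ ≤ 1 := by
  induction hx using Algebra.adjoin_induction with
  | mem x hx =>
    obtain ⟨i, rfl⟩ := hx
    exact ⟨TateAlgebra.X i, TateAlgebra.eval_X b hb i, (TateAlgebra.norm_X i).le⟩
  | algebraMap r =>
    refine ⟨algebraMap K _ r, (TateAlgebra.eval b hb).commutes (r : K), ?_⟩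
    rw [norm_algebraMap']
    exact r.2
  | add x y _ _ hx hy =>
    obtain ⟨f, rfl, hf⟩ := hx
    obtain ⟨g, rfl, hg⟩ := hy
    exact ⟨f + g, map_add _ _ _, (IsUltrametricDist.norm_add_le_max _ _).trans (max_le hf hg)⟩
  | mul x y _ _ hx hy =>
    obtain ⟨f, rfl, hf⟩ := hx
    obtain ⟨g, rfl, hg⟩ := hy
    exact ⟨f * g, map_mul _ _ _, (norm_mul_le _ _).trans (mul_le_one₀ hf (norm_nonneg _) hg)⟩

/-- A criterion for a Banach algebra to be affinoid, in terms of a finite set `s` of topological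
generators. -/
theorem isAffinoid_of_dense {s : Set A} (hs : s.Finite) (hs1 : ∀ x ∈ s, ‖x‖ ≤ 1)
    {D : AddSubgroup A} (hD : Dense (D : Set A)) {C : ℝ} {Λ : Type*}
    (h : ∀ a ∈ D, ∃ (I : Finset Λ) (c : Λ → K) (g : Λ → A), a = ∑ l ∈ I, c l • g l ∧
      ∀ l ∈ I, ‖c l‖ ≤ C * ‖a‖ ∧ g l ∈ Algebra.adjoin (unitBall K) s) : IsAffinoid K A := by
  obtain ⟨n, b, rfl⟩ := hs.fin_embedding.imp fun n h => h.imp fun b hb => hb.symm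
  have hb : ∀ i, ‖b i‖ ≤ 1 := fun i => hs1 _ ⟨i, rfl⟩
  let φ := TateAlgebra.eval (K := K) (b : Fin n → A) hb
  let φ' : NormedAddGroupHom (TateAlgebra K n) A :=
    { toFun := φ
      map_add' := map_add φ
      bound' := ⟨1, fun f => by rw [one_mul]; exact TateAlgebra.norm_eval_le _ hb f⟩ }
  have h1 : φ'.SurjectiveOnWith D (|C| + 1) := by
    intro a ha
    obtain ⟨I, c, g, hac, hI⟩ := h a ha
    choose! f hf hf1 using fun l (hl : l ∈ I) => exists_eval_eq_of_mem_adjoin (b : Fin n → A) hb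
      (hI l hl).2
    refine ⟨∑ l ∈ I, c l • f l, ?_, ?_⟩
    · change φ _ = a
      rw [map_sum, hac]
      refine Finset.sum_congr rfl fun l hl => ?_
      rw [map_smul, hf l hl]
    · refine IsUltrametricDist.norm_sum_le_of_forall_le_of_nonneg (by positivity) fun l hl => ?_
      rw [norm_smul]
      have h2 : ‖c l‖ ≤ (|C| + 1) * ‖a‖ := (hI l hl).1.trans (by
        gcongr
        exact (le_abs_self C).trans (by linarith))
      exact (mul_le_of_le_one_right (norm_nonneg _) (hf1 l hl)).trans h2
  -- Successive approximation extends controlled surjectivity from the dense subgroup to all of `A`,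
  -- adding 1 to the constant; `|C| + 1` ensures that the constant is positive.
  have h2 := controlled_closure_of_complete (by positivity) one_pos h1
  refine ⟨n, φ, |C| + 1 + 1, fun f => ?_, fun a => ?_⟩
  · refine (TateAlgebra.norm_eval_le _ hb f).trans ?_
    exact le_mul_of_one_le_left (norm_nonneg f) (by have := abs_nonneg C; linarith)
  · obtain ⟨f, hf, hfa⟩ := h2 a (hD a)
    exact ⟨f, hf, hfa⟩

end Affinoid

/-! ### Noether's finiteness argument with control by a subring -/

section Trace

open MulSemiringAction in
/-- Noether's finiteness theorem for invariants, for the elements which are traces. -/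
lemma exists_finite_trace_mem_adjoin {k B G : Type*} [CommRing k] [CommRing B] [Nontrivial B]
    [Algebra k B]     [Group G] [Fintype G] [MulSemiringAction G B] [SMulCommClass G k B] (O : Subring B)
    (hO : ∀ (g : G), ∀ x ∈ O, g • x ∈ O) (hk : ∀ r, algebraMap k B r ∈ O) {s : Set B}
    (hs : s.Finite) (hsO : s ⊆ O) :
    ∃ t : Set B, t.Finite ∧ t ⊆ O ∧ (∀ x ∈ t, ∀ g : G, g • x = x) ∧
      ∀ x ∈ Algebra.adjoin k s, ∑ g : G, g • x ∈ Algebra.adjoin k t := by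
  have hinv : ∀ t : Set B, (∀ x ∈ t, ∀ g : G, g • x = x) → ∀ x ∈ Algebra.adjoin k t, ∀ g : G,
      g • x = x := fun t ht x hx g => by
    induction hx using Algebra.adjoin_induction with
    | mem x hx => exact ht x hx g
    | algebraMap r => exact smul_algebraMap g r
    | add x y _ _ hx hy => rw [smul_add, hx, hy]
    | mul x y _ _ hx hy => rw [smul_mul', hx, hy]
  have hadj : ∀ t : Set B, t ⊆ O → ∀ x ∈ Algebra.adjoin k t, x ∈ O := fun t ht x hx => by
    induction hx using Algebra.adjoin_induction with
    | mem x hx => exact ht hx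
    | algebraMap r => exact hk r
    | add x y _ _ hx hy => exact O.add_mem hx hy
    | mul x y _ _ hx hy => exact O.mul_mem hx hy
  let t₀ : Set B := ⋃ b ∈ s, ((charpoly G b).coeffs : Set B)
  have ht₀f : t₀.Finite := hs.biUnion fun b _ => Finset.finite_toSet _
  have hcO : ∀ b ∈ s, ∀ i, (charpoly G b).coeff i ∈ O := fun b hb i => by
    have h1 : charpoly G b ∈ lifts O.subtype := by
      rw [charpoly_eq]
      refine Subsemiring.prod_mem _ fun g _ => ⟨Polynomial.X - C ⟨g • b, hO g b (hsO hb)⟩, ?_⟩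
      simp
    obtain ⟨x, hx⟩ := (lifts_iff_coeff_lifts _).1 h1 i
    rw [← hx]
    exact x.2
  have ht₀O : t₀ ⊆ O := by
    simp only [t₀, Set.iUnion_subset_iff]
    intro b hb x hx
    obtain ⟨i, -, rfl⟩ := mem_coeffs_iff.1 hx
    exact hcO b hb i
  have ht₀i : ∀ x ∈ t₀, ∀ g : G, g • x = x := by
    simp only [t₀, Set.mem_iUnion]
    rintro x ⟨b, hb, hx⟩ g
    obtain ⟨i, -, rfl⟩ := mem_coeffs_iff.1 hx
    exact smul_coeff_charpoly b i g
  let R₀ := Algebra.adjoin k t₀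
  have hint : ∀ b ∈ s, IsIntegral R₀ b := fun b hb => by
    have h1 : charpoly G b ∈ lifts (algebraMap R₀ B) := by
      rw [lifts_iff_coeff_lifts]
      intro i
      by_cases h0 : (charpoly G b).coeff i = 0
      · exact ⟨0, by rw [h0, map_zero]⟩
      · exact ⟨⟨_, Algebra.subset_adjoin (Set.mem_biUnion hb (coeff_mem_coeffs h0))⟩, rfl⟩
    obtain ⟨p, hp, -, hpm⟩ := lifts_and_degree_eq_and_monic h1 (monic_charpoly G b)
    refine ⟨p, hpm, ?_⟩
    rw [← eval_map, hp, eval_charpoly]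
  -- Each element of `s` is a root of its characteristic polynomial over `R₀`, so the algebra
  -- generated by `s` is a finite `R₀`-module. `R₀` is invariant, so the trace is `R₀`-linear and
  -- only the traces of the module generators must be added.
  obtain ⟨m, hm⟩ := fg_adjoin_of_finite hs hint
  have hmO : ∀ x ∈ m, x ∈ O := fun x hx => by
    have h1 : x ∈ Subalgebra.toSubmodule (Algebra.adjoin R₀ s) := by
      rw [← hm]
      exact Submodule.subset_span hx
    rw [Subalgebra.mem_toSubmodule] at h1
    clear hx
    induction h1 using Algebra.adjoin_induction with
    | mem x hx => exact hsO hx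
    | algebraMap r => exact hadj _ ht₀O _ r.2
    | add x y _ _ hx hy => exact O.add_mem hx hy
    | mul x y _ _ hx hy => exact O.mul_mem hx hy
  refine ⟨t₀ ∪ (fun x => ∑ g : G, g • x) '' m, ht₀f.union (m.finite_toSet.image _), ?_, ?_, ?_⟩
  · rintro x (hx | ⟨y, hy, rfl⟩)
    · exact ht₀O hx
    · exact O.sum_mem fun g _ => hO g y (hmO y hy)
  · rintro x (hx | ⟨y, hy, rfl⟩) g
    · exact ht₀i x hx g
    · simp only [Finset.smul_sum, smul_smul]
      exact Fintype.sum_equiv (Equiv.mulLeft g) _ _ fun h => rfl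
  · intro x hx
    have h1 : x ∈ Submodule.span R₀ (m : Set B) := by
      rw [hm, Subalgebra.mem_toSubmodule]
      induction hx using Algebra.adjoin_induction with
      | mem x hx => exact Algebra.subset_adjoin hx
      | algebraMap r => exact Subalgebra.algebraMap_mem _ (algebraMap k R₀ r)
      | add x y _ _ hx hy => exact add_mem hx hy
      | mul x y _ _ hx hy => exact mul_mem hx hy
    clear hx
    induction h1 using Submodule.span_induction with
    | mem x hx => exact Algebra.subset_adjoin (Or.inr ⟨x, hx, rfl⟩)
    | zero => simp
    | add x y _ _ hx hy =>
      simp only [smul_add, Finset.sum_add_distrib]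
      exact add_mem hx hy
    | smul r x _ hx =>
      have hr : ∀ g : G, g • (r • x) = (r : B) * g • x := fun g => by
        rw [Subalgebra.smul_def, smul_eq_mul, smul_mul', hinv t₀ ht₀i r r.2]
      simp only [hr, ← Finset.mul_sum]
      exact mul_mem (Algebra.adjoin_mono Set.subset_union_left r.2) hx

end Trace

end AffinoidTorus

namespace AffinoidTorus

open Filter Topology Polynomial

/-! ### Gordan's lemma and finiteness of the Weyl group -/

section Gordan

/-- **Gordan's lemma**: a rational polyhedral cone in a lattice is finitely generated. -/
lemma addSubmonoid_fg_of_nonpos {Λ ι : Type*} [AddCommGroup Λ] [Module.Finite ℤ Λ] [Finite ι]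
    (f : ι → Λ →+ ℤ) (S : AddSubmonoid Λ) (hS : ∀ l, l ∈ S ↔ ∀ i, f i l ≤ 0) : S.FG := by
  have : AddMonoid.FG Λ := AddGroup.fg_iff_addMonoid_fg.1 (Module.Finite.iff_addGroup_fg.1 ‹_›)
  obtain ⟨s, hs⟩ := this.fg_top
  let π : (s →₀ ℕ) →+ Λ := Finsupp.liftAddHom fun a => multiplesHom Λ (a : Λ)
  have hπ : Function.Surjective π := by
    rw [← AddMonoidHom.mrange_eq_top, ← top_le_iff, ← hs, AddSubmonoid.closure_le]
    intro a ha
    exact ⟨Finsupp.single ⟨a, ha⟩ 1, by simp [π]⟩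
  -- Slack variables turn the inequalities into equations `f i = -y i`, so the cone is the image of
  -- the equalizer of two homomorphisms on a free commutative monoid of finite rank.
  let M := (s →₀ ℕ) × (ι →₀ ℕ)
  let F : M →+ (ι → ℤ) :=
    (AddMonoidHom.pi fun i => f i).comp (π.comp (AddMonoidHom.fst _ _))
  let G : M →+ (ι → ℤ) :=
    { toFun := fun x i => -(x.2 i : ℤ)
      map_zero' := by ext; simp
      map_add' := fun x y => by
        ext i
        have h : (x + y).2 i = x.2 i + y.2 i := rfl
        simp only [h, Nat.cast_add, Pi.add_apply]
        ring }
  have h1 := AddSubmonoid.fg_eqLocusM F G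
  have h2 : (F.eqLocusM G).map (π.comp (AddMonoidHom.fst _ _)) = S := by
    ext l
    rw [AddSubmonoid.mem_map, hS]
    constructor
    · rintro ⟨x, hx, rfl⟩ i
      have h3 : F x i = G x i := congrFun hx i
      have h4 : F x i = f i (π x.1) := rfl
      have h5 : G x i = -(x.2 i : ℤ) := rfl
      change f i (π x.1) ≤ 0
      omega
    · intro h
      obtain ⟨y, rfl⟩ := hπ l
      refine ⟨(y, Finsupp.equivFunOnFinite.symm fun i => (-f i (π y)).toNat), ?_, rfl⟩
      ext i
      have h4 := h i
      change f i (π y) = -((-f i (π y)).toNat : ℤ)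
      omega
  rw [← h2]
  exact h1.map _

end Gordan

section Weyl

variable {ι X Λ : Type*} [AddCommGroup X] [AddCommGroup Λ] (P : RootDatum ι X Λ)

/-- A reflection moves an element by a multiple of a coroot, and the differences telescope along a
product. -/
lemma weylAct_sub_mem_corootSpan (w : P.weylGroup) (l : Λ) :
    weylAct P w l - l ∈ P.corootSpan ℤ := by
  obtain ⟨w, hw⟩ := w
  induction hw using RootPairing.weylGroup.induction generalizing l with
  | mem i =>
    have h : weylAct P (RootPairing.weylGroup.ofIdx P i) l = P.coreflection i l := by
      have hinv : (RootPairing.weylGroup.ofIdx P i)⁻¹ = RootPairing.weylGroup.ofIdx P i :=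
        Subtype.ext (RootPairing.Equiv.reflection_inv P i)
      rw [weylAct, hinv]
      rfl
    have h1 := P.coreflection_apply i l
    change weylAct P (RootPairing.weylGroup.ofIdx P i) l - l ∈ _
    rw [h, h1, sub_sub_cancel_left]
    exact neg_mem (Submodule.smul_mem _ _ (Submodule.subset_span ⟨i, rfl⟩))
  | one =>
    have h : weylAct P 1 l = l := weylAct_one P l
    change weylAct P 1 l - l ∈ _
    rw [h, sub_self]
    exact zero_mem _
  | mul x y hx hy h1 h2 =>
    have h := weylAct_mul P ⟨x, hx⟩ ⟨y, hy⟩ l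
    change weylAct P (⟨x, hx⟩ * ⟨y, hy⟩) l - l ∈ _
    rw [h, ← sub_add_sub_cancel _ (weylAct P ⟨y, hy⟩ l)]
    exact add_mem (h1 _) (h2 _)

variable [Finite ι]

/-- If `w` fixes all roots, the displacement of `l` under `w⁻¹` is killed by every root, hence lies
in the kernel of the coroot form; it also lies in the coroot span, which meets this kernel
trivially. -/
lemma weylGroupToPerm_injective : Function.Injective P.weylGroupToPerm := by
  have := Fintype.ofFinite ι
  refine (injective_iff_map_eq_one _).2 fun w hw => ?_
  have h1 : ∀ l, weylAct P w⁻¹ l = l := fun l => by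
    rw [← sub_eq_zero]
    have h2 := weylAct_sub_mem_corootSpan P w⁻¹ l
    refine Submodule.disjoint_def.1 P.disjoint_corootSpan_ker_corootForm _ h2 ?_
    have h3 : ∀ i, P.toLinearMap (P.root i) (weylAct P w⁻¹ l - l) = 0 := fun i => by
      rw [map_sub, root_weylAct, inv_inv, hw, sub_eq_zero]
      rfl
    rw [LinearMap.mem_ker]
    ext y
    rw [RootPairing.corootForm_apply_apply]
    simp only [LinearMap.zero_apply]
    refine Finset.sum_eq_zero fun i _ => ?_
    have h4 : P.root' i (weylAct P w⁻¹ l - l) = 0 := h3 i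
    rw [h4, zero_mul]
  refine Subtype.ext (RootPairing.Equiv.coweightHom_injective P
    (MulOpposite.unop_injective (LinearEquiv.ext fun l => ?_)))
  have h2 := h1 l
  rw [weylAct, inv_inv] at h2
  exact h2

instance finite_weylGroup : Finite P.weylGroup :=
  Finite.of_injective _ (weylGroupToPerm_injective P)

end Weyl

namespace WeylCocycle

variable {ι X Λ : Type*} [AddCommGroup X] [AddCommGroup Λ] {P : RootDatum ι X Λ} {b : P.Base}
  [Finite ι] [P.IsReduced]

/-! ### Finite generation of the unit ball of the group ring -/

section Generators

variable {K : Type*} [NormedField K] [IsUltrametricDist K] (γ : WeylCocycle b K)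

instance : IsUltrametricDist γ.GroupRing :=
  IsUltrametricDist.isUltrametricDist_of_isNonarchimedean_norm fun f g =>
    γ.gnorm_le _ _ fun l => by
      rw [coeff_add, Finsupp.add_apply, ← norm_mul, mul_add]
      refine (IsUltrametricDist.norm_add_le_max _ _).trans (max_le_max ?_ ?_) <;>
        rw [norm_mul] <;> exact γ.le_gnorm _ l

lemma norm_single (l : Λ) (c : K) :
    ‖γ.toGroupRing (AddMonoidAlgebra.single l c)‖ = ‖(γ.dom l : K)‖ * ‖c‖ := by
  classical
  have hc : ∀ m, γ.coeff (γ.toGroupRing (AddMonoidAlgebra.single l c)) m =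
      if l = m then c else 0 := fun m => Finsupp.single_apply
  refine le_antisymm (γ.gnorm_le _ _ fun m => ?_) ?_
  · rw [hc]
    split_ifs with h
    · rw [h]
    · rw [norm_zero, mul_zero]
      positivity
  · refine le_trans (le_of_eq ?_) (γ.le_gnorm _ l)
    rw [hc, if_pos rfl]

instance : NormOneClass γ.GroupRing where
  norm_one := by
    have h : (1 : γ.GroupRing) = γ.toGroupRing (AddMonoidAlgebra.single 0 1) := rfl
    rw [h, norm_single, norm_dom_zero, norm_one, one_mul]

instance : IsUltrametricDist γ.BanachAlgebra :=
  IsUltrametricDist.isUltrametricDist_of_isNonarchimedean_norm fun x y => by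
    induction x, y using UniformSpace.Completion.induction_on₂ with
    | hp => exact isClosed_le (by fun_prop) (by fun_prop)
    | ih x y =>
      rw [← UniformSpace.Completion.coe_add]
      simp only [UniformSpace.Completion.norm_coe]
      exact IsUltrametricDist.norm_add_le_max x y

instance : NormOneClass γ.BanachAlgebra where
  norm_one := by
    rw [← UniformSpace.Completion.coe_one, UniformSpace.Completion.norm_coe, norm_one]

/-- The normalized element `γ^dom(λ)⁻¹ λ` of norm `1`. -/
def gen (l : Λ) : γ.GroupRing := γ.toGroupRing (AddMonoidAlgebra.single l ((γ.dom l)⁻¹ : Kˣ).val)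

lemma norm_gen (l : Λ) : ‖γ.gen l‖ = 1 := by
  rw [gen, norm_single, ← norm_mul, Units.mul_inv, norm_one]

/-- The coefficients are exactly the quantities whose absolute values have supremum `‖f‖`, so the
`gen l` behave as an orthonormal basis. -/
lemma eq_sum_gen (f : γ.GroupRing) :
    f = ∑ l ∈ (γ.coeff f).support, (γ.dom l * γ.coeff f l : K) • γ.gen l := by
  have h : ∀ l, (γ.dom l * γ.coeff f l : K) • γ.gen l =
      γ.toGroupRing (AddMonoidAlgebra.single l (γ.coeff f l)) := fun l => by
    rw [gen, ← map_smul, AddMonoidAlgebra.smul_single, smul_eq_mul, mul_comm (γ.dom l : K),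
      mul_assoc, Units.mul_inv, mul_one]
  simp only [h]
  rw [← map_sum]
  apply γ.toGroupRing.symm.injective
  rw [AlgEquiv.symm_apply_apply]
  exact (AddMonoidAlgebra.sum_coeff_single _).symm

/-- The cone of the elements which are moved to antidominant elements by `w`. -/
def cone (b : P.Base) (w : P.weylGroup) : AddSubmonoid Λ where
  carrier := {l | Antidominant b (weylAct P w l)}
  zero_mem' i _ := by rw [map_zero, map_zero]
  add_mem' {l m} hl hm i hi := by
    rw [map_add, map_add]
    exact add_nonpos (hl i hi) (hm i hi)

omit [P.IsReduced] in
lemma cone_fg [Module.Finite ℤ Λ] (b : P.Base) (w : P.weylGroup) : (cone b w).FG :=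
  addSubmonoid_fg_of_nonpos (ι := {i // b.IsPos i})
    (fun i => (P.toLinearMap (P.root i)).toAddMonoidHom.comp (weylAct P w)) _
    fun _ => ⟨fun h i => h i i.2, fun h i hi => h ⟨i, hi⟩⟩

-- On one cone the same `w` computes `γ.dom` for `l`, `m` and `l + m`, so submultiplicativity
-- becomes an equality.
omit [IsUltrametricDist K] in
lemma norm_dom_add {w : P.weylGroup} {l m : Λ} (hl : l ∈ cone b w) (hm : m ∈ cone b w) :
    ‖(γ.dom (l + m) : K)‖ = ‖(γ.dom l : K)‖ * ‖(γ.dom m : K)‖ := by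
  rw [γ.norm_dom_eq w l hl, γ.norm_dom_eq w m hm, γ.norm_dom_eq w _ ((cone b w).add_mem hl hm),
    γ.mul, Units.val_mul, norm_mul]

/-- The unit ball of `K[Λ]` is generated by finitely many of the elements `γ^dom(λ)⁻¹ λ`. -/
lemma exists_finset_gen_mem_adjoin [Module.Finite ℤ Λ] :
    ∃ F : Finset Λ, ∀ l, γ.gen l ∈ Algebra.adjoin (unitBall K) (γ.gen '' F) := by
  classical
  have := Fintype.ofFinite P.weylGroup
  choose S hS using fun w => cone_fg b w
  refine ⟨Finset.univ.biUnion S, fun l => ?_⟩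
  obtain ⟨w, hw⟩ := exists_antidominant b l
  have hl : l ∈ AddSubmonoid.closure (S w : Set Λ) := by rw [hS]; exact hw
  clear hw
  induction hl using AddSubmonoid.closure_induction with
  | mem l hl =>
    exact Algebra.subset_adjoin ⟨l, Finset.mem_coe.2 (Finset.mem_biUnion.2 ⟨w, by simp, hl⟩), rfl⟩
  | zero =>
    have h : γ.gen 0 = algebraMap K γ.GroupRing ((γ.dom (0 : Λ))⁻¹ : Kˣ).val := rfl
    have h1 : ((γ.dom (0 : Λ))⁻¹ : Kˣ).val ∈ unitBall K := by
      rw [mem_unitBall, Units.val_inv_eq_inv_val, norm_inv, norm_dom_zero, inv_one]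
    rw [h]
    exact Subalgebra.algebraMap_mem _ (⟨_, h1⟩ : unitBall K)
  | add l m hl hm ihl ihm =>
    rw [hS] at hl hm
    -- `gen (l + m)` and `gen l * gen m` differ by this scalar, which has absolute value 1 because
    -- `l` and `m` lie in a common cone.
    let c : Kˣ := γ.dom l * γ.dom m * (γ.dom (l + m))⁻¹
    have hc : (c : K) ∈ unitBall K := by
      rw [mem_unitBall, Units.val_mul, Units.val_mul, Units.val_inv_eq_inv_val, norm_mul, norm_mul,
        norm_inv, ← γ.norm_dom_add hl hm, mul_inv_cancel₀ (γ.norm_dom_pos _).ne']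
    have h : γ.gen (l + m) = (⟨c, hc⟩ : unitBall K) • (γ.gen l * γ.gen m) := by
      change _ = (c : K) • (γ.gen l * γ.gen m)
      rw [gen, gen, gen, ← map_mul, AddMonoidAlgebra.single_mul_single, ← map_smul,
        AddMonoidAlgebra.smul_single, smul_eq_mul, ← Units.val_mul, ← Units.val_mul]
      congr 3
      change (γ.dom (l + m))⁻¹ = γ.dom l * γ.dom m * (γ.dom (l + m))⁻¹ *
        ((γ.dom l)⁻¹ * (γ.dom m)⁻¹)
      rw [mul_right_comm, ← mul_inv, mul_inv_cancel, one_mul]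
    rw [h]
    exact Subalgebra.smul_mem _ (mul_mem ihl ihm) _

end Generators

end WeylCocycle

end AffinoidTorus

namespace AffinoidTorus

open Filter Topology Polynomial

namespace WeylCocycle

variable {ι X Λ : Type*} [AddCommGroup X] [AddCommGroup Λ] {P : RootDatum ι X Λ} {b : P.Base}
  [Finite ι] [P.IsReduced]

/-! ### The twisted action on the completion, and the trace -/

section Action

variable {K : Type*} [NormedField K] [IsUltrametricDist K] (γ : WeylCocycle b K)

/-- The inclusion of the group ring in its completion. -/
def toCompl : γ.GroupRing →ₐ[K] γ.BanachAlgebra := γ.incl.comp γ.toGroupRing.symm.toAlgHom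

lemma toCompl_apply (f : γ.GroupRing) : γ.toCompl f = (f : γ.BanachAlgebra) := rfl

lemma norm_toCompl (f : γ.GroupRing) : ‖γ.toCompl f‖ = ‖f‖ := UniformSpace.Completion.norm_coe f

lemma denseRange_toCompl : DenseRange γ.toCompl := UniformSpace.Completion.denseRange_coe

lemma continuous_twistCompl (w : P.weylGroup) : Continuous (γ.twistCompl w) :=
  UniformSpace.Completion.continuous_map

lemma twist_one (f : γ.GroupRing) : γ.twist 1 f = f := by
  refine γ.toGroupRing.symm.injective (AddMonoidAlgebra.coeff_injective (Finsupp.ext fun l => ?_))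
  have h := γ.coeff_twist 1 f l
  rwa [weylAct_one, γ.eq_one 1 l (weylAct_one P l), Units.val_one, one_mul] at h

/-- Comparing coefficients, this is the cocycle identity for `γ`. -/
lemma twist_mul (v w : P.weylGroup) (f : γ.GroupRing) :
    γ.twist (v * w) f = γ.twist v (γ.twist w f) := by
  refine γ.toGroupRing.symm.injective (AddMonoidAlgebra.coeff_injective (Finsupp.ext fun m => ?_))
  obtain ⟨l, rfl⟩ : ∃ l, weylAct P (v * w) l = m :=
    ⟨weylAct P (v * w)⁻¹ m, by rw [← weylAct_mul, mul_inv_cancel, weylAct_one]⟩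
  have h1 := γ.coeff_twist (v * w) f l
  have h2 := γ.coeff_twist v (γ.twist w f) (weylAct P w l)
  rw [← weylAct_mul, coeff_twist, ← mul_assoc, ← Units.val_mul, ← γ.cocycle] at h2
  exact h1.trans h2.symm

/-- The twisted action of the Weyl group on `K⟨Λ; γ⟩`. -/
instance : MulSemiringAction P.weylGroup γ.BanachAlgebra where
  smul w x := γ.twistCompl w x
  one_smul x := by
    refine UniformSpace.Completion.induction_on x
      (isClosed_eq (γ.continuous_twistCompl 1) continuous_id) fun f => ?_
    exact (γ.twistCompl_coe 1 f).trans (congrArg _ (γ.twist_one f))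
  mul_smul v w x := by
    refine UniformSpace.Completion.induction_on x
      (isClosed_eq (γ.continuous_twistCompl _)
        ((γ.continuous_twistCompl v).comp (γ.continuous_twistCompl w))) fun f => ?_
    refine (γ.twistCompl_coe _ f).trans ?_
    rw [twist_mul, ← twistCompl_coe, ← twistCompl_coe]
    rfl
  smul_zero w := map_zero (γ.twistCompl w)
  smul_add w := map_add (γ.twistCompl w)
  smul_one w := map_one (γ.twistCompl w)
  smul_mul w := map_mul (γ.twistCompl w)

lemma smul_toCompl (w : P.weylGroup) (f : γ.GroupRing) :
    w • γ.toCompl f = γ.toCompl (γ.twist w f) := γ.twistCompl_coe w f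

lemma norm_smul_le_norm (w : P.weylGroup) (x : γ.BanachAlgebra) : ‖w • x‖ ≤ ‖x‖ := by
  refine UniformSpace.Completion.induction_on x
    (isClosed_le (γ.continuous_twistCompl w).norm continuous_norm) fun f => ?_
  rw [← toCompl_apply, smul_toCompl, norm_toCompl, norm_toCompl]
  exact γ.norm_twist_le w f

instance : SMulCommClass P.weylGroup K γ.BanachAlgebra where
  smul_comm w r x := by
    have h : w • algebraMap K γ.BanachAlgebra r = algebraMap K γ.BanachAlgebra r :=
      γ.invariants.algebraMap_mem r w
    rw [Algebra.smul_def, smul_mul', h, Algebra.smul_def]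

instance : SMulCommClass P.weylGroup (unitBall K) γ.BanachAlgebra where
  smul_comm w r x := smul_comm w (r : K) x

lemma toCompl_gen_mem_adjoin {F : Set Λ} {l : Λ}
    (h : γ.gen l ∈ Algebra.adjoin (unitBall K) (γ.gen '' F)) :
    γ.toCompl (γ.gen l) ∈ Algebra.adjoin (unitBall K) ((fun l => γ.toCompl (γ.gen l)) '' F) := by
  have h1 := AlgHom.map_adjoin (γ.toCompl.restrictScalars (unitBall K)) (γ.gen '' F)
  rw [← Set.image_comp] at h1
  have h2 : γ.toCompl (γ.gen l) ∈ (Algebra.adjoin (unitBall K) (γ.gen '' F)).map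
      (γ.toCompl.restrictScalars (unitBall K)) := ⟨_, h, rfl⟩
  rw [h1] at h2
  exact h2

lemma mem_invariants {x : γ.BanachAlgebra} :
    x ∈ γ.invariants ↔ ∀ w : P.weylGroup, w • x = x := Iff.rfl

lemma isClosed_invariants : IsClosed (γ.invariants : Set γ.BanachAlgebra) := by
  have h : (γ.invariants : Set γ.BanachAlgebra) = ⋂ w, {x | γ.twistCompl w x = x} := by
    ext x
    simp only [Set.mem_iInter]
    rfl
  rw [h]
  exact isClosed_iInter fun w => isClosed_eq (γ.continuous_twistCompl w) continuous_id

instance : CompleteSpace γ.invariants := γ.isClosed_invariants.completeSpace_coe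

instance : IsUltrametricDist γ.invariants :=
  ⟨fun x y z => dist_triangle_max (x : γ.BanachAlgebra) y z⟩

instance : NormOneClass γ.invariants := ⟨norm_one (α := γ.BanachAlgebra)⟩

/-- The trace `x ↦ ∑_w w · x` from `K⟨Λ; γ⟩` to the invariants. -/
def trace [Fintype P.weylGroup] : γ.BanachAlgebra →ₗ[K] γ.invariants where
  toFun x := ⟨∑ w : P.weylGroup, w • x, fun v => by
    change v • (∑ w : P.weylGroup, w • x) = ∑ w : P.weylGroup, w • x
    simp only [Finset.smul_sum, smul_smul]
    exact Fintype.sum_equiv (Equiv.mulLeft v) _ _ fun w => rfl⟩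
  map_add' x y := Subtype.ext (by simp [Finset.sum_add_distrib])
  map_smul' r x := Subtype.ext (by simp [Finset.smul_sum, smul_comm])

lemma coe_trace [Fintype P.weylGroup] (x : γ.BanachAlgebra) :
    (γ.trace x : γ.BanachAlgebra) = ∑ w : P.weylGroup, w • x := rfl

lemma trace_coe [Fintype P.weylGroup] (x : γ.invariants) :
    γ.trace (x : γ.BanachAlgebra) = Fintype.card P.weylGroup • x := Subtype.ext (by
  rw [coe_trace, Finset.sum_congr rfl fun w _ => γ.mem_invariants.1 x.2 w, Finset.sum_const,
    Finset.card_univ]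
  rfl)

lemma continuous_trace [Fintype P.weylGroup] : Continuous γ.trace :=
  Continuous.subtype_mk (continuous_finsetSum _ fun w _ => γ.continuous_twistCompl w) _

end Action

/-! ### The completion and its invariants are affinoid -/

section Affinoid

variable [Module.Finite ℤ Λ] {K : Type*} [NontriviallyNormedField K] [CompleteSpace K]
  [IsUltrametricDist K] (γ : WeylCocycle b K)

/-- The density criterion applies to the group ring: `eq_sum_gen` expands each element with
coefficients bounded by its norm, and each `gen l` is in the algebra generated by a finite set. -/
theorem isAffinoid_banachAlgebra : IsAffinoid K γ.BanachAlgebra := by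
  obtain ⟨F, hF⟩ := γ.exists_finset_gen_mem_adjoin
  refine isAffinoid_of_dense (s := (fun l => γ.toCompl (γ.gen l)) '' F)
    (F.finite_toSet.image _) ?_ (D := γ.toCompl.toRingHom.toAddMonoidHom.range) (C := 1) (Λ := Λ)
    γ.denseRange_toCompl ?_
  · rintro _ ⟨l, -, rfl⟩
    rw [norm_toCompl, norm_gen]
  · rintro _ ⟨f, rfl⟩
    refine ⟨(γ.coeff f).support, fun l => γ.dom l * γ.coeff f l,
      fun l => γ.toCompl (γ.gen l), ?_, fun l _ => ⟨?_, γ.toCompl_gen_mem_adjoin (hF l)⟩⟩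
    · have h := congrArg γ.toCompl (γ.eq_sum_gen f)
      simp only [map_sum, map_smul] at h
      exact h
    · have h : ‖γ.toCompl.toRingHom.toAddMonoidHom f‖ = ‖f‖ := γ.norm_toCompl f
      rw [h, one_mul, norm_mul]
      exact γ.le_gnorm f l

theorem isAffinoid_invariants [CharZero K] : IsAffinoid K γ.invariants := by
  have := Fintype.ofFinite P.weylGroup
  obtain ⟨F, hF⟩ := γ.exists_finset_gen_mem_adjoin
  have : Nontrivial γ.BanachAlgebra := NormOneClass.nontrivial
  have hball : ∀ (w : P.weylGroup), ∀ x ∈ unitBall γ.BanachAlgebra,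
      w • x ∈ unitBall γ.BanachAlgebra := fun w x hx => (γ.norm_smul_le_norm w x).trans hx
  obtain ⟨t, htf, ht1, hti, ht⟩ := exists_finite_trace_mem_adjoin (k := unitBall K)
    (G := P.weylGroup) (unitBall γ.BanachAlgebra) hball
    (fun r => by
      have h : algebraMap (unitBall K) γ.BanachAlgebra r = algebraMap K γ.BanachAlgebra r := rfl
      rw [h, mem_unitBall, norm_algebraMap']
      exact r.2)
    (s := (fun l => γ.toCompl (γ.gen l)) '' F) (F.finite_toSet.image _) (by
      rintro _ ⟨l, -, rfl⟩
      exact ((γ.norm_toCompl _).trans (γ.norm_gen l)).le)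
  set N : K := (Fintype.card P.weylGroup : K) with hN
  have hN0 : N ≠ 0 := Nat.cast_ne_zero.2 Fintype.card_ne_zero
  let s : Set γ.invariants := Subtype.val ⁻¹' t
  have hst : (γ.invariants.val.restrictScalars (unitBall K)) '' s = t := by
    refine (Set.image_preimage_eq_iff).2 fun x hx => ⟨⟨x, fun w => hti x hx w⟩, rfl⟩
  have hs : ∀ l, γ.trace (γ.toCompl (γ.gen l)) ∈ Algebra.adjoin (unitBall K) s := fun l => by
    have h1 := ht _ (γ.toCompl_gen_mem_adjoin (hF l))
    rw [← hst, ← AlgHom.map_adjoin] at h1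
    obtain ⟨y, hy, hyl⟩ := h1
    have h2 : y = γ.trace (γ.toCompl (γ.gen l)) := Subtype.ext hyl
    rwa [← h2]
  refine isAffinoid_of_dense (s := s) (htf.preimage Subtype.val_injective.injOn)
    (fun x hx => ht1 hx)
    (D := (γ.trace.comp γ.toCompl.toLinearMap).toAddMonoidHom.range) (C := ‖N⁻¹‖)
    (Λ := Λ) ?_ ?_
  -- On invariants the trace is multiplication by `|W|`, which is invertible in `K`; so the trace is
  -- onto and sends the dense group ring to a dense subgroup.
  · have h1 : Function.Surjective γ.trace := fun x => ⟨(N⁻¹ • x : γ.invariants), by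
      rw [trace_coe, ← Nat.cast_smul_eq_nsmul K, smul_smul, mul_inv_cancel₀ hN0, one_smul]⟩
    exact h1.denseRange.comp γ.denseRange_toCompl γ.continuous_trace
  · rintro _ ⟨f, rfl⟩
    -- The norm of the trace of `f` does not control the coefficients of `f`. So its representative
    -- `g` in the group ring is expanded instead, and the trace is applied once more at the cost of
    -- the factor `N⁻¹`.
    let g : γ.GroupRing := ∑ w : P.weylGroup, γ.twist w f
    have hg : γ.toCompl g = (γ.trace (γ.toCompl f) : γ.BanachAlgebra) := by
      rw [coe_trace, map_sum]
      exact Finset.sum_congr rfl fun w _ => (γ.smul_toCompl w f).symm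
    have hgn : ‖γ.trace (γ.toCompl f)‖ = ‖g‖ := by
      rw [← norm_toCompl, hg]
      rfl
    refine ⟨(γ.coeff g).support, fun l => N⁻¹ * (γ.dom l * γ.coeff g l),
      fun l => γ.trace (γ.toCompl (γ.gen l)), ?_, fun l _ => ⟨?_, hs l⟩⟩
    · change γ.trace (γ.toCompl f) = _
      have h1 : γ.trace (γ.toCompl f) = N⁻¹ • γ.trace (γ.toCompl g) := by
        rw [hg, trace_coe, ← Nat.cast_smul_eq_nsmul K, smul_smul, inv_mul_cancel₀ hN0, one_smul]
      rw [h1]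
      conv_lhs => rw [γ.eq_sum_gen g]
      simp only [map_sum, map_smul, Finset.smul_sum, smul_smul]
    · change _ ≤ ‖N⁻¹‖ * ‖γ.trace (γ.toCompl f)‖
      rw [hgn, norm_mul, norm_mul (γ.dom l : K)]
      exact mul_le_mul_of_nonneg_left (γ.le_gnorm g l) (norm_nonneg _)

end Affinoid

end WeylCocycle

end AffinoidTorus

namespace AffinoidTorus

open Filter Topology Polynomial

universe u

/-! ### The domain `T'_γ` and its universal property -/

section Points

variable {K : Type*} [NontriviallyNormedField K] [IsUltrametricDist K] {A : Type*} [CommRing A]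
  [Algebra K A] {B : Type*} [CommRing B] [Algebra K B]

lemma absAt_le_one_iff (a : A) (x : MaximalSpectrum A) [Algebra.IsAlgebraic K (A ⧸ x.asIdeal)] :
    absAt (K := K) a x ≤ 1 ↔ IsIntegral (unitBall K) (Ideal.Quotient.mk x.asIdeal a) := by
  let _ : Field (A ⧸ x.asIdeal) := Ideal.Quotient.field x.asIdeal
  exact (isIntegral_unitBall_iff _).symm

lemma isIntegral_of_mem_adjoin (f : A →ₐ[K] B) {s : Set A}
    (hs : ∀ x ∈ s, IsIntegral (unitBall K) (f x)) {x : A}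
    (hx : x ∈ Algebra.adjoin (unitBall K) s) : IsIntegral (unitBall K) (f x) := by
  induction hx using Algebra.adjoin_induction with
  | mem x hx => exact hs x hx
  | algebraMap r =>
    have h : f (algebraMap (unitBall K) A r) = algebraMap (unitBall K) B r := f.commutes (r : K)
    rw [h]
    exact isIntegral_algebraMap
  | add x y _ _ hx hy => rw [map_add]; exact hx.add hy
  | mul x y _ _ hx hy => rw [map_mul]; exact hx.mul hy

variable {Λ : Type*} [AddCommGroup Λ] [Module.Finite ℤ Λ]

instance isAlgebraic_quotient_groupRing (x : MaximalSpectrum (AddMonoidAlgebra K Λ)) :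
    Algebra.IsAlgebraic K (AddMonoidAlgebra K Λ ⧸ x.asIdeal) := by
  let _ : Field (AddMonoidAlgebra K Λ ⧸ x.asIdeal) := Ideal.Quotient.field x.asIdeal
  have : AddMonoid.FG Λ := AddGroup.fg_iff_addMonoid_fg.1 (Module.Finite.iff_addGroup_fg.1 ‹_›)
  have : Algebra.FiniteType K (AddMonoidAlgebra K Λ ⧸ x.asIdeal) := inferInstance
  have : Module.Finite K (AddMonoidAlgebra K Λ ⧸ x.asIdeal) :=
    finite_of_finite_type_of_isJacobsonRing _ _
  exact Algebra.IsAlgebraic.of_finite K _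

end Points

section Bounded

variable {K : Type*} [NontriviallyNormedField K] [IsUltrametricDist K] {A : Type*}
  [NormedCommRing A] [NormedAlgebra K A]

lemma exists_norm_prod_pow_le {σ : Type*} (a : σ → A) (S : Finset σ)
    (h : ∀ i, ∃ M, ∀ k : ℕ, ‖a i ^ k‖ ≤ M) :
    ∃ M, 0 ≤ M ∧ ∀ d : σ → ℕ, ‖∏ i ∈ S, a i ^ d i‖ ≤ M := by
  classical
  induction S using Finset.induction_on with
  | empty => exact ⟨‖(1 : A)‖, norm_nonneg _, fun d => by simp⟩
  | insert i S hi ih =>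
    obtain ⟨M, hM0, hM⟩ := ih
    obtain ⟨N, hN⟩ := h i
    have hN0 : 0 ≤ N := (norm_nonneg _).trans (hN 0)
    refine ⟨N * M, mul_nonneg hN0 hM0, fun d => ?_⟩
    rw [Finset.prod_insert hi]
    exact (norm_mul_le _ _).trans (mul_le_mul (hN _) (hM d) (norm_nonneg _) hN0)

/-- The algebra generated by finitely many power-bounded elements is bounded. -/
lemma IsAffinoid.exists_norm_le_of_mem_adjoin (hA : IsAffinoid K A) {s : Set A} (hs : s.Finite)
    (h : ∀ a ∈ s, ∃ M, ∀ k : ℕ, ‖a ^ k‖ ≤ M) :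
    ∃ M, 0 ≤ M ∧ ∀ y ∈ Algebra.adjoin (unitBall K) s, ‖y‖ ≤ M := by
  have := hs.fintype
  obtain ⟨C, hC0, hC⟩ := hA.exists_norm_sum_le
  obtain ⟨M, hM0, hM⟩ := exists_norm_prod_pow_le (fun i : s => (i : A)) Finset.univ
    fun i => h i i.2
  refine ⟨C * M, mul_nonneg hC0 hM0, fun y hy => ?_⟩
  have h1 := Algebra.adjoin_range_eq_range_aeval (unitBall K) (fun i : s => (i : A))
  rw [Subtype.range_coe] at h1
  rw [h1] at hy
  obtain ⟨p, rfl⟩ := hy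
  have h2 : MvPolynomial.aeval (R := unitBall K) (fun i : s => (i : A)) p =
      ∑ d ∈ p.support, ((p.coeff d : unitBall K) : K) • ∏ i : s, (i : A) ^ d i := by
    rw [MvPolynomial.aeval_def, MvPolynomial.eval₂_eq']
    refine Finset.sum_congr rfl fun d _ => ?_
    rw [Algebra.smul_def]
    rfl
  change ‖MvPolynomial.aeval (R := unitBall K) (fun i : s => (i : A)) p‖ ≤ _
  rw [h2]
  refine hC _ _ M hM0 fun d _ => ?_
  rw [norm_smul]
  exact (mul_le_of_le_one_left (norm_nonneg _) (p.coeff d).2).trans (hM _)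

end Bounded

namespace WeylCocycle

variable {ι X Λ : Type*} [AddCommGroup X] [AddCommGroup Λ] {P : RootDatum ι X Λ} {b : P.Base}
  [Finite ι] [P.IsReduced] [Module.Finite ℤ Λ]

section Domain

variable {K : Type*} [NontriviallyNormedField K] [IsUltrametricDist K] (γ : WeylCocycle b K)

/-- The subset `T'_γ` of the rigid analytic torus. -/
def domain : Set (MaximalSpectrum (AddMonoidAlgebra K Λ)) :=
  {x | ∀ l, absAt (K := K) (AddMonoidAlgebra.single l ((γ.dom l)⁻¹ : Kˣ).val) x ≤ 1}

/-- Integral values at the finitely many generators force integral values at every `gen l`, a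
polynomial in them over the unit ball of `K`. -/
lemma exists_finset_domain_eq : ∃ F : Finset Λ, γ.domain = {x | ∀ l ∈ F,
    absAt (K := K) (AddMonoidAlgebra.single l ((γ.dom l)⁻¹ : Kˣ).val) x ≤ 1} := by
  obtain ⟨F, hF⟩ := γ.exists_finset_gen_mem_adjoin
  refine ⟨F, Set.ext fun x => ⟨fun hx l _ => hx l, fun hx l => ?_⟩⟩
  rw [absAt_le_one_iff]
  refine isIntegral_of_mem_adjoin
    ((Ideal.Quotient.mkₐ K x.asIdeal).comp γ.toGroupRing.symm.toAlgHom) ?_ (hF l)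
  rintro _ ⟨m, hm, rfl⟩
  exact (absAt_le_one_iff (AddMonoidAlgebra.single m ((γ.dom m)⁻¹ : Kˣ).val) x).1 (hx m hm)

variable [CompleteSpace K]

/-- By the Nullstellensatz the residue field at `m` is algebraic over `K`, so `m` pulls back to a
maximal ideal. The `gen l` have norm 1, hence integral values. -/
theorem mapsInto_domain : MapsInto γ.incl γ.domain := by
  intro m
  let _ : Field (γ.BanachAlgebra ⧸ m.asIdeal) := Ideal.Quotient.field m.asIdeal
  have := γ.isAffinoid_banachAlgebra.isAlgebraic (Ideal.Quotient.mkₐ K m.asIdeal)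
    (Ideal.Quotient.mkₐ_surjective K m.asIdeal)
  let f : AddMonoidAlgebra K Λ →ₐ[K] γ.BanachAlgebra ⧸ m.asIdeal :=
    (Ideal.Quotient.mkₐ K m.asIdeal).comp γ.incl
  have hf : f.toRingHom.IsIntegral := by
    refine RingHom.IsIntegral.tower_top (algebraMap K (AddMonoidAlgebra K Λ)) f.toRingHom ?_
    have h : f.toRingHom.comp (algebraMap K _) = algebraMap K (γ.BanachAlgebra ⧸ m.asIdeal) :=
      RingHom.ext f.commutes
    rw [h]
    exact Algebra.IsIntegral.isIntegral
  have hmax : (RingHom.ker f).IsMaximal :=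
    Ideal.isMaximal_comap_of_isIntegral_of_isMaximal' f.toRingHom hf ⊥
  let x : MaximalSpectrum (AddMonoidAlgebra K Λ) := ⟨RingHom.ker f, hmax⟩
  have := isAlgebraic_quotient_groupRing x
  refine ⟨x, fun l => (absAt_le_one_iff _ x).2 ?_, ?_⟩
  · rw [← isIntegral_algHom_iff ((Ideal.kerLiftAlg f).restrictScalars (unitBall K))
      (Ideal.kerLiftAlg_injective f)]
    exact isIntegral_map_of_norm_le_one (Ideal.Quotient.mkₐ K m.asIdeal)
      ((γ.norm_toCompl _).trans (γ.norm_gen l)).le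
  · ext a
    exact Ideal.Quotient.eq_zero_iff_mem

end Domain

section Universal

variable {K : Type u} [NontriviallyNormedField K] [IsUltrametricDist K] [CompleteSpace K]
  (γ : WeylCocycle b K)

omit [CompleteSpace K] in
lemma isIntegral_of_mapsInto {C : Type*} [CommRing C] [Algebra K C]
    {ψ : AddMonoidAlgebra K Λ →ₐ[K] C} (hψ : MapsInto ψ γ.domain) {F : Type*} [Field F]
    [Algebra K F] (f : C →ₐ[K] F) (hf : Function.Surjective f) (l : Λ) :
    IsIntegral (unitBall K) (f (ψ (γ.toGroupRing.symm (γ.gen l)))) := by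
  have hm : (RingHom.ker f).IsMaximal := RingHom.ker_isMaximal_of_surjective f hf
  obtain ⟨x, hx, hxm⟩ := hψ ⟨RingHom.ker f, hm⟩
  have h0 : ∀ a ∈ x.asIdeal, (f.comp ψ) a = 0 := fun a ha => by
    rw [hxm] at ha
    exact ha
  have h1 := (absAt_le_one_iff _ _).1 (hx l)
  exact h1.map ((Ideal.Quotient.liftₐ x.asIdeal (f.comp ψ) h0).restrictScalars (unitBall K))

/-- The images of the finitely many generators have integral values at all points of `C`, so they
are power-bounded and generate a bounded algebra over the unit ball of `K`. This bounds all `gen l`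
uniformly, and `eq_sum_gen` then bounds the map. -/
theorem exists_norm_le_of_mapsInto {C : Type*} [NormedCommRing C] [NormedAlgebra K C]
    (hC : IsAffinoid K C) {ψ : AddMonoidAlgebra K Λ →ₐ[K] C} (hψ : MapsInto ψ γ.domain) :
    ∃ M, ∀ f : γ.GroupRing, ‖ψ (γ.toGroupRing.symm f)‖ ≤ M * ‖f‖ := by
  obtain ⟨F, hF⟩ := γ.exists_finset_gen_mem_adjoin
  let ψ' : γ.GroupRing →ₐ[K] C := ψ.comp γ.toGroupRing.symm.toAlgHom
  have hpow : ∀ a ∈ (fun l => ψ' (γ.gen l)) '' F, ∃ M, ∀ k : ℕ, ‖a ^ k‖ ≤ M := by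
    rintro _ ⟨l, -, rfl⟩
    exact hC.exists_norm_pow_le fun _ _ _ f hf => γ.isIntegral_of_mapsInto hψ f hf l
  obtain ⟨M, hM0, hM⟩ := hC.exists_norm_le_of_mem_adjoin (F.finite_toSet.image _) hpow
  obtain ⟨D, hD0, hD⟩ := hC.exists_norm_sum_le
  have hgen : ∀ l, ‖ψ' (γ.gen l)‖ ≤ M := fun l => hM _ (by
    have h1 := AlgHom.map_adjoin (ψ'.restrictScalars (unitBall K)) (γ.gen '' F)
    rw [← Set.image_comp] at h1
    have h2 : ψ' (γ.gen l) ∈ (Algebra.adjoin (unitBall K) (γ.gen '' F)).map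
      (ψ'.restrictScalars (unitBall K)) := ⟨_, hF l, rfl⟩
    rw [h1] at h2
    exact h2)
  refine ⟨D * M, fun f => ?_⟩
  change ‖ψ' f‖ ≤ _
  have h1 : ψ' f = ∑ l ∈ (γ.coeff f).support, (γ.dom l * γ.coeff f l : K) • ψ' (γ.gen l) := by
    conv_lhs => rw [γ.eq_sum_gen f]
    simp only [map_sum, map_smul]
  rw [h1, mul_assoc]
  refine hD _ _ _ (mul_nonneg hM0 (norm_nonneg _)) fun l _ => ?_
  rw [norm_smul, norm_mul, mul_comm M]
  exact mul_le_mul (γ.le_gnorm f l) (hgen l) (norm_nonneg _) (norm_nonneg _)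

theorem existsUnique_extension {C : Type*} [NormedCommRing C] [NormedAlgebra K C]
    (hC : IsAffinoid K C) {ψ : AddMonoidAlgebra K Λ →ₐ[K] C} (hψ : MapsInto ψ γ.domain) :
    ∃! β : γ.BanachAlgebra →A[K] C, (β : γ.BanachAlgebra →ₐ[K] C).comp γ.incl = ψ := by
  have := hC.completeSpace
  obtain ⟨M, hM⟩ := γ.exists_norm_le_of_mapsInto hC hψ
  let ψ' : γ.GroupRing →ₐ[K] C := ψ.comp γ.toGroupRing.symm.toAlgHom
  have hc : Continuous (ψ' : γ.GroupRing →+* C) :=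
    AddMonoidHomClass.continuous_of_bound ψ' M hM
  let E := UniformSpace.Completion.extensionHom (ψ' : γ.GroupRing →+* C) hc
  have hE : ∀ f : γ.GroupRing, E (f : γ.BanachAlgebra) = ψ' f := fun f =>
    UniformSpace.Completion.extensionHom_coe _ hc f
  let β : γ.BanachAlgebra →A[K] C :=
    { E with
      commutes' := fun r => (hE (algebraMap K _ r)).trans (ψ'.commutes r)
      cont := UniformSpace.Completion.continuous_extension }
  refine ⟨β, AlgHom.ext fun a => hE (γ.toGroupRing a), fun β' hβ' => ?_⟩
  refine DFunLike.coe_injective (γ.denseRange_toCompl.equalizer β'.cont β.cont (funext fun f => ?_))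
  have h1 : β' (γ.toCompl f) = ψ (γ.toGroupRing.symm f) :=
    DFunLike.congr_fun hβ' (γ.toGroupRing.symm f)
  exact h1.trans (hE f).symm

theorem isAffinoidSubdomain_domain : IsAffinoidSubdomain γ.domain γ.incl where
  isAffinoid := γ.isAffinoid_banachAlgebra
  mapsInto := γ.mapsInto_domain
  existsUnique _ _ _ hC _ hψ := γ.existsUnique_extension hC hψ

end Universal

end WeylCocycle

end AffinoidTorus

namespace AffinoidTorus

open Filter Topology

/-! ### Convex hulls tested on a lattice -/

section ConvexHull

variable {Λ : Type*} [AddCommGroup Λ]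

/-- Finitely many strict homogeneous linear inequalities with a real solution have an integral
solution. -/
lemma exists_int_sum_mul_neg {ι σ : Type*} [Fintype ι] [Finite σ] (a : σ → ι → ℝ) (c : ι → ℝ)
    (hc : ∀ s, ∑ i, c i * a s i < 0) : ∃ n : ι → ℤ, ∀ s, ∑ i, (n i : ℝ) * a s i < 0 := by
  classical
  have hopen : IsOpen {c : ι → ℝ | ∀ s, ∑ i, c i * a s i < 0} := by
    simp only [Set.ofPred_forall]
    exact isOpen_iInter_of_finite fun s => isOpen_lt (by fun_prop) continuous_const
  -- The strict inequalities define an open set, so a real solution may be replaced by a rational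
  -- one; the product `D` of the denominators makes it integral.
  have hdense : DenseRange fun (q : ι → ℚ) (i : ι) => (q i : ℝ) :=
    DenseRange.piMap fun _ => Rat.denseRange_cast
  obtain ⟨q, hq⟩ := hdense.exists_mem_open hopen ⟨c, hc⟩
  let D : ℕ := ∏ i, (q i).den
  have hD : 0 < D := Finset.prod_pos fun i _ => (q i).den_pos
  have hint : ∀ i, ∃ n : ℤ, (n : ℝ) = (q i : ℝ) * D := fun i => by
    obtain ⟨k, hk⟩ : (q i).den ∣ D := Finset.dvd_prod_of_mem _ (Finset.mem_univ i)
    refine ⟨(q i).num * k, ?_⟩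
    have h1 : (q i : ℝ) * ((q i).den : ℝ) = (q i).num := by exact_mod_cast Rat.mul_den_eq_num (q i)
    rw [hk]
    push_cast
    rw [← mul_assoc, h1]
  choose n hn using hint
  refine ⟨n, fun s => ?_⟩
  have h1 : ∑ i, (n i : ℝ) * a s i = D * ∑ i, (q i : ℝ) * a s i := by
    rw [Finset.mul_sum]
    refine Finset.sum_congr rfl fun i _ => ?_
    rw [hn]
    ring
  rw [h1]
  exact mul_neg_of_pos_of_neg (by exact_mod_cast hD) (hq s)

/-- The convex hull of finitely many real characters of a lattice is determined by its support
function on the lattice. -/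
lemma mem_convexHull_range_iff [Module.Finite ℤ Λ] {σ : Type*} [Finite σ] (p : σ → Λ →+ ℝ)
    (v : Λ →+ ℝ) : v ∈ convexHull ℝ (Set.range p) ↔ ∀ l, ∃ s, p s l ≤ v l := by
  constructor
  · intro hv l
    by_contra! h
    have h1 : Convex ℝ {q : Λ →+ ℝ | v l < q l} := by
      intro x hx y hy s t hs ht hst
      have h2 : v l < s * x l + t * y l := by
        have hx' : v l < x l := hx
        have hy' : v l < y l := hy
        have h3 : v l = s * v l + t * v l := by rw [← add_mul, hst, one_mul]
        rcases hs.eq_or_lt with h0 | h0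
        · rw [← h0, zero_add] at hst
          rw [← h0, hst]
          linarith
        · have h4 := mul_lt_mul_of_pos_left hx' h0
          have h5 := mul_le_mul_of_nonneg_left hy'.le ht
          linarith
      exact h2
    have h2 : Set.range p ⊆ {q : Λ →+ ℝ | v l < q l} := by
      rintro _ ⟨s, rfl⟩
      exact h s
    have h3 : v l < v l := convexHull_min h2 h1 hv
    exact lt_irrefl _ h3
  · intro h
    by_contra hv
    obtain ⟨n, e, he⟩ := Module.Finite.exists_fin (R := ℤ) (M := Λ)
    let ev : (Λ →+ ℝ) →ₗ[ℝ] (Fin n → ℝ) :=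
      { toFun := fun q i => q (e i)
        map_add' := fun _ _ => rfl
        map_smul' := fun _ _ => rfl }
    have hinj : Function.Injective ev := fun q r hqr => by
      have h1 : q.toIntLinearMap = r.toIntLinearMap := by
        refine LinearMap.ext_on_range he fun i => congrFun hqr i
      exact AddMonoidHom.ext fun l => DFunLike.congr_fun h1 l
    have hv' : ev v ∉ convexHull ℝ (ev '' Set.range p) := by
      rw [← LinearMap.image_convexHull]
      rintro ⟨q, hq, hqv⟩
      exact hv (hinj hqv ▸ hq)
    have hfin : (ev '' Set.range p).Finite := (Set.finite_range p).image _
    obtain ⟨f, u, hfv, hfu⟩ := geometric_hahn_banach_point_closed (convex_convexHull ℝ _)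
      (hfin.isClosed_convexHull ℝ) hv'
    have hf : ∀ y : Fin n → ℝ, f y = ∑ i, f (Pi.single i 1) * y i := fun y => by
      conv_lhs => rw [pi_eq_sum_univ' y]
      rw [map_sum]
      refine Finset.sum_congr rfl fun i _ => ?_
      rw [map_smul, smul_eq_mul, mul_comm]
    -- The functional `f` separates `v` strictly from all the points `p s`. Replacing its
    -- coefficients by integers yields an element of `Λ` at which `v` is smaller than every `p s`.
    obtain ⟨m, hm⟩ := exists_int_sum_mul_neg (fun s i => v (e i) - p s (e i))
      (fun i => f (Pi.single i 1)) fun s => by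
        have h1 := hfv.trans (hfu _ (subset_convexHull ℝ _ ⟨p s, ⟨s, rfl⟩, rfl⟩))
        rw [← sub_neg, ← map_sub, hf] at h1
        exact h1
    obtain ⟨s, hs⟩ := h (∑ i, m i • e i)
    have h1 := hm s
    have h2 : ∑ i, (m i : ℝ) * (v (e i) - p s (e i)) =
        v (∑ i, m i • e i) - p s (∑ i, m i • e i) := by
      simp only [map_sum, map_zsmul, zsmul_eq_mul, mul_sub, Finset.sum_sub_distrib]
    rw [h2] at h1
    linarith

end ConvexHull

/-! ### The valuation of `L` and the map `val` -/

section Valuation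

variable {p : ℕ} [Fact p.Prime] {K : Type*} [NormedField K] [NormedAlgebra ℚ_[p] K]
  (L : IntermediateField ℚ_[p] K)

/-- The norm of `y` is a root, of order at most `[L : ℚ_p]`, of the absolute value of the constant
term of its minimal polynomial. That constant term lies in `ℚ_p` and has absolute value less than 1,
hence at most `p⁻¹`. -/
lemma norm_le_of_norm_lt_one [IsUltrametricDist K] [FiniteDimensional ℚ_[p] L] {y : K}
    (hy : y ∈ L) (h : ‖y‖ < 1) :
    ‖y‖ ≤ ((p : ℝ)⁻¹) ^ (1 / Module.finrank ℚ_[p] L : ℝ) := by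
  have hp1 : (1 : ℝ) < p := by exact_mod_cast (Fact.out : p.Prime).one_lt
  set x : L := ⟨y, hy⟩ with hx
  set P := minpoly ℚ_[p] x with hP
  have hint : IsIntegral ℚ_[p] x := Algebra.IsIntegral.isIntegral x
  have hd : 0 < P.natDegree := minpoly.natDegree_pos hint
  have hdn : P.natDegree ≤ Module.finrank ℚ_[p] L := minpoly.natDegree_le x
  have h1 : ‖y‖ = ‖P.coeff 0‖ ^ (1 / P.natDegree : ℝ) := by
    rw [hP, ← spectralNorm.spectralNorm_eq_norm_coeff_zero_rpow,
      ← NormedAlgebra.norm_eq_spectralNorm ℚ_[p] x]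
    rfl
  have hd' : (0 : ℝ) < 1 / P.natDegree := by positivity
  have h2 : ‖P.coeff 0‖ < 1 := by
    by_contra! h2
    exact absurd (Real.one_le_rpow h2 hd'.le) (not_le.2 (h1 ▸ h))
  have h3 : ‖P.coeff 0‖ ≤ (p : ℝ)⁻¹ := by
    by_cases h0 : P.coeff 0 = 0
    · rw [h0, norm_zero]; positivity
    · have h4 := (Padic.norm_le_pow_iff_norm_lt_pow_add_one (P.coeff 0) (-1)).2
        (by simpa using h2)
      simpa using h4
  rw [h1]
  refine (Real.rpow_le_rpow (norm_nonneg _) h3 hd'.le).trans ?_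
  refine Real.rpow_le_rpow_of_exponent_ge (by positivity) (inv_le_one_of_one_le₀ hp1.le) ?_
  exact one_div_le_one_div_of_le (by exact_mod_cast hd) (by exact_mod_cast hdn)

/-- The element `p` of `L` bounds the supremum from below and `norm_le_of_norm_lt_one` bounds it
away from 1. So the logarithm dividing in `valL` is negative and `valL` reverses order. -/
lemma absUniformizer_pos_lt_one [IsUltrametricDist K] [FiniteDimensional ℚ_[p] L] :
    0 < absUniformizer L ∧ absUniformizer L < 1 := by
  have hp1 : (1 : ℝ) < p := by exact_mod_cast (Fact.out : p.Prime).one_lt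
  have hn : 0 < Module.finrank ℚ_[p] L := Module.finrank_pos
  set c : ℝ := ((p : ℝ)⁻¹) ^ (1 / Module.finrank ℚ_[p] L : ℝ) with hc
  have hc1 : c < 1 := Real.rpow_lt_one (by positivity) (inv_lt_one_of_one_lt₀ hp1) (by positivity)
  have hub : ∀ r ∈ {r : ℝ | ∃ y ∈ L, ‖y‖ = r ∧ r < 1}, r ≤ c := by
    rintro _ ⟨y, hy, rfl, h⟩
    exact norm_le_of_norm_lt_one L hy h
  have hmem : (p : ℝ)⁻¹ ∈ {r : ℝ | ∃ y ∈ L, ‖y‖ = r ∧ r < 1} :=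
    ⟨algebraMap ℚ_[p] K p, L.algebraMap_mem _, by rw [norm_algebraMap', Padic.norm_p],
      inv_lt_one_of_one_lt₀ hp1⟩
  exact ⟨(inv_pos.2 (by linarith)).trans_le (le_csSup ⟨c, hub⟩ hmem),
    (csSup_le ⟨_, hmem⟩ hub).trans_lt hc1⟩

lemma valL_le_valL_iff [IsUltrametricDist K] [FiniteDimensional ℚ_[p] L] {r s : ℝ} (hr : 0 < r)
    (hs : 0 < s) : valL L r ≤ valL L s ↔ s ≤ r := by
  obtain ⟨h0, h1⟩ := absUniformizer_pos_lt_one L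
  rw [valL, valL, div_le_div_right_of_neg (Real.log_neg h0 h1), Real.log_le_log_iff hs hr]

end Valuation

section Torus

variable {Λ K : Type*} [AddCommGroup Λ] [Module.Finite ℤ Λ] [NontriviallyNormedField K]
  [IsUltrametricDist K] [CompleteSpace K]

omit [CompleteSpace K] [Module.Finite ℤ Λ] [IsUltrametricDist K] in
lemma absAt_algebraMap (c : K) (x : MaximalSpectrum (AddMonoidAlgebra K Λ)) :
    absAt (K := K) (algebraMap K (AddMonoidAlgebra K Λ) c) x = ‖c‖ := by
  let _ : Field (AddMonoidAlgebra K Λ ⧸ x.asIdeal) := Ideal.Quotient.field x.asIdeal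
  exact spectralNorm_extends c

lemma absAt_single (l : Λ) (c : K) (x : MaximalSpectrum (AddMonoidAlgebra K Λ)) :
    absAt (K := K) (AddMonoidAlgebra.single l c) x =
      ‖c‖ * absAt (K := K) (AddMonoidAlgebra.single l (1 : K)) x := by
  rw [← absAt_algebraMap c x, ← absAt_mul]
  congr 1
  rw [← Algebra.smul_def, AddMonoidAlgebra.smul_single, smul_eq_mul, mul_one]

lemma absAt_single_pos (l : Λ) (x : MaximalSpectrum (AddMonoidAlgebra K Λ)) :
    0 < absAt (K := K) (AddMonoidAlgebra.single l (1 : K)) x := by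
  let _ : Field (AddMonoidAlgebra K Λ ⧸ x.asIdeal) := Ideal.Quotient.field x.asIdeal
  refine lt_of_le_of_ne (spectralNorm_nonneg _) fun h0 => ?_
  have h1 := absAt_mul (AddMonoidAlgebra.single l (1 : K)) (AddMonoidAlgebra.single (-l) 1) x
  rw [← h0, zero_mul, AddMonoidAlgebra.single_mul_single, add_neg_cancel, mul_one,
    ← AddMonoidAlgebra.one_def, absAt_one] at h1
  exact one_ne_zero h1

omit [CompleteSpace K] [Module.Finite ℤ Λ] [IsUltrametricDist K] in
lemma absAt_torusPoint (ζ : Multiplicative Λ →* Kˣ) (l : Λ) :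
    absAt (K := K) (AddMonoidAlgebra.single l (1 : K)) (torusPoint ζ) = ‖(ζ (.ofAdd l) : K)‖ := by
  rw [← absAt_algebraMap _ (torusPoint ζ), absAt, absAt]
  congr 1
  rw [Ideal.Quotient.eq]
  change AddMonoidAlgebra.lift K K Λ ((Units.coeHom K).comp ζ) _ = 0
  rw [map_sub, AlgHom.commutes, AddMonoidAlgebra.lift_single]
  simp

end Torus

namespace WeylCocycle

variable {ι X Λ : Type*} [AddCommGroup X] [AddCommGroup Λ] {P : RootDatum ι X Λ} {b : P.Base}
  [Finite ι] [P.IsReduced] [Module.Finite ℤ Λ] {K : Type*} [NontriviallyNormedField K]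
  [IsUltrametricDist K] [CompleteSpace K] (γ : WeylCocycle b K)

lemma mem_domain_iff (x : MaximalSpectrum (AddMonoidAlgebra K Λ)) : x ∈ γ.domain ↔
    ∀ l, absAt (K := K) (AddMonoidAlgebra.single l (1 : K)) x ≤ ‖(γ.dom l : K)‖ := by
  refine forall_congr' fun l => ?_
  rw [absAt_single, Units.val_inv_eq_inv_val, norm_inv, inv_mul_le_iff₀ (γ.norm_dom_pos l), mul_one]

lemma torusPoint_mem_domain_iff (ζ : Multiplicative Λ →* Kˣ) :
    torusPoint ζ ∈ γ.domain ↔ ζ ∈ γ.domainPoints := by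
  rw [mem_domain_iff]
  simp only [absAt_torusPoint]
  rfl

/-- As `|γ^dom(λ)|` is the maximum of the `|γ(w, λ)|`, the inequality defining the domain at `λ`
says that `|λ(x)| ≤ |γ(w, λ)|` for some `w`. Since `valL` reverses order, this is the test of
`mem_convexHull_range_iff` for the points `-z_w`; the inverse in `z_w` only permutes `W`. -/
theorem domain_eq_preimage_convexHull {p : ℕ} [Fact p.Prime] [NormedAlgebra ℚ_[p] K]
    (L : IntermediateField ℚ_[p] K) [FiniteDimensional ℚ_[p] L] :
    γ.domain = valPoint L ⁻¹' convexHull ℝ (Set.range fun w : P.weylGroup => -γ.zPoint L w) := by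
  ext x
  rw [mem_domain_iff, Set.mem_preimage, mem_convexHull_range_iff]
  refine forall_congr' fun l => ?_
  have h : ∀ w : P.weylGroup, (-γ.zPoint L w) l ≤ valPoint L x l ↔
      absAt (K := K) (AddMonoidAlgebra.single l (1 : K)) x ≤ ‖(γ w⁻¹ l : K)‖ := fun w => by
    rw [zPoint, neg_neg]
    exact valL_le_valL_iff L (norm_pos_iff.2 (Units.ne_zero _)) (absAt_single_pos l x)
  simp only [h]
  constructor
  · intro hx
    obtain ⟨w, hw⟩ := exists_antidominant b l
    exact ⟨w⁻¹, by rwa [inv_inv, ← γ.norm_dom_eq w l hw]⟩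
  · rintro ⟨w, hw⟩
    exact hw.trans (γ.norm_le_dom _ l)

end WeylCocycle

end AffinoidTorus

theorem proposition2p4 {p : ℕ} [Fact p.Prime] {K : Type*} [NontriviallyNormedField K]
    [CompleteSpace K] [IsUltrametricDist K] [NormedAlgebra ℚ_[p] K]
    (L : IntermediateField ℚ_[p] K) [FiniteDimensional ℚ_[p] L]
    {ι X Λ : Type*} [Finite ι] [AddCommGroup X] [AddCommGroup Λ] [Module.Finite ℤ X]
    [Module.Finite ℤ Λ] {P : RootDatum ι X Λ} [P.IsReduced] {b : P.Base}
    (γ : AffinoidTorus.WeylCocycle b K) :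
    (∃ U : Set (MaximalSpectrum (AddMonoidAlgebra K Λ)),
      (∀ ζ : Multiplicative Λ →* Kˣ, AffinoidTorus.torusPoint ζ ∈ U ↔ ζ ∈ γ.domainPoints) ∧
      (∃ F : Finset Λ, U = {x | ∀ l ∈ F,
        AffinoidTorus.absAt (K := K) (AddMonoidAlgebra.single l ((γ.dom l)⁻¹ : Kˣ).val) x ≤ 1}) ∧
      AffinoidTorus.IsAffinoidSubdomain U γ.incl ∧
      U = AffinoidTorus.valPoint L ⁻¹'
        convexHull ℝ (Set.range fun w : P.weylGroup => -γ.zPoint L w)) ∧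
    AffinoidTorus.IsAffinoid K γ.invariants := by
  have : CharZero K := charZero_of_injective_algebraMap (algebraMap ℚ_[p] K).injective
  exact ⟨⟨γ.domain, γ.torusPoint_mem_domain_iff, γ.exists_finset_domain_eq,
    γ.isAffinoidSubdomain_domain, γ.domain_eq_preimage_convexHull L⟩, γ.isAffinoid_invariants⟩
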